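/- \textbf{Generalized Rellich's Lemma II.} Let $D\subset\mathbb{R}^2$ be a bounded open set with Lipschitz boundary whose exterior $\mathbb{R}^2\setminus\overline{D}$ is connected, and let $\nu$ be the unit normal to $\partial D$ pointing out of $D$. Let $k\in\mathbb{C}\setminus\mathbb{R}_{\le 0}$ and let $$\Phi_k(x,y)=\frac{i}{4}H^{(1)}_0(k|x-y|),\qquad x\neq y,$$ where $H^{(1)}_0=J_0+iY_0$ is the Hankel function of the first kind of order zero (principal branch on $\mathbb{C}\setminus\mathbb{R}_{\le 0}$). Let $u\in C^2(\mathbb{R}^2\setminus\overline{D})$ satisfy $\Delta u+k^2u=0$ in $\mathbb{R}^2\setminus\overline{D}$, and suppose that $u$ is outgoing, i.e. $u\in H^1(B_R\setminus\overline D)$ for every disk $B_R=\{|x|<R\}$ and $$u(x)=\int_{\partial D}\Big\{\frac{\partial \Phi_k(x,y)}{\partial\nu(y)}\,u(y)-\Phi_k(x,y)\,\frac{\partial u}{\partial\nu}(y)\Big\}\,ds(y),\qquad x\in\mathbb{R}^2\setminus\overline{D}.$$ Here $u|_{\partial D}\in H^{1/2}(\partial D)$ is the trace of $u$ from the exterior,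 and $\partial u/\partial\nu\in H^{-1/2}(\partial D)$ is defined by $\int_{\partial D}\frac{\partial u}{\partial \nu}\varphi\,ds=-\int_{\mathbb{R}^2\setminus\overline D}(\nabla u\cdot\nabla\varphi-k^2u\varphi)\,dx$ for $\varphi\in C_c^\infty(\mathbb{R}^2)$, the second term of the integral above being understood as a duality pairing. If $$\lim_{r\to\infty}e^{2\,\mathrm{Im}(kr)}\int_{|x|=r}|u(x)|^2\,ds=0,$$ then $u=0$ in $\mathbb{R}^2\setminus\overline{D}$. -/

import Mathlib

open Set Filter Topology MeasureTheory
open scoped ContDiff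

noncomputable section

namespace Scattering

/-- The Euclidean plane `ℝ²`. -/
abbrev Plane : Type := EuclideanSpace ℝ (Fin 2)

/-- `D ⊂ ℝ²` is a bounded open set with Lipschitz boundary: near each boundary point `D`
coincides, in a suitable orthonormal coordinate system, with the region strictly below the graph
of a Lipschitz function. -/
def IsLipschitzDomain (D : Set Plane) : Prop :=
  IsOpen D ∧ Bornology.IsBounded D ∧
    ∀ p ∈ frontier D, ∃ (A : Plane ≃ₗᵢ[ℝ] Plane) (L : NNReal) (γ : ℝ → ℝ),
      LipschitzWith L γ ∧ ∀ᶠ x in 𝓝 p, (x ∈ D ↔ (A x) 1 < γ ((A x) 0))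

/-- Arc length on the boundary `∂D` (the restriction of the one-dimensional Hausdorff measure). -/
def boundaryMeasure (D : Set Plane) : Measure Plane :=
  (Measure.hausdorffMeasure 1).restrict (frontier D)

/-- `n` is the outward unit normal to `∂D` at `y`: outside every double cone around the tangent
line `n^⊥`, the points close to `y` on the side of `-n` lie in `D` and those on the side of `n`
lie outside of the closure of `D`. -/
def IsOutwardUnitNormalAt (D : Set Plane) (y n : Plane) : Prop :=
  ‖n‖ = 1 ∧ ∀ ε > 0, ∀ᶠ z in 𝓝 y,
    (inner ℝ (z - y) n < -ε * ‖z - y‖ → z ∈ D) ∧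
    (ε * ‖z - y‖ < inner ℝ (z - y) n → z ∉ closure D)

/-- `ν` is the (measurable, almost everywhere defined) outward unit normal field of `∂D`. -/
def IsOutwardUnitNormal (D : Set Plane) (ν : Plane → Plane) : Prop :=
  AEStronglyMeasurable ν (boundaryMeasure D) ∧
    ∀ᵐ y ∂(boundaryMeasure D), IsOutwardUnitNormalAt D y (ν y)

/-- The Bessel function `J₀`. -/
def besselJ0 (z : ℂ) : ℂ :=
  ∑' m : ℕ, (-1) ^ m / (m.factorial : ℂ) ^ 2 * (z / 2) ^ (2 * m)

/-- The Bessel function of the second kind `Y₀`, with the principal branch of the logarithm; here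
`harmonic m = 1 + 1/2 + ⋯ + 1/m`. -/
def besselY0 (z : ℂ) : ℂ :=
  2 / (Real.pi : ℂ) * (Complex.log (z / 2) + (Real.eulerMascheroniConstant : ℂ)) * besselJ0 z -
    2 / (Real.pi : ℂ) *
      ∑' m : ℕ, (-1) ^ m * ((harmonic m : ℚ) : ℂ) / (m.factorial : ℂ) ^ 2 * (z / 2) ^ (2 * m)

/-- The Hankel function of the first kind of order zero, `H₀⁽¹⁾ = J₀ + i Y₀`. -/
def hankelH0 (z : ℂ) : ℂ := besselJ0 z + Complex.I * besselY0 z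

/-- The fundamental solution `Φₖ(x, y) = (i/4) H₀⁽¹⁾(k |x - y|)` of the Helmholtz equation. -/
def fundSol (k : ℂ) (x y : Plane) : ℂ :=
  Complex.I / 4 * hankelH0 (k * ((‖x - y‖ : ℝ) : ℂ))

/-- The Helmholtz equation `Δu + k² u = 0` in the open set `U`. -/
def IsHelmholtzSolutionOn (k : ℂ) (u : Plane → ℂ) (U : Set Plane) : Prop :=
  ∀ x ∈ U, Laplacian.laplacian u x + k ^ 2 * u x = 0

/-- The part of the exterior of `D` inside the disk of radius `R`, with Lebesgue measure. -/
def exteriorMeasure (D : Set Plane) (R : ℝ) : Measure Plane :=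
  volume.restrict (Metric.ball 0 R \ closure D)

/-- `u ∈ H¹_loc(ℝ² ∖ closure D)`, i.e. `u ∈ H¹(B_R ∖ closure D)` for all `R`, for a function `u`
which is continuously differentiable in the exterior of `D`; its weak gradient is then the
classical one. -/
def IsH1LocExterior (D : Set Plane) (u : Plane → ℂ) : Prop :=
  ∀ R : ℝ, MemLp u 2 (exteriorMeasure D R) ∧ MemLp (fderiv ℝ u) 2 (exteriorMeasure D R)

/-- `g` is the (Dirichlet) trace on `∂D`, taken from the exterior, of `u ∈ H¹_loc(ℝ² ∖ closure D)`:
the limit in `L²(∂D)` of the boundary values of smooth functions converging to `u`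
in `H¹(B_R ∖ closure D)` for all `R`. -/
def IsExteriorTrace (D : Set Plane) (u g : Plane → ℂ) : Prop :=
  MemLp g 2 (boundaryMeasure D) ∧
    ∃ φ : ℕ → Plane → ℂ, (∀ n, ContDiff ℝ ∞ (φ n)) ∧
      (∀ R : ℝ,
        Tendsto (fun n => eLpNorm (fun x => φ n x - u x) 2 (exteriorMeasure D R)) atTop (𝓝 0) ∧
        Tendsto (fun n => eLpNorm (fun x => fderiv ℝ (φ n) x - fderiv ℝ u x) 2
          (exteriorMeasure D R)) atTop (𝓝 0)) ∧
      Tendsto (fun n => eLpNorm (fun y => φ n y - g y) 2 (boundaryMeasure D)) atTop (𝓝 0)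

/-- The bilinear product `∇u · ∇v = ∂₁u ∂₁v + ∂₂u ∂₂v` (without conjugation) at `x`. -/
def gradDot (u v : Plane → ℂ) (x : Plane) : ℂ :=
  ∑ i : Fin 2, fderiv ℝ u x (EuclideanSpace.single i 1) * fderiv ℝ v x (EuclideanSpace.single i 1)

/-- `ℓ` is the exterior normal derivative `∂u/∂ν ∈ H^{-1/2}(∂D)` (with `ν` pointing out of `D`) of
a solution `u ∈ H¹_loc` of the Helmholtz equation in the exterior of `D`, as a functional
`ψ ↦ ∫_{∂D} (∂u/∂ν) ψ ds` of the boundary values `ψ` of test functions (which are dense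
in `H^{1/2}(∂D)`). It is defined by Green's first identity
`∫_{∂D} (∂u/∂ν) φ ds = - ∫_{ℝ² ∖ closure D} (∇u · ∇φ - k² u φ) dx`, for all `φ ∈ C_c^∞(ℝ²)`. -/
def IsExteriorNormalDerivative (D : Set Plane) (k : ℂ) (u : Plane → ℂ)
    (ℓ : (frontier D → ℂ) → ℂ) : Prop :=
  ∀ φ : Plane → ℂ, ContDiff ℝ ∞ φ → HasCompactSupport φ →
    ℓ (fun y : frontier D => φ y) =
      -∫ x in (closure D)ᶜ, (gradDot u φ x - k ^ 2 * (u x * φ x))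

/-- A solution `u` of the Helmholtz equation in the exterior of `D` is *outgoing*: it is in
`H¹_loc(ℝ² ∖ closure D)` and has the Green representation
`u(x) = ∫_{∂D} { (∂Φₖ(x,y)/∂ν(y)) u(y) - Φₖ(x,y) (∂u/∂ν)(y) } ds(y)` in the exterior of `D`, where
`ν` is the outward unit normal, `u|_{∂D} = g` is the trace and `∂u/∂ν = ℓ` the normal derivative,
paired with `Φₖ(x, ·)`. -/
def IsOutgoing (D : Set Plane) (k : ℂ) (u : Plane → ℂ) : Prop :=
  IsH1LocExterior D u ∧
    ∃ (ν : Plane → Plane) (g : Plane → ℂ) (ℓ : (frontier D → ℂ) → ℂ),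
      IsOutwardUnitNormal D ν ∧ IsExteriorTrace D u g ∧ IsExteriorNormalDerivative D k u ℓ ∧
      ∀ x ∈ (closure D)ᶜ,
        u x = (∫ y, fderiv ℝ (fundSol k x) y (ν y) * g y ∂(boundaryMeasure D)) -
          ℓ (fun y : frontier D => fundSol k x y)

/-- The arc length integral `∫_{|x| = r} |u(x)|² ds`, for `r > 0`, in polar coordinates. -/
def circleSqIntegral (u : Plane → ℂ) (r : ℝ) : ℝ :=
  ∫ θ in (0 : ℝ)..(2 * Real.pi), ‖u !₂[r * Real.cos θ, r * Real.sin θ]‖ ^ 2 * r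

end Scattering

end

/-! Write `H₀⁽¹⁾(k r) = h (r²)` and let `hₘ` be the `m`-th derivative of `h` (`hankelSqDeriv`); up
to a constant, `rᵐ hₘ(r²)` is the Hankel function of order `m` at `k r`. Outside a large disk the
representation formula makes `u` a superposition of point sources and dipoles lying in the disk. By
Graf's addition theorem the `n`-th Fourier coefficient of `u` on `|x| = r` is then `Aₙ` times
`outgoingRadial k n r`, with `Aₙ` independent of `r` (`exists_fourier_outgoing`). By Cauchy-Schwarz
the decay hypothesis would force `exp (2 Im k r) r |rᵐ hₘ(r²)|² → 0` if `Aₙ ≠ 0`, `m = |n|`, and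
`not_tendsto_exp_mul_hankelSqDeriv` excludes this. So `u` vanishes near infinity, and unique
continuation in the connected exterior finishes the proof.

The lower bound on the radial functions uses no asymptotic expansion. The function `w = r^(m + 1/2)
hₘ(r²)` solves `w'' = -(k² - (m² - 1/4) / r²) w`, whose solutions behave like combinations of `exp
(± i k r)`. For `Im k ≥ 0` an energy estimate shows that no nonzero solution is `o(exp (-Im k r))`.
For `Im k < 0` that bound only says that the growing component is absent, which forces `w → 0` on
the real axis. The smallness is then carried along lines `Im (k v) = const` to the ray where `k v`
is negative imaginary. There the real part of the Hankel function is twice a modified Bessel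
function, hence bounded below, a contradiction.

Unique continuation uses Fourier coefficients again: about any centre they solve Bessel's equation
in the radius, so if they vanish for small radii they vanish up to the edge of the disk. -/

namespace Scattering

/-! ### Entire power series and the Bessel functions of order `n`. -/

/-- The sum of the power series with coefficients `a`. -/
noncomputable def powerSum (a : ℕ → ℂ) (x : ℂ) : ℂ := ∑' m : ℕ, a m * x ^ m

/-- The coefficients `a` decay factorially, so that the power series is entire. -/
def FactorialDecay (a : ℕ → ℂ) : Prop := ∃ C : ℝ, ∀ m : ℕ, ‖a m‖ ≤ C / (m.factorial : ℝ)

/-- The coefficients of the derivative of a power series. -/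
def derivCoeff (a : ℕ → ℂ) (m : ℕ) : ℂ := (m + 1) * a (m + 1)

lemma FactorialDecay.derivCoeff {a : ℕ → ℂ} (ha : FactorialDecay a) :
    FactorialDecay (derivCoeff a) := by
  obtain ⟨C, hC⟩ := ha
  refine ⟨C, fun m => ?_⟩
  have h := hC (m + 1)
  have h1 : ‖Scattering.derivCoeff a m‖ = ((m : ℝ) + 1) * ‖a (m + 1)‖ := by
    rw [Scattering.derivCoeff, norm_mul]
    congr 1
    exact_mod_cast Complex.norm_natCast (m + 1)
  rw [h1]
  have hm : (0 : ℝ) < (m : ℝ) + 1 := by positivity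
  have hf : (0 : ℝ) < m.factorial := by positivity
  calc ((m : ℝ) + 1) * ‖a (m + 1)‖ ≤ ((m : ℝ) + 1) * (C / ((m + 1).factorial : ℝ)) := by gcongr
    _ = C / (m.factorial : ℝ) := by
        rw [Nat.factorial_succ]; push_cast; field_simp

lemma FactorialDecay.summable {a : ℕ → ℂ} (ha : FactorialDecay a) (x : ℂ) :
    Summable (fun m => a m * x ^ m) := by
  obtain ⟨C, hC⟩ := ha
  refine Summable.of_norm_bounded ((Real.summable_pow_div_factorial ‖x‖).mul_left C) fun m => ?_
  rw [norm_mul, norm_pow]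
  calc ‖a m‖ * ‖x‖ ^ m ≤ C / (m.factorial : ℝ) * ‖x‖ ^ m := by gcongr; exact hC m
    _ = C * (‖x‖ ^ m / m.factorial) := by ring

/-- Factorial decay passes to `derivCoeff`, so the differentiated series has a summable bound,
uniform on the ball of radius `‖x‖ + 1`, and may be differentiated termwise. -/
lemma FactorialDecay.hasDerivAt {a : ℕ → ℂ} (ha : FactorialDecay a) (x : ℂ) :
    HasDerivAt (powerSum a) (powerSum (Scattering.derivCoeff a) x) x := by
  obtain ⟨C, hC⟩ := ha.derivCoeff
  set R : ℝ := ‖x‖ + 1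
  have hsum : Summable (fun m : ℕ => C * (R ^ (m - 1) / ((m - 1).factorial : ℝ))) := by
    rw [← summable_nat_add_iff 1]
    exact (Real.summable_pow_div_factorial R).mul_left C
  have hder := hasDerivAt_tsum_of_isPreconnected (𝕜 := ℂ) (t := Metric.ball (0 : ℂ) R)
    (g := fun m y => a m * y ^ m) (g' := fun m y => a m * (m * y ^ (m - 1))) hsum
    Metric.isOpen_ball (convex_ball _ _).isPreconnected
    (fun m y _ => (hasDerivAt_pow m y).const_mul (a m))
    (fun m y hy => by
      have hy' : ‖y‖ ≤ R := by
        rw [Metric.mem_ball, dist_zero_right] at hy; exact hy.le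
      rcases m with _ | m
      · simp only [CharP.cast_eq_zero, zero_mul, mul_zero, norm_zero]
        have := (norm_nonneg _).trans (hC 0)
        have hC0 : 0 ≤ C := by simpa using this
        positivity
      · have h := hC m
        have e : a (m + 1) * (((m + 1 : ℕ) : ℂ) * y ^ (m + 1 - 1))
            = Scattering.derivCoeff a m * y ^ m := by
          simp only [Scattering.derivCoeff, Nat.add_sub_cancel]; push_cast; ring
        rw [e, norm_mul, norm_pow, Nat.add_sub_cancel]
        calc ‖Scattering.derivCoeff a m‖ * ‖y‖ ^ m ≤ C / (m.factorial : ℝ) * R ^ m := by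
              gcongr
              exact (norm_nonneg _).trans h
          _ = C * (R ^ m / m.factorial) := by ring)
    (y₀ := x) (y := x) (by rw [Metric.mem_ball, dist_zero_right]; simp [R]) (ha.summable x)
    (by rw [Metric.mem_ball, dist_zero_right]; simp [R])
  have hsx : Summable (fun m : ℕ => a m * ((m : ℂ) * x ^ (m - 1))) := by
    rw [← summable_nat_add_iff 1]
    refine (ha.derivCoeff.summable x).congr fun m => ?_
    simp only [Scattering.derivCoeff, Nat.add_sub_cancel]; push_cast; ring
  have e : ∑' m : ℕ, a m * ((m : ℂ) * x ^ (m - 1)) = powerSum (Scattering.derivCoeff a) x := by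
    rw [hsx.tsum_eq_zero_add, powerSum]
    simp only [CharP.cast_eq_zero, zero_mul, mul_zero, zero_add]
    refine tsum_congr fun m => ?_
    simp only [Scattering.derivCoeff, Nat.add_sub_cancel]; push_cast; ring
  rw [← e]
  exact hder

lemma FactorialDecay.mul_powerSum {a : ℕ → ℂ} (ha : FactorialDecay a) (x : ℂ) :
    HasSum (fun m : ℕ => (m : ℂ) * a m * x ^ m) (x * powerSum (Scattering.derivCoeff a) x) := by
  have h := ((ha.derivCoeff.summable x).hasSum.mul_left x)
  rw [← hasSum_nat_add_iff' 1]
  simp only [Finset.range_one, Finset.sum_singleton, CharP.cast_eq_zero, zero_mul, sub_zero]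
  refine h.congr_fun fun m => ?_
  simp only [Scattering.derivCoeff]; push_cast; ring

/-- The entire function `∑ xᵐ / (m! (m + n)!)`; up to normalization, the Bessel function `Jₙ(z)`
as a function of `x = -z² / 4`. -/
noncomputable def besselB (n : ℕ) : ℂ → ℂ :=
  powerSum fun m => 1 / ((m.factorial : ℂ) * ((m + n).factorial : ℂ))

/-- The power series part of `Y₀(z)`, as a function of `x = -z² / 4`. -/
noncomputable def harmonicB : ℂ → ℂ :=
  powerSum fun m => ((harmonic m : ℚ) : ℂ) / (m.factorial : ℂ) ^ 2

lemma factorialDecay_besselB (n : ℕ) :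
    FactorialDecay fun m => 1 / ((m.factorial : ℂ) * ((m + n).factorial : ℂ)) := by
  refine ⟨1, fun m => ?_⟩
  rw [norm_div, norm_mul, norm_one, Complex.norm_natCast, Complex.norm_natCast]
  have h1 : (1 : ℝ) ≤ (m + n).factorial := by exact_mod_cast (m + n).factorial_pos
  have h2 : (0 : ℝ) < m.factorial := by positivity
  gcongr
  nlinarith

lemma harmonic_le_self (m : ℕ) : (harmonic m : ℚ) ≤ m := by
  induction m with
  | zero => simp
  | succ m ih =>
    rw [harmonic_succ]
    have : (((m + 1 : ℕ) : ℚ))⁻¹ ≤ 1 :=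
      inv_le_one_of_one_le₀ (by push_cast; linarith [Nat.cast_nonneg (α := ℚ) m])
    push_cast at *
    linarith

lemma factorialDecay_harmonicB :
    FactorialDecay fun m => ((harmonic m : ℚ) : ℂ) / (m.factorial : ℂ) ^ 2 := by
  refine ⟨1, fun m => ?_⟩
  have h0 : (0 : ℚ) ≤ harmonic m := by unfold harmonic; positivity
  have h1 : ‖((harmonic m : ℚ) : ℂ)‖ ≤ m.factorial := by
    have e : ((harmonic m : ℚ) : ℂ) = (((harmonic m : ℚ) : ℝ) : ℂ) := by push_cast; rfl
    rw [e, Complex.norm_real, Real.norm_of_nonneg (by exact_mod_cast h0)]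
    have h2 := harmonic_le_self m
    have h3 : (m : ℚ) ≤ m.factorial := by exact_mod_cast m.self_le_factorial
    exact_mod_cast h2.trans h3
  have h2 : (0 : ℝ) < m.factorial := by positivity
  rw [norm_div, norm_pow, Complex.norm_natCast, div_le_div_iff₀ (by positivity) h2]
  nlinarith

lemma derivCoeff_besselB (n : ℕ) :
    derivCoeff (fun m => 1 / ((m.factorial : ℂ) * ((m + n).factorial : ℂ))) =
      fun m => 1 / ((m.factorial : ℂ) * ((m + (n + 1)).factorial : ℂ)) := by
  ext m
  have h1 : ((m : ℂ) + 1) ≠ 0 := by exact_mod_cast m.succ_ne_zero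
  have h2 : (m.factorial : ℂ) ≠ 0 := by exact_mod_cast m.factorial_ne_zero
  have h3 : ((m + (n + 1)).factorial : ℂ) ≠ 0 := by exact_mod_cast (m + (n + 1)).factorial_ne_zero
  have e : m + 1 + n = m + (n + 1) := by ring
  simp only [derivCoeff]
  rw [e, Nat.factorial_succ m]
  push_cast
  field_simp

lemma hasDerivAt_besselB (n : ℕ) (x : ℂ) : HasDerivAt (besselB n) (besselB (n + 1) x) x := by
  have h := (factorialDecay_besselB n).hasDerivAt x
  rwa [derivCoeff_besselB] at h

lemma differentiable_besselB (n : ℕ) : Differentiable ℂ (besselB n) :=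
  fun x => (hasDerivAt_besselB n x).differentiableAt

/-- The derivative of `harmonicB`. -/
noncomputable def harmonicB' : ℂ → ℂ :=
  powerSum (derivCoeff fun m => ((harmonic m : ℚ) : ℂ) / (m.factorial : ℂ) ^ 2)

/-- The second derivative of `harmonicB`. -/
noncomputable def harmonicB'' : ℂ → ℂ :=
  powerSum (derivCoeff (derivCoeff fun m => ((harmonic m : ℚ) : ℂ) / (m.factorial : ℂ) ^ 2))

lemma hasDerivAt_harmonicB (x : ℂ) : HasDerivAt harmonicB (harmonicB' x) x :=
  factorialDecay_harmonicB.hasDerivAt x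

lemma hasDerivAt_harmonicB' (x : ℂ) : HasDerivAt harmonicB' (harmonicB'' x) x :=
  factorialDecay_harmonicB.derivCoeff.hasDerivAt x

/-- Since differentiation raises the index of `besselB`, this is Bessel's equation `x f'' + f' = f`
for `f = besselB 0`. -/
lemma besselB_recurrence (x : ℂ) : x * besselB 2 x + besselB 1 x = besselB 0 x := by
  have h1 := (factorialDecay_besselB 1).mul_powerSum x
  rw [derivCoeff_besselB] at h1
  have h2 := ((factorialDecay_besselB 1).summable x).hasSum
  have h := h1.add h2
  refine h.unique (((factorialDecay_besselB 0).summable x).hasSum.congr_fun fun m => ?_)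
  have h1 : ((m : ℂ) + 1) ≠ 0 := by exact_mod_cast m.succ_ne_zero
  have h2 : (m.factorial : ℂ) ≠ 0 := by exact_mod_cast m.factorial_ne_zero
  simp only [add_zero]
  rw [Nat.factorial_succ m]
  push_cast
  field_simp

/-- Bessel's equation with a source: the right side comes from `harmonic (m + 1) - harmonic m = 1 /
(m + 1)`. It cancels the terms produced in `hankelSq` by differentiating the logarithm. -/
lemma harmonicB_equation (x : ℂ) :
    x * harmonicB'' x + harmonicB' x - harmonicB x = besselB 1 x := by
  have h1 := factorialDecay_harmonicB.derivCoeff.mul_powerSum x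
  have h2 := (factorialDecay_harmonicB.derivCoeff.summable x).hasSum
  have h3 := (factorialDecay_harmonicB.summable x).hasSum
  have h := (h1.add h2).sub h3
  refine h.unique (((factorialDecay_besselB 1).summable x).hasSum.congr_fun fun m => ?_)
  have h1 : ((m : ℂ) + 1) ≠ 0 := by exact_mod_cast m.succ_ne_zero
  have h2 : (m.factorial : ℂ) ≠ 0 := by exact_mod_cast m.factorial_ne_zero
  simp only [derivCoeff]
  rw [harmonic_succ, Nat.factorial_succ m]
  push_cast
  field_simp
  ring

/-! ### The Hankel function as an analytic function of the squared distance. -/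

/-- The function `h` with `H₀⁽¹⁾(k r) = h (r²)` for `r > 0`, analytic in the slit plane. -/
noncomputable def hankelSq (k s : ℂ) : ℂ :=
  besselB 0 (-(k ^ 2 / 4) * s) * (1 + 2 * Complex.I / (Real.pi : ℂ) *
      (Complex.log (k / 2) + (Real.eulerMascheroniConstant : ℂ)) +
      Complex.I / (Real.pi : ℂ) * Complex.log s) -
    2 * Complex.I / (Real.pi : ℂ) * harmonicB (-(k ^ 2 / 4) * s)

/-- The derivatives of `hankelSq`. -/
noncomputable def hankelSqDeriv (k : ℂ) (n : ℕ) : ℂ → ℂ := deriv^[n] (hankelSq k)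

lemma besselJ0_eq (z : ℂ) : besselJ0 z = besselB 0 (-(z ^ 2 / 4)) := by
  rw [besselJ0, besselB, powerSum]
  refine tsum_congr fun m => ?_
  have e : -(z ^ 2 / 4) = -1 * (z / 2) ^ 2 := by ring
  rw [e, mul_pow, ← pow_mul, add_zero]
  ring

lemma besselY0_series_eq (z : ℂ) :
    ∑' m : ℕ, (-1) ^ m * ((harmonic m : ℚ) : ℂ) / (m.factorial : ℂ) ^ 2 * (z / 2) ^ (2 * m) =
      harmonicB (-(z ^ 2 / 4)) := by
  rw [harmonicB, powerSum]
  refine tsum_congr fun m => ?_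
  have e : -(z ^ 2 / 4) = -1 * (z / 2) ^ 2 := by ring
  rw [e, mul_pow, ← pow_mul]
  ring

lemma hankelH0_mul_ofReal {k : ℂ} (hk : k ≠ 0) {r : ℝ} (hr : 0 < r) :
    hankelH0 (k * (r : ℂ)) = hankelSq k ((r ^ 2 : ℝ) : ℂ) := by
  rw [hankelH0, besselY0, besselY0_series_eq, besselJ0_eq, hankelSq]
  have e1 : -((k * (r : ℂ)) ^ 2 / 4) = -(k ^ 2 / 4) * ((r ^ 2 : ℝ) : ℂ) := by push_cast; ring
  have e2 : Complex.log (k * (r : ℂ) / 2) = (Real.log r : ℂ) + Complex.log (k / 2) := by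
    rw [show k * (r : ℂ) / 2 = (r : ℂ) * (k / 2) by ring,
      Complex.log_ofReal_mul hr (div_ne_zero hk two_ne_zero)]
  have e3 : Complex.log ((r ^ 2 : ℝ) : ℂ) = 2 * (Real.log r : ℂ) := by
    rw [← Complex.ofReal_log (by positivity), Real.log_pow]; push_cast; ring
  rw [e1, e2, e3]
  ring

lemma fundSol_eq {k : ℂ} (hk : k ≠ 0) {x y : Plane} (hxy : x ≠ y) :
    fundSol k x y = Complex.I / 4 * hankelSq k ((‖x - y‖ ^ 2 : ℝ) : ℂ) := by
  rw [fundSol, hankelH0_mul_ofReal hk (norm_pos_iff.mpr (sub_ne_zero.mpr hxy))]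

lemma hasDerivAt_hankelSq (k : ℂ) {s : ℂ} (hs : s ∈ Complex.slitPlane) :
    HasDerivAt (hankelSq k)
      (-(k ^ 2 / 4) * besselB 1 (-(k ^ 2 / 4) * s) * (1 + 2 * Complex.I / (Real.pi : ℂ) *
          (Complex.log (k / 2) + (Real.eulerMascheroniConstant : ℂ)) +
          Complex.I / (Real.pi : ℂ) * Complex.log s) +
        besselB 0 (-(k ^ 2 / 4) * s) * (Complex.I / (Real.pi : ℂ) * s⁻¹) -
        2 * Complex.I / (Real.pi : ℂ) * (-(k ^ 2 / 4) * harmonicB' (-(k ^ 2 / 4) * s))) s := by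
  have hl : HasDerivAt (fun s : ℂ => -(k ^ 2 / 4) * s) (-(k ^ 2 / 4)) s := by
    simpa using (hasDerivAt_id s).const_mul (-(k ^ 2 / 4))
  have h0 := (hasDerivAt_besselB 0 (-(k ^ 2 / 4) * s)).comp s hl
  have hE := (hasDerivAt_harmonicB (-(k ^ 2 / 4) * s)).comp s hl
  have hlog := ((Complex.hasDerivAt_log hs).const_mul (Complex.I / (Real.pi : ℂ))).const_add
    (1 + 2 * Complex.I / (Real.pi : ℂ) *
          (Complex.log (k / 2) + (Real.eulerMascheroniConstant : ℂ)))
  refine ((h0.mul hlog).sub (hE.const_mul (2 * Complex.I / (Real.pi : ℂ)))).congr_deriv ?_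
  simp only [Function.comp_apply]
  ring

lemma hankelSqDeriv_zero (k : ℂ) : hankelSqDeriv k 0 = hankelSq k := rfl

lemma hankelSqDeriv_succ (k : ℂ) (n : ℕ) :
    hankelSqDeriv k (n + 1) = deriv (hankelSqDeriv k n) := by
  rw [hankelSqDeriv, Function.iterate_succ_apply', hankelSqDeriv]

lemma differentiableOn_hankelSqDeriv (k : ℂ) (n : ℕ) :
    DifferentiableOn ℂ (hankelSqDeriv k n) Complex.slitPlane := by
  induction n with
  | zero => exact fun s hs => (hasDerivAt_hankelSq k hs).differentiableAt.differentiableWithinAt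
  | succ n ih =>
    rw [hankelSqDeriv_succ]
    exact ih.deriv Complex.isOpen_slitPlane

lemma hasDerivAt_hankelSqDeriv (k : ℂ) (n : ℕ) {s : ℂ} (hs : s ∈ Complex.slitPlane) :
    HasDerivAt (hankelSqDeriv k n) (hankelSqDeriv k (n + 1) s) s := by
  rw [hankelSqDeriv_succ]
  exact ((differentiableOn_hankelSqDeriv k n).differentiableAt
    (Complex.isOpen_slitPlane.mem_nhds hs)).hasDerivAt

/-- For `n = 0` this is Bessel's equation of order zero in the variable `s = r²`; differentiating in
`s` raises `n` by one. Both the radial equation and the addition theorem rest on it. -/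
lemma hankelSqDeriv_equation (k : ℂ) (n : ℕ) {s : ℂ} (hs : s ∈ Complex.slitPlane) :
    s * hankelSqDeriv k (n + 2) s + (n + 1) * hankelSqDeriv k (n + 1) s +
      k ^ 2 / 4 * hankelSqDeriv k n s = 0 := by
  induction n generalizing s with
  | zero =>
    have h1 : ∀ t ∈ Complex.slitPlane, hankelSqDeriv k 1 t = _ := fun t ht =>
      ((hasDerivAt_hankelSqDeriv k 0 ht).unique (hasDerivAt_hankelSq k ht))
    have hl : HasDerivAt (fun s : ℂ => -(k ^ 2 / 4) * s) (-(k ^ 2 / 4)) s := by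
      simpa using (hasDerivAt_id s).const_mul (-(k ^ 2 / 4))
    have hb0 := (hasDerivAt_besselB 0 (-(k ^ 2 / 4) * s)).comp s hl
    have hb1 := (hasDerivAt_besselB 1 (-(k ^ 2 / 4) * s)).comp s hl
    have hE := (hasDerivAt_harmonicB' (-(k ^ 2 / 4) * s)).comp s hl
    have hlog := ((Complex.hasDerivAt_log hs).const_mul (Complex.I / (Real.pi : ℂ))).const_add
      (1 + 2 * Complex.I / (Real.pi : ℂ) *
          (Complex.log (k / 2) + (Real.eulerMascheroniConstant : ℂ)))
    have hs0 := Complex.slitPlane_ne_zero hs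
    have hinv := (hasDerivAt_inv hs0).const_mul (Complex.I / (Real.pi : ℂ))
    have h2 := (((hb1.const_mul (-(k ^ 2 / 4))).mul hlog).add (hb0.mul hinv)).sub
      ((hE.const_mul (-(k ^ 2 / 4))).const_mul (2 * Complex.I / (Real.pi : ℂ)))
    have h3 := (hasDerivAt_hankelSqDeriv k 1 hs).unique (h2.congr_of_eventuallyEq
      (Filter.eventuallyEq_of_mem (Complex.isOpen_slitPlane.mem_nhds hs) h1))
    have hr := besselB_recurrence (-(k ^ 2 / 4) * s)
    have he := harmonicB_equation (-(k ^ 2 / 4) * s)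
    rw [show 0 + 2 = 1 + 1 from rfl, h3, show 0 + 1 = 1 from rfl, h1 s hs, hankelSqDeriv_zero,
      hankelSq]
    simp only [Function.comp_apply]
    have hpi : (Real.pi : ℂ) ≠ 0 := by exact_mod_cast Real.pi_ne_zero
    have hE2 : harmonicB (-(k ^ 2 / 4) * s) = (-(k ^ 2 / 4) * s) * harmonicB'' (-(k ^ 2 / 4) * s)
        + harmonicB' (-(k ^ 2 / 4) * s) - besselB 1 (-(k ^ 2 / 4) * s) := by linear_combination -he
    rw [hE2, ← hr]
    push_cast
    field_simp
    ring
  | succ n ih =>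
    have h1 := ((hasDerivAt_id s).mul (hasDerivAt_hankelSqDeriv k (n + 2) hs)).add
      ((hasDerivAt_hankelSqDeriv k (n + 1) hs).const_mul ((n : ℂ) + 1))
    have h2 := h1.add ((hasDerivAt_hankelSqDeriv k n hs).const_mul (k ^ 2 / 4))
    have h3 := (hasDerivAt_const s (0 : ℂ)).unique (h2.congr_of_eventuallyEq
      (Filter.eventuallyEq_of_mem (Complex.isOpen_slitPlane.mem_nhds hs)
        (fun t ht => (ih ht).symm)))
    simp only [id] at h3
    push_cast
    linear_combination -h3

/-! ### Growth and decay of solutions of the radial equation. -/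

section RadialEquation

lemma monotoneOn_Ici_of_hasDerivAt {f f' : ℝ → ℝ} {a : ℝ} (h : ∀ r ≥ a, HasDerivAt f (f' r) r)
    (h' : ∀ r ≥ a, 0 ≤ f' r) : MonotoneOn f (Ici a) := by
  refine monotoneOn_of_deriv_nonneg (convex_Ici a)
    (fun r hr => (h r hr).continuousAt.continuousWithinAt)
    (fun r hr => (h r (interior_subset hr)).differentiableAt.differentiableWithinAt)
    (fun r hr => ?_)
  rw [(h r (interior_subset hr)).deriv]
  exact h' r (interior_subset hr)

/-- If a solution of `w'' = -(k² - q / r²) w` is `o(exp (-σ r))`, then so is its derivative. -/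
lemma tendsto_exp_mul_norm_deriv {k q : ℂ} {σ : ℝ} {w w' : ℝ → ℂ}
    (hw : ∀ r : ℝ, r > 0 → HasDerivAt w (w' r) r)
    (hw' : ∀ r : ℝ, r > 0 → HasDerivAt w' (-(k ^ 2 - q / (r : ℂ) ^ 2) * w r) r)
    (hlim : Tendsto (fun r => Real.exp (σ * r) * ‖w r‖) atTop (𝓝 0)) :
    Tendsto (fun r => Real.exp (σ * r) * ‖w' r‖) atTop (𝓝 0) := by
  -- On `[r, r + 1]` the value `w' r` is `w (r + 1) - w r` up to an error controlled by `w''`. The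
  -- `2` counts the two values of `w`, the term `‖k‖² + ‖q‖` bounds the coefficient of the equation
  -- for `r ≥ 1`, and `exp |σ|` bounds the change of the weight over unit length.
  set A : ℝ := Real.exp |σ| * (2 + ‖k‖ ^ 2 + ‖q‖) with hA
  have hApos : 0 < A := by positivity
  rw [Metric.tendsto_atTop] at hlim ⊢
  intro ε hε
  obtain ⟨R, hR⟩ := hlim (ε / (2 * A)) (by positivity)
  refine ⟨max R 1, fun r hr => ?_⟩
  have hr1 : 1 ≤ r := (le_max_right _ _).trans hr
  have hrR : R ≤ r := (le_max_left _ _).trans hr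
  set δ := ε / (2 * A) with hδ
  have hδpos : 0 < δ := by positivity
  have hb : ∀ t ∈ Icc r (r + 1), ‖w t‖ ≤ δ * Real.exp |σ| * Real.exp (-(σ * r)) := by
    intro t ht
    have h := hR t (hrR.trans ht.1)
    rw [Real.dist_eq, sub_zero, abs_of_nonneg (by positivity)] at h
    have h2 : ‖w t‖ = Real.exp (-(σ * t)) * (Real.exp (σ * t) * ‖w t‖) := by
      rw [← mul_assoc, ← Real.exp_add]; simp
    rw [h2]
    calc Real.exp (-(σ * t)) * (Real.exp (σ * t) * ‖w t‖) ≤ Real.exp (-(σ * t)) * δ := by gcongr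
      _ ≤ Real.exp (|σ| + -(σ * r)) * δ := by
          gcongr
          have : -(σ * (t - r)) ≤ |σ| * (t - r) := by
            have := neg_abs_le σ
            nlinarith [sub_nonneg.mpr ht.1]
          have h3 : |σ| * (t - r) ≤ |σ| * 1 := by
            gcongr; linarith [ht.2]
          linarith
      _ = _ := by rw [Real.exp_add]; ring
  set b := δ * Real.exp |σ| * Real.exp (-(σ * r)) with hbdef
  have hM : ∀ t ∈ Icc r (r + 1), ‖-(k ^ 2 - q / (t : ℂ) ^ 2) * w t‖ ≤ (‖k‖ ^ 2 + ‖q‖) * b := by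
    intro t ht
    have ht1 : 1 ≤ t := hr1.trans ht.1
    rw [norm_mul, norm_neg]
    have h1 : ‖k ^ 2 - q / (t : ℂ) ^ 2‖ ≤ ‖k‖ ^ 2 + ‖q‖ := by
      refine (norm_sub_le _ _).trans ?_
      rw [norm_pow, norm_div, norm_pow, Complex.norm_real, Real.norm_of_nonneg (by linarith)]
      gcongr
      exact div_le_self (norm_nonneg _) (one_le_pow₀ ht1)
    exact mul_le_mul h1 (hb t ht) (norm_nonneg _) (by positivity)
  have hstep : ∀ t ∈ Icc r (r + 1), ‖w' t - w' r‖ ≤ (‖k‖ ^ 2 + ‖q‖) * b := by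
    intro t ht
    have h := (convex_Icc r (r + 1)).norm_image_sub_le_of_norm_hasDerivWithin_le
      (fun t ht => (hw' t (by linarith [ht.1])).hasDerivWithinAt) hM
      (left_mem_Icc.mpr (by linarith)) ht
    refine h.trans (mul_le_of_le_one_right (by positivity) ?_)
    rw [Real.norm_of_nonneg (by linarith [ht.1])]
    linarith [ht.2]
  have h2 := (convex_Icc r (r + 1)).norm_image_sub_le_of_norm_hasDerivWithin_le
      (f := fun t : ℝ => w t - (t : ℂ) * w' r)
      (f' := fun t => w' t - w' r)
      (fun t ht => ((hw t (by linarith [ht.1])).sub (by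
        simpa using (Complex.ofRealCLM.hasDerivAt (x := t)).mul_const (w' r))).hasDerivWithinAt)
      hstep (left_mem_Icc.mpr (by linarith)) (right_mem_Icc.mpr (by linarith))
  have e : w' r = w (r + 1) - w r -
      ((w (r + 1) - ((r + 1 : ℝ) : ℂ) * w' r) - (w r - (r : ℂ) * w' r)) := by push_cast; ring
  have h3 : ‖w' r‖ ≤ b + b + (‖k‖ ^ 2 + ‖q‖) * b := by
    rw [e]
    refine (norm_sub_le _ _).trans (add_le_add ((norm_sub_le _ _).trans
      (add_le_add (hb _ (right_mem_Icc.mpr (by linarith)))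
        (hb _ (left_mem_Icc.mpr (by linarith))))) (h2.trans (le_of_eq ?_)))
    simp
  rw [Real.dist_eq, sub_zero, abs_of_nonneg (by positivity)]
  calc Real.exp (σ * r) * ‖w' r‖ ≤ Real.exp (σ * r) * (b + b + (‖k‖ ^ 2 + ‖q‖) * b) := by gcongr
    _ = Real.exp (σ * r) * Real.exp (-(σ * r)) * (δ * A) := by rw [hbdef, hA]; ring
    _ = δ * A := by rw [← Real.exp_add]; simp
    _ = ε / 2 := by rw [hδ]; field_simp
    _ < ε := by linarith

variable {k q : ℂ} {w w' : ℝ → ℂ}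

/-- The derivative of `‖w' - i κ w‖²` (for `κ = ± k`) along a solution of the radial equation. -/
lemma exists_hasDerivAt_norm_sq (κ : ℂ) (hκ : κ ^ 2 = k ^ 2)
    (hk : k ≠ 0) {r : ℝ} (hr : 0 < r) (hw : HasDerivAt w (w' r) r)
    (hw' : HasDerivAt w' (-(k ^ 2 - q / (r : ℂ) ^ 2) * w r) r) :
    ∃ d : ℝ, HasDerivAt (fun r => ‖w' r - Complex.I * κ * w r‖ ^ 2) d r ∧
      |d - 2 * κ.im * ‖w' r - Complex.I * κ * w r‖ ^ 2| ≤ 2 * ‖q‖ / ‖k‖ / r ^ 2 *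
        (‖w' r - Complex.I * κ * w r‖ ^ 2 + ‖w' r + Complex.I * κ * w r‖ ^ 2) := by
  have h1 := (hw'.sub (hw.const_mul (Complex.I * κ))).norm_sq
  refine ⟨_, h1, ?_⟩
  set p := w' r - Complex.I * κ * w r
  set m := w' r + Complex.I * κ * w r
  have hκn : ‖κ‖ = ‖k‖ := by
    have := congrArg norm hκ
    rw [norm_pow, norm_pow] at this
    exact (pow_left_inj₀ (norm_nonneg _) (norm_nonneg _) two_ne_zero).mp this
  have hk0 : 0 < ‖k‖ := norm_pos_iff.mpr hk
  -- If `q = 0`, then `p' = -iκ p` and `‖p‖²` grows at the exact rate `2 Im κ`. The `q` term is a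
  -- perturbation of size `1 / r²`, bounded by `p` and `m` because `w = (m - p) / (2iκ)`.
  have e1 : -(k ^ 2 - q / (r : ℂ) ^ 2) * w r - Complex.I * κ * w' r =
      (-Complex.I * κ) * p + q / (r : ℂ) ^ 2 * w r := by
    simp only [p]
    rw [← hκ]
    linear_combination (κ ^ 2 * w r) * (-Complex.I_sq)
  have e2 : inner ℝ p ((-Complex.I * κ) * p) = κ.im * ‖p‖ ^ 2 := by
    rw [Complex.inner, ← Complex.normSq_eq_norm_sq, Complex.normSq_apply]
    simp only [Complex.mul_re, Complex.mul_im, Complex.conj_re, Complex.conj_im,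
      Complex.neg_re, Complex.neg_im, Complex.I_re, Complex.I_im]
    ring
  have hwn : 2 * ‖k‖ * ‖w r‖ ≤ ‖p‖ + ‖m‖ := by
    have : 2 * ‖k‖ * ‖w r‖ = ‖m - p‖ := by
      have : m - p = 2 * Complex.I * κ * w r := by simp only [p, m]; ring
      rw [this]; simp [hκn]
    rw [this]
    linarith [norm_sub_le m p]
  have e3 : |inner ℝ p (q / (r : ℂ) ^ 2 * w r)| ≤ ‖p‖ * (‖q‖ / r ^ 2 * ‖w r‖) := by
    refine (abs_real_inner_le_norm _ _).trans (le_of_eq ?_)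
    simp [abs_of_pos hr]
  have e5 : (w' - fun y => Complex.I * κ * w y) r = p := rfl
  rw [e5, e1, inner_add_right, e2]
  have e4 : 2 * (κ.im * ‖p‖ ^ 2 + inner ℝ p (q / (r : ℂ) ^ 2 * w r)) - 2 * κ.im * ‖p‖ ^ 2 =
    2 * inner ℝ p (q / (r : ℂ) ^ 2 * w r) := by ring
  rw [e4, abs_mul, abs_two]
  calc 2 * |inner ℝ p (q / (r : ℂ) ^ 2 * w r)| ≤ 2 * (‖p‖ * (‖q‖ / r ^ 2 * ‖w r‖)) := by gcongr
    _ = ‖q‖ / ‖k‖ / r ^ 2 * (‖p‖ * (2 * ‖k‖ * ‖w r‖)) := by field_simp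
    _ ≤ ‖q‖ / ‖k‖ / r ^ 2 * (2 * (‖p‖ ^ 2 + ‖m‖ ^ 2)) := by
        refine mul_le_mul_of_nonneg_left ?_ (by positivity)
        have h := mul_le_mul_of_nonneg_left hwn (norm_nonneg p)
        nlinarith [sq_nonneg (‖p‖ - ‖m‖), sq_nonneg ‖m‖]
    _ = _ := by ring

lemma hasDerivAt_exp_weight (a c : ℝ) {r : ℝ} (hr : 0 < r) :
    HasDerivAt (fun r => Real.exp (a * r + c / r))
      (Real.exp (a * r + c / r) * (a - c / r ^ 2)) r := by
  have h : HasDerivAt (fun r : ℝ => a * r + c / r) (a - c / r ^ 2) r := by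
    have h1 := ((hasDerivAt_id r).const_mul a).add ((hasDerivAt_inv hr.ne').const_mul c)
    refine (h1.congr_of_eventuallyEq (Eventually.of_forall fun x => ?_)).congr_deriv ?_
    · simp [div_eq_mul_inv]
    · simp only [mul_one]; ring
  exact h.exp

variable (hk : k ≠ 0) (hw : ∀ r : ℝ, r > 0 → HasDerivAt w (w' r) r)
  (hw' : ∀ r : ℝ, r > 0 → HasDerivAt w' (-(k ^ 2 - q / (r : ℂ) ^ 2) * w r) r)
  (hlim : Tendsto (fun r => Real.exp (k.im * r) * ‖w r‖) atTop (𝓝 0))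

include hw hw' hlim in
lemma tendsto_exp_mul_norm_sq (κ : ℂ) :
    Tendsto (fun r => Real.exp (2 * k.im * r) * ‖w' r - κ * w r‖ ^ 2)
      atTop (𝓝 0) := by
  have hlim' := tendsto_exp_mul_norm_deriv hw hw' hlim
  have h := (hlim'.add (hlim.const_mul ‖κ‖)).pow 2
  simp only [mul_zero, add_zero, ne_eq, OfNat.ofNat_ne_zero, not_false_eq_true, zero_pow] at h
  refine squeeze_zero (fun r => by positivity) (fun r => ?_) h
  have e : Real.exp (2 * k.im * r) = Real.exp (k.im * r) ^ 2 := by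
    rw [← Real.exp_nat_mul]; congr 1; push_cast; ring
  rw [e, ← mul_pow]
  gcongr
  have : ‖w' r - κ * w r‖ ≤ ‖w' r‖ + ‖κ‖ * ‖w r‖ := by
    refine (norm_sub_le _ _).trans (by rw [norm_mul])
  calc _ ≤ Real.exp (k.im * r) * (‖w' r‖ + ‖κ‖ * ‖w r‖) := by gcongr
    _ = _ := by ring

include hk hw hw' hlim in
/-- For `Im k ≥ 0` no nonzero solution of the radial equation is `o(exp (-Im k r))`. -/
lemma eq_zero_of_im_nonneg (him : 0 ≤ k.im) {r : ℝ} (hr : 0 < r) : w r = 0 := by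
  set C := 2 * ‖q‖ / ‖k‖ with hC
  have hC0 : 0 ≤ C := by positivity
  -- The two summands have rates `2 Im k` and `-2 Im k`; as `Im k ≥ 0`, both are at least `-2 Im k`.
  -- The perturbation enters once for each summand, whence `2 * C`.
  have hp : ∀ r > 0, ∃ d : ℝ, HasDerivAt (fun r => ‖w' r - Complex.I * k * w r‖ ^ 2 +
      ‖w' r - Complex.I * (-k) * w r‖ ^ 2) d r ∧
      -(2 * k.im + 2 * C / r ^ 2) * (‖w' r - Complex.I * k * w r‖ ^ 2 +
      ‖w' r - Complex.I * (-k) * w r‖ ^ 2) ≤ d := by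
    intro r hr
    obtain ⟨d1, h1, hd1⟩ := exists_hasDerivAt_norm_sq k rfl hk hr (hw r hr) (hw' r hr)
    obtain ⟨d2, h2, hd2⟩ := exists_hasDerivAt_norm_sq (-k) (by ring) hk hr (hw r hr) (hw' r hr)
    refine ⟨_, h1.add h2, ?_⟩
    have e1 : w' r + Complex.I * k * w r = w' r - Complex.I * (-k) * w r := by ring
    have e2 : w' r + Complex.I * (-k) * w r = w' r - Complex.I * k * w r := by ring
    rw [e1] at hd1
    rw [e2, Complex.neg_im] at hd2
    set P := ‖w' r - Complex.I * k * w r‖ ^ 2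
    set M := ‖w' r - Complex.I * (-k) * w r‖ ^ 2
    have hP : 0 ≤ P := by positivity
    have hM : 0 ≤ M := by positivity
    have a1 := (abs_le.mp hd1).1
    have a2 := (abs_le.mp hd2).1
    have e3 : 2 * C / r ^ 2 * (P + M) = C / r ^ 2 * (P + M) + C / r ^ 2 * (M + P) := by ring
    have := mul_nonneg him hP
    nlinarith
  choose! d hd hd' using hp
  set N : ℝ → ℝ := fun r => ‖w' r - Complex.I * k * w r‖ ^ 2 +
      ‖w' r - Complex.I * (-k) * w r‖ ^ 2 with hN
  have hN0 : ∀ r, 0 ≤ N r := fun r => by positivity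
  -- The logarithmic derivative of the weight is `2 Im k + 2C / t²`, exactly the largest possible
  -- rate of loss of `N`. The part `-2C / t` of the exponent is nonpositive, so the weighted energy
  -- still tends to zero, and a nonnegative increasing function with limit zero vanishes.
  have hmono : MonotoneOn (fun t => N t * Real.exp (2 * k.im * t + (-(2 * C)) / t)) (Ici r) := by
    refine monotoneOn_Ici_of_hasDerivAt (fun t ht => (hd t (hr.trans_le ht)).mul
      (hasDerivAt_exp_weight _ _ (hr.trans_le ht))) (fun t ht => ?_)
    have h := hd' t (hr.trans_le ht)
    have hE := Real.exp_pos (2 * k.im * t + (-(2 * C)) / t)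
    have : d t * Real.exp (2 * k.im * t + (-(2 * C)) / t) + N t *
      (Real.exp (2 * k.im * t + (-(2 * C)) / t) * (2 * k.im - (-(2 * C)) / t ^ 2)) =
      Real.exp (2 * k.im * t + (-(2 * C)) / t) *
        (d t + (2 * k.im + 2 * C / t ^ 2) * N t) := by ring
    rw [this]
    exact mul_nonneg hE.le (by linarith)
  have hlimN : Tendsto (fun t => Real.exp (2 * k.im * t) * N t) atTop (𝓝 0) := by
    have h := (tendsto_exp_mul_norm_sq hw hw' hlim (Complex.I * k)).add
      (tendsto_exp_mul_norm_sq hw hw' hlim (Complex.I * (-k)))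
    simpa only [← mul_add, add_zero] using h
  have hle : N r * Real.exp (2 * k.im * r + (-(2 * C)) / r) ≤ 0 := by
    refine ge_of_tendsto hlimN (eventually_ge_atTop r |>.mono fun t ht => ?_)
    refine (hmono (mem_Ici.mpr le_rfl) ht ht).trans ?_
    have ht0 : 0 < t := hr.trans_le ht
    have : 2 * k.im * t + (-(2 * C)) / t ≤ 2 * k.im * t := by
      have : 0 ≤ 2 * C / t := by positivity
      rw [neg_div]; linarith
    exact (mul_comm _ _).trans_le
      (mul_le_mul_of_nonneg_right (Real.exp_le_exp.mpr this) (hN0 t))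
  have hNr : N r = 0 := le_antisymm (by
    have := Real.exp_pos (2 * k.im * r + (-(2 * C)) / r)
    by_contra h
    push Not at h
    nlinarith [mul_pos h this]) (hN0 r)
  have h1 : w' r - Complex.I * k * w r = 0 := by
    have : ‖w' r - Complex.I * k * w r‖ ^ 2 = 0 := by
      have h := sq_nonneg ‖w' r - Complex.I * (-k) * w r‖
      have h' := sq_nonneg ‖w' r - Complex.I * k * w r‖
      simp only [hN] at hNr
      linarith
    simpa using this
  have h2 : w' r - Complex.I * (-k) * w r = 0 := by
    have : ‖w' r - Complex.I * (-k) * w r‖ ^ 2 = 0 := by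
      have h := sq_nonneg ‖w' r - Complex.I * (-k) * w r‖
      have h' := sq_nonneg ‖w' r - Complex.I * k * w r‖
      simp only [hN] at hNr
      linarith
    simpa using this
  have h3 : 2 * Complex.I * k * w r = 0 := by linear_combination h2 - h1
  simpa [hk] using h3

include hk hw hw' hlim in
/-- For `Im k < 0` a solution of the radial equation which is `o(exp (-Im k r))` tends to `0`. -/
lemma tendsto_zero_of_im_neg (him : k.im < 0) :
    Tendsto (fun r => ‖w r‖ ^ 2 + ‖w' r‖ ^ 2) atTop (𝓝 0) := by
  set C := 2 * ‖q‖ / ‖k‖ with hC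
  have hC0 : 0 ≤ C := by positivity
  set τ := -k.im with hτ
  have hτ0 : 0 < τ := by rw [hτ]; linarith
  set P : ℝ → ℝ := fun r => ‖w' r - Complex.I * k * w r‖ ^ 2 with hPdef
  set M : ℝ → ℝ := fun r => ‖w' r - Complex.I * (-k) * w r‖ ^ 2 with hMdef
  have hP0 : ∀ r, 0 ≤ P r := fun r => by positivity
  have hM0 : ∀ r, 0 ≤ M r := fun r => by positivity
  have hp : ∀ r > 0, ∃ d : ℝ, HasDerivAt P d r ∧
      |d + 2 * τ * P r| ≤ C / r ^ 2 * (P r + M r) := by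
    intro r hr
    obtain ⟨d1, h1, hd1⟩ := exists_hasDerivAt_norm_sq k rfl hk hr (hw r hr) (hw' r hr)
    have e1 : w' r + Complex.I * k * w r = w' r - Complex.I * (-k) * w r := by ring
    rw [e1] at hd1
    refine ⟨d1, h1, le_trans (le_of_eq ?_) hd1⟩
    congr 1
    rw [hτ]; ring
  have hm : ∀ r > 0, ∃ d : ℝ, HasDerivAt M d r ∧
      |d - 2 * τ * M r| ≤ C / r ^ 2 * (P r + M r) := by
    intro r hr
    obtain ⟨d2, h2, hd2⟩ := exists_hasDerivAt_norm_sq (-k) (by ring) hk hr (hw r hr) (hw' r hr)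
    have e2 : w' r + Complex.I * (-k) * w r = w' r - Complex.I * k * w r := by ring
    rw [e2, Complex.neg_im, add_comm] at hd2
    exact ⟨d2, h2, hd2⟩
  choose! d hd hd' using hp
  choose! f hf hf' using hm
  -- Beyond `r₀` the perturbation `C / r²` is at most `τ`, so it cannot reverse the growth of `M` or
  -- the decay of `P`.
  set r₀ : ℝ := max 1 (C / τ) with hr₀
  have hr₀1 : 1 ≤ r₀ := le_max_left _ _
  have hr₀C : ∀ r ≥ r₀, C / r ^ 2 ≤ τ := by
    intro r hr
    have h1 : 1 ≤ r := hr₀1.trans hr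
    have h2 : C / τ ≤ r := (le_max_right _ _).trans hr
    rw [div_le_iff₀ hτ0] at h2
    rw [div_le_iff₀ (by positivity)]
    nlinarith [mul_pos hτ0 (show 0 < r by linarith)]
  -- If the growing part `M` ever exceeded the decaying part `P`, then `M - P` would keep growing
  -- like `exp (2τ r)`, contradicting the assumed bound on `w`.
  have hcone : ∀ r ≥ r₀, M r ≤ P r := by
    have hmono : MonotoneOn (fun t => (M t - P t) * Real.exp ((-(2 * τ)) * t + (-(2 * C)) / t))
        (Ici r₀) := by
      refine monotoneOn_Ici_of_hasDerivAt (fun t ht => ((hf t (by linarith)).sub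
        (hd t (by linarith))).mul (hasDerivAt_exp_weight _ _ (by linarith))) (fun t ht => ?_)
      have ht0 : 0 < t := by linarith
      have hE := Real.exp_pos ((-(2 * τ)) * t + (-(2 * C)) / t)
      have : (f t - d t) * Real.exp ((-(2 * τ)) * t + (-(2 * C)) / t) + (M t - P t) *
        (Real.exp ((-(2 * τ)) * t + (-(2 * C)) / t) * (-(2 * τ) - (-(2 * C)) / t ^ 2)) =
        Real.exp ((-(2 * τ)) * t + (-(2 * C)) / t) *
          (f t - d t - (2 * τ - 2 * (C / t ^ 2)) * (M t - P t)) := by ring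
      simp only [Pi.sub_apply]
      rw [this]
      refine mul_nonneg hE.le ?_
      have h1 := (abs_le.mp (hf' t ht0)).1
      have h2 := (abs_le.mp (hd' t ht0)).2
      have h3 := mul_nonneg (sub_nonneg.mpr (hr₀C t ht)) (hP0 t)
      nlinarith
    have hlimE : Tendsto (fun t => Real.exp (2 * k.im * t) * M t) atTop (𝓝 0) :=
      tendsto_exp_mul_norm_sq hw hw' hlim (Complex.I * (-k))
    intro r hr
    have hle : (M r - P r) * Real.exp ((-(2 * τ)) * r + (-(2 * C)) / r) ≤ 0 := by
      refine ge_of_tendsto hlimE (eventually_ge_atTop r |>.mono fun t ht => ?_)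
      have ht0 : 0 < t := by linarith
      refine (hmono hr (hr.trans ht) ht).trans ?_
      have : -(2 * τ) * t + (-(2 * C)) / t ≤ 2 * k.im * t := by
        have : 0 ≤ 2 * C / t := by positivity
        rw [neg_div, hτ]; linarith
      calc (M t - P t) * Real.exp (-(2 * τ) * t + (-(2 * C)) / t)
          ≤ M t * Real.exp (-(2 * τ) * t + (-(2 * C)) / t) := by
            gcongr; linarith [hP0 t]
        _ ≤ M t * Real.exp (2 * k.im * t) :=
            mul_le_mul_of_nonneg_left (Real.exp_le_exp.mpr this) (hM0 t)
        _ = _ := by ring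
    by_contra h
    push Not at h
    have := mul_pos (sub_pos.mpr h) (Real.exp_pos ((-(2 * τ)) * r + (-(2 * C)) / r))
    linarith
  -- With `M ≤ P` the perturbation in the equation for `P` is at most `2C / t²` times `P`, which the
  -- weight absorbs; hence `P` decays exponentially.
  have hanti : MonotoneOn (fun t => -(P t * Real.exp ((2 * τ) * t + (2 * C) / t))) (Ici r₀) := by
    refine monotoneOn_Ici_of_hasDerivAt (fun t ht => ((hd t (by linarith)).mul
      (hasDerivAt_exp_weight _ _ (by linarith))).neg) (fun t ht => ?_)
    have ht0 : 0 < t := by linarith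
    have hE := Real.exp_pos ((2 * τ) * t + (2 * C) / t)
    have : -(d t * Real.exp ((2 * τ) * t + (2 * C) / t) + P t *
        (Real.exp ((2 * τ) * t + (2 * C) / t) * (2 * τ - (2 * C) / t ^ 2))) =
        Real.exp ((2 * τ) * t + (2 * C) / t) *
          (-d t - (2 * τ - 2 * (C / t ^ 2)) * P t) := by ring
    rw [this]
    refine mul_nonneg hE.le ?_
    have h2 := (abs_le.mp (hd' t ht0)).2
    have h3 := mul_le_mul_of_nonneg_left (hcone t ht) (show 0 ≤ C / t ^ 2 by positivity)
    nlinarith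
  have hPlim : Tendsto P atTop (𝓝 0) := by
    have hexp : Tendsto (fun r => P r₀ * Real.exp ((2 * τ) * r₀ + (2 * C) / r₀) *
        Real.exp (-((2 * τ) * r))) atTop (𝓝 0) := by
      rw [← mul_zero (P r₀ * Real.exp ((2 * τ) * r₀ + (2 * C) / r₀))]
      refine Tendsto.const_mul _ (Real.tendsto_exp_neg_atTop_nhds_zero.comp
        (tendsto_id.const_mul_atTop (by positivity)))
    refine squeeze_zero' (Eventually.of_forall hP0)
      (eventually_ge_atTop r₀ |>.mono fun t ht => ?_) hexp
    have ht0 : 0 < t := by linarith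
    have h := hanti (mem_Ici.mpr le_rfl) ht ht
    simp only [neg_le_neg_iff] at h
    have h1 : P t * Real.exp (2 * τ * t) ≤ P t * Real.exp (2 * τ * t + 2 * C / t) := by
      have : 0 ≤ 2 * C / t := by positivity
      exact mul_le_mul_of_nonneg_left (Real.exp_le_exp.mpr (by linarith)) (hP0 t)
    have e : P t = P t * Real.exp (2 * τ * t) * Real.exp (-(2 * τ * t)) := by
      rw [mul_assoc, ← Real.exp_add]; simp
    rw [e]
    exact mul_le_mul_of_nonneg_right (h1.trans h) (Real.exp_pos _).le
  set A : ℝ := 1 / ‖k‖ ^ 2 + 1 with hA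
  have hlim2 : Tendsto (fun r => A * (2 * P r)) atTop (𝓝 0) := by
    simpa using (hPlim.const_mul 2).const_mul A
  refine squeeze_zero' (Eventually.of_forall fun r => by positivity)
    (eventually_ge_atTop r₀ |>.mono fun r hr => ?_) hlim2
  have hk0 : 0 < ‖k‖ := norm_pos_iff.mpr hk
  have hpar := parallelogram_law_with_norm ℝ (w' r) (Complex.I * k * w r)
  have e3 : ‖w' r + Complex.I * k * w r‖ ^ 2 = M r := by
    simp only [hMdef]
    rw [show w' r - Complex.I * (-k) * w r = w' r + Complex.I * k * w r by ring]
  have e4 : ‖w' r - Complex.I * k * w r‖ ^ 2 = P r := rfl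
  rw [e3, e4, norm_mul, norm_mul, Complex.norm_I, one_mul] at hpar
  have hc := hcone r hr
  have h1 : ‖w' r‖ ^ 2 + ‖k‖ ^ 2 * ‖w r‖ ^ 2 ≤ P r := by nlinarith
  have h2 : ‖w r‖ ^ 2 ≤ 1 / ‖k‖ ^ 2 * P r := by
    rw [div_mul_eq_mul_div, one_mul, le_div_iff₀ (by positivity)]
    nlinarith [sq_nonneg ‖w' r‖]
  have h3 : ‖w' r‖ ^ 2 ≤ P r := by nlinarith [mul_nonneg (sq_nonneg ‖k‖) (sq_nonneg ‖w r‖)]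
  have h4 : 0 ≤ A * P r := mul_nonneg (by positivity) (hP0 r)
  rw [hA] at *
  nlinarith

end RadialEquation

/-! ### The Hankel function on the ray where `k v` is negative imaginary, for `Im k < 0`. -/

lemma sq_mem_slitPlane {v : ℂ} (hv : 0 < v.re) : v ^ 2 ∈ Complex.slitPlane := by
  rw [Complex.mem_slitPlane_iff, sq, Complex.mul_re, Complex.mul_im]
  by_cases h : v.im = 0
  · left; rw [h]; nlinarith
  · right
    have : v.re * v.im ≠ 0 := mul_ne_zero hv.ne' h
    intro h2; apply this; linarith

lemma log_sq {v : ℂ} (hv : 0 < v.re) : Complex.log (v ^ 2) = 2 * Complex.log v := by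
  have h := abs_lt.mp (Complex.abs_arg_lt_pi_div_two_iff.mpr (Or.inl hv))
  have hv0 : v ≠ 0 := fun h => by simp [h] at hv
  rw [sq, Complex.log_mul hv0 hv0 ⟨by linarith [h.1], by linarith [h.2]⟩]
  ring

/-- `besselB` on the real line. -/
noncomputable def besselBReal (n : ℕ) (x : ℝ) : ℝ :=
  ∑' m : ℕ, 1 / ((m.factorial : ℝ) * ((m + n).factorial : ℝ)) * x ^ m

lemma besselB_ofReal (n : ℕ) (x : ℝ) : besselB n (x : ℂ) = (besselBReal n x : ℂ) := by
  rw [besselB, powerSum, besselBReal, Complex.ofReal_tsum]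
  push_cast
  rfl

lemma harmonicB_ofReal_im (x : ℝ) : (harmonicB (x : ℂ)).im = 0 := by
  have : harmonicB (x : ℂ) =
      ((∑' m : ℕ, ((harmonic m : ℚ) : ℝ) / (m.factorial : ℝ) ^ 2 * x ^ m : ℝ) : ℂ) := by
    rw [harmonicB, powerSum, Complex.ofReal_tsum]
    push_cast
    rfl
  rw [this, Complex.ofReal_im]

lemma le_besselBReal (n : ℕ) {x : ℝ} (hx : 0 ≤ x) : 1 / (n.factorial : ℝ) ≤ besselBReal n x := by
  have hs : Summable (fun m : ℕ => 1 / ((m.factorial : ℝ) * ((m + n).factorial : ℝ)) * x ^ m) := by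
    rw [← Complex.summable_ofReal]
    refine ((factorialDecay_besselB n).summable (x : ℂ)).congr fun m => ?_
    push_cast
    rfl
  have h := hs.le_tsum 0 (fun m _ => by positivity)
  simpa [besselBReal] using h

lemma hasDerivAt_besselBReal (n : ℕ) (x : ℝ) :
    HasDerivAt (besselBReal n) (besselBReal (n + 1) x) x := by
  have h := (hasDerivAt_besselB n (x : ℂ)).real_of_complex
  rw [besselB_ofReal, Complex.ofReal_re] at h
  refine h.congr_of_eventuallyEq (Eventually.of_forall fun y => ?_)
  simp only [besselB_ofReal, Complex.ofReal_re]

section LowerHalfPlane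

variable {k : ℂ} (him : k.im < 0)

include him in
-- The solution `v` of `k v = -i t` stays in the right half-plane, where `v²` avoids the cut of the
-- logarithm.
lemma re_neg_I_div_pos {t : ℝ} (ht : 0 < t) : 0 < (-Complex.I * (t : ℂ) / k).re := by
  have hk : 0 < Complex.normSq k := Complex.normSq_pos.mpr fun h => by simp [h] at him
  have e : (-Complex.I * (t : ℂ) / k).re = t * (-k.im) / Complex.normSq k := by
    rw [Complex.div_re]
    simp
  rw [e]
  have : 0 < -k.im := by linarith
  positivity

include him in
-- No multiple of `2πi` appears because `arg k` lies in `(-π, 0)`, so that `-π/2 - arg k` is again a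
-- principal argument.
lemma log_neg_I_div {t : ℝ} (ht : 0 < t) :
    Complex.log (-Complex.I * (t : ℂ) / k) =
      (Real.log t : ℂ) - Complex.I * (Real.pi / 2 : ℝ) - Complex.log k := by
  have hk : k ≠ 0 := fun h => by simp [h] at him
  have h1 : Complex.arg k < 0 := Complex.arg_neg_iff.mpr him
  have h2 := Complex.neg_pi_lt_arg k
  have e : -Complex.I * (t : ℂ) / k =
      Complex.exp ((Real.log t : ℂ) - Complex.I * (Real.pi / 2 : ℝ) - Complex.log k) := by
    rw [Complex.exp_sub, Complex.exp_sub, Complex.exp_log hk, ← Complex.ofReal_exp,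
      Real.exp_log ht]
    have : Complex.exp (Complex.I * (Real.pi / 2 : ℝ)) = Complex.I := by
      rw [mul_comm]; push_cast; exact Complex.exp_pi_div_two_mul_I
    rw [this, div_eq_mul_inv (t : ℂ) Complex.I, Complex.inv_I]
    ring
  have him' : ((Real.log t : ℂ) - Complex.I * (Real.pi / 2 : ℝ) - Complex.log k).im =
      -(Real.pi / 2) - Complex.arg k := by
    simp [Complex.log_im]
  have hpi := Real.pi_pos
  rw [e, Complex.log_exp] <;> rw [him'] <;> linarith

include him in
lemma neg_div_sq_mem_slitPlane {t : ℝ} (ht : 0 < t) : -1 / k ^ 2 * (t : ℂ) ∈ Complex.slitPlane := by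
  have h := sq_mem_slitPlane (re_neg_I_div_pos him (Real.sqrt_pos.mpr ht))
  convert h using 1
  rw [div_pow, mul_pow, ← Complex.ofReal_pow, Real.sq_sqrt ht.le]
  simp
  ring

include him in
-- At `s = -t / k²` the Bessel series are real, and the `-iπ/2` in the logarithm turns the constant
-- `1` of `hankelSq` into `2`: this is `H₀⁽¹⁾(-i√t) = 2 I₀(√t) + i (real)`. Differentiating in the
-- real variable `t` gives the higher `n`, with factors `-1 / k²` on the left and `1 / 4` on the
-- right.
lemma re_hankelSqDeriv (n : ℕ) {t : ℝ} (ht : 0 < t) :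
    ((-1 / k ^ 2) ^ n * hankelSqDeriv k n (-1 / k ^ 2 * (t : ℂ))).re =
      2 * (1 / 4) ^ n * besselBReal n (t / 4) := by
  have hk : k ≠ 0 := fun h => by simp [h] at him
  induction n generalizing t with
  | zero =>
    rw [pow_zero, one_mul, hankelSqDeriv_zero, hankelSq]
    have e1 : -(k ^ 2 / 4) * (-1 / k ^ 2 * (t : ℂ)) = ((t / 4 : ℝ) : ℂ) := by
      push_cast; field_simp
    have e2 : Complex.log (-1 / k ^ 2 * (t : ℂ)) =
        2 * ((Real.log (√t) : ℂ) - Complex.I * (Real.pi / 2 : ℝ) - Complex.log k) := by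
      rw [← log_neg_I_div him (Real.sqrt_pos.mpr ht),
        ← log_sq (re_neg_I_div_pos him (Real.sqrt_pos.mpr ht))]
      congr 1
      rw [div_pow, mul_pow, ← Complex.ofReal_pow, Real.sq_sqrt ht.le]
      simp
      ring
    have e3 : Complex.log (k / 2) = Complex.log k - (Real.log 2 : ℂ) := by
      rw [show k / 2 = ((1 / 2 : ℝ) : ℂ) * k by push_cast; ring,
        Complex.log_ofReal_mul (by norm_num) hk, one_div, Real.log_inv]
      push_cast; ring
    have hpi : (Real.pi : ℂ) ≠ 0 := by exact_mod_cast Real.pi_ne_zero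
    rw [e1, e2, e3, besselB_ofReal]
    have e4 : (1 + 2 * Complex.I / (Real.pi : ℂ) * (Complex.log k - (Real.log 2 : ℂ) +
          (Real.eulerMascheroniConstant : ℂ)) + Complex.I / (Real.pi : ℂ) *
          (2 * ((Real.log (√t) : ℂ) - Complex.I * (Real.pi / 2 : ℝ) - Complex.log k))) =
        2 + Complex.I * ((2 / Real.pi * (Real.eulerMascheroniConstant - Real.log 2 +
          Real.log (√t)) : ℝ) : ℂ) := by
      push_cast
      field_simp
      linear_combination (-(Real.pi : ℂ)) * Complex.I_sq
    have e5 : 2 * Complex.I / (Real.pi : ℂ) * harmonicB ((t / 4 : ℝ) : ℂ) =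
        ((2 / Real.pi : ℝ) : ℂ) * (Complex.I * harmonicB ((t / 4 : ℝ) : ℂ)) := by
      push_cast; ring
    generalize (2 / Real.pi * (Real.eulerMascheroniConstant - Real.log 2 +
          Real.log (√t)) : ℝ) = c at e4
    rw [e4, e5, Complex.sub_re, Complex.re_ofReal_mul, Complex.re_ofReal_mul]
    simp [harmonicB_ofReal_im, -Complex.ofReal_div]
    ring
  | succ n ih =>
    have hl : HasDerivAt (fun s : ℂ => -1 / k ^ 2 * s) (-1 / k ^ 2) (t : ℂ) := by
      simpa using (hasDerivAt_id (t : ℂ)).const_mul (-1 / k ^ 2)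
    have h1 := (((hasDerivAt_hankelSqDeriv k n (neg_div_sq_mem_slitPlane him ht)).comp (t : ℂ) hl
      ).const_mul ((-1 / k ^ 2) ^ n)).real_of_complex
    have h2 := ((hasDerivAt_besselBReal n (t / 4)).comp t
      ((hasDerivAt_id t).div_const 4)).const_mul (2 * (1 / 4) ^ n)
    have h3 := h2.unique (h1.congr_of_eventuallyEq
      (Filter.eventuallyEq_of_mem (Ioi_mem_nhds ht) (fun y hy => (ih hy).symm)))
    have e : (-1 / k ^ 2) ^ (n + 1) * hankelSqDeriv k (n + 1) (-1 / k ^ 2 * (t : ℂ)) =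
      (-1 / k ^ 2) ^ n * (hankelSqDeriv k (n + 1) (-1 / k ^ 2 * (t : ℂ)) * (-1 / k ^ 2)) := by ring
    rw [e, ← h3]
    ring

include him in
lemma exists_le_norm_hankelSqDeriv (n : ℕ) : ∃ c > 0, ∀ t : ℝ, 0 < t →
    c ≤ ‖hankelSqDeriv k n (-1 / k ^ 2 * (t : ℂ))‖ := by
  have hk : k ≠ 0 := fun h => by simp [h] at him
  have hkn : 0 < ‖(-1 / k ^ 2) ^ n‖ := norm_pos_iff.mpr (pow_ne_zero _ (by simp [hk]))
  refine ⟨2 * (1 / 4) ^ n * (1 / n.factorial) / ‖(-1 / k ^ 2) ^ n‖, by positivity, fun t ht => ?_⟩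
  rw [div_le_iff₀ hkn, mul_comm ‖hankelSqDeriv k n _‖, ← norm_mul]
  refine le_trans ?_ ((le_abs_self _).trans (Complex.abs_re_le_norm _))
  rw [re_hankelSqDeriv him n ht]
  gcongr
  exact le_besselBReal n (by positivity)

end LowerHalfPlane

/-! ### Lower bounds for the outgoing radial functions. -/

/-- The radial function `v^(n + 1/2) hₙ(v²)`, on the right half-plane. -/
noncomputable def radialW (k : ℂ) (n : ℕ) (v : ℂ) : ℂ :=
  v ^ ((n + 1 / 2 : ℝ) : ℂ) * hankelSqDeriv k n (v ^ 2)

/-- The derivative of `radialW`. -/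
noncomputable def radialW' (k : ℂ) (n : ℕ) (v : ℂ) : ℂ :=
  ((n + 1 / 2 : ℝ) : ℂ) * v ^ (((n + 1 / 2 : ℝ) : ℂ) - 1) * hankelSqDeriv k n (v ^ 2) +
    v ^ ((n + 1 / 2 : ℝ) : ℂ) * (hankelSqDeriv k (n + 1) (v ^ 2) * (2 * v))

lemma hasDerivAt_radialW (k : ℂ) (n : ℕ) {v : ℂ} (hv : 0 < v.re) :
    HasDerivAt (radialW k n) (radialW' k n v) v := by
  have hs : v ∈ Complex.slitPlane := Or.inl hv
  have hp : HasDerivAt (fun v : ℂ => v ^ 2) (2 * v) v := by simpa using hasDerivAt_pow 2 v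
  have h1 := (hasDerivAt_hankelSqDeriv k n (sq_mem_slitPlane hv)).comp v hp
  have h2 := (hasDerivAt_id v).cpow_const (c := ((n + 1 / 2 : ℝ) : ℂ)) hs
  refine (h2.mul h1).congr_deriv ?_
  simp [radialW']

/-- The function `vⁿ hₙ(v²)` solves Bessel's equation of order `n` in `k v`; the extra factor
`v^(1/2)` removes the first-order term. -/
lemma hasDerivAt_radialW' (k : ℂ) (n : ℕ) {v : ℂ} (hv : 0 < v.re) :
    HasDerivAt (radialW' k n) (-(k ^ 2 - ((n : ℂ) ^ 2 - 1 / 4) / v ^ 2) * radialW k n v) v := by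
  have hs : v ∈ Complex.slitPlane := Or.inl hv
  have hv0 := Complex.slitPlane_ne_zero hs
  have hp : HasDerivAt (fun v : ℂ => v ^ 2) (2 * v) v := by simpa using hasDerivAt_pow 2 v
  have h1 := (hasDerivAt_hankelSqDeriv k n (sq_mem_slitPlane hv)).comp v hp
  have h1' := (hasDerivAt_hankelSqDeriv k (n + 1) (sq_mem_slitPlane hv)).comp v hp
  have h2 := (hasDerivAt_id v).cpow_const (c := ((n + 1 / 2 : ℝ) : ℂ)) hs
  have h2' := (hasDerivAt_id v).cpow_const (c := ((n + 1 / 2 : ℝ) : ℂ) - 1) hs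
  have h3 := ((h2'.const_mul ((n + 1 / 2 : ℝ) : ℂ)).mul h1).add
    (h2.mul (h1'.mul ((hasDerivAt_id v).const_mul 2)))
  refine h3.congr_deriv ?_
  have he := hankelSqDeriv_equation k n (sq_mem_slitPlane hv)
  simp only [Function.comp_apply, id, radialW, mul_one, Pi.mul_apply]
  rw [Complex.cpow_sub _ _ hv0, Complex.cpow_sub _ _ hv0, Complex.cpow_one]
  set a := v ^ ((n + 1 / 2 : ℝ) : ℂ)
  push_cast
  field_simp
  linear_combination (64 * a * v ^ 2) * he

lemma norm_radialW_sq (k : ℂ) (n : ℕ) {v : ℂ} (hv : 0 < v.re) :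
    ‖radialW k n v‖ ^ 2 = ‖v‖ * ‖v ^ n * hankelSqDeriv k n (v ^ 2)‖ ^ 2 := by
  have hv0 : v ≠ 0 := fun h => by simp [h] at hv
  have h0 : 0 < ‖v‖ := norm_pos_iff.mpr hv0
  rw [radialW, norm_mul, norm_mul, mul_pow, mul_pow, norm_pow,
    Complex.norm_cpow_of_ne_zero hv0, Complex.ofReal_re, Complex.ofReal_im, mul_zero,
    Real.exp_zero, div_one, ← Real.rpow_natCast, ← Real.rpow_mul h0.le]
  have : (((n : ℝ) + 1 / 2) * ((2 : ℕ) : ℝ)) = ((n * 2 + 1 : ℕ) : ℝ) := by push_cast; ring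
  rw [this, Real.rpow_natCast, pow_succ, pow_mul]
  ring

/-- Along lines `Im (k v) = const` the size of `radialW` changes only by a bounded factor. -/
lemma exists_norm_radialW_vertical_le {k : ℂ} (him : k.im < 0) (n : ℕ) :
    ∃ K : ℝ, ∀ r : ℝ, 1 ≤ r → ‖radialW k n (-Complex.I * ((-k.im * r : ℝ) : ℂ) / k)‖ ^ 2 ≤
      K * (‖radialW k n r‖ ^ 2 + ‖radialW' k n r‖ ^ 2) := by
  have hk : k ≠ 0 := fun h => by simp [h] at him
  have hkn : 0 < ‖k‖ := norm_pos_iff.mpr hk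
  set τ : ℝ := -k.im with hτ
  have hτ0 : 0 < τ := by rw [hτ]; linarith
  set q : ℂ := (n : ℂ) ^ 2 - 1 / 4 with hq
  set C : ℝ := |k.re| * ‖q‖ / τ ^ 2 with hC
  have hC0 : 0 ≤ C := by positivity
  refine ⟨(1 + 1 / ‖k‖ ^ 2) * Real.exp C, fun r hr => ?_⟩
  have hr0 : 0 < r := by linarith
  -- This segment runs from `-iτr / k` to `r` and keeps `Im (k v) = -τ r`, so `exp (± i k v)` has
  -- constant modulus on it.
  set v : ℝ → ℂ := fun t => ((t * (k.re * r) : ℝ) - Complex.I * ((τ * r : ℝ) : ℂ)) / k with hv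
  have hvd : ∀ t, HasDerivAt v (((k.re * r : ℝ) : ℂ) / k) t := by
    intro t
    have h1 : HasDerivAt (fun t : ℝ => ((t * (k.re * r) : ℝ) : ℂ)) ((k.re * r : ℝ) : ℂ) t := by
      have := ((hasDerivAt_id t).mul_const (k.re * r)).ofReal_comp
      simpa using this
    exact (h1.sub_const _).div_const k
  have hvre : ∀ t ∈ Icc (0 : ℝ) 1, 0 < (v t).re := by
    intro t ht
    have e : (v t).re = (t * k.re ^ 2 * r + τ ^ 2 * r) / Complex.normSq k := by
      simp only [hv, Complex.div_re, hτ]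
      simp
      ring
    rw [e]
    have := Complex.normSq_pos.mpr hk
    have h1 := ht.1
    positivity
  have hvn : ∀ t, τ * r ≤ ‖k * v t‖ := by
    intro t
    have e : k * v t = (t * (k.re * r) : ℝ) - Complex.I * ((τ * r : ℝ) : ℂ) := by
      simp only [hv]; field_simp
    rw [e]
    refine le_trans ?_ (Complex.abs_im_le_norm _)
    simp [abs_of_pos hτ0, abs_of_pos hr0]
  -- `G` would be constant for `q = 0`. The remaining term is at most `|Re k| r ‖q‖ / (τ r)² = C /
  -- r` times `G`, which for `r ≥ 1` bounds the total change independently of `r`.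
  set G : ℝ → ℝ := fun t => ‖radialW k n (v t)‖ ^ 2 + ‖radialW' k n (v t) / k‖ ^ 2 with hG
  have hGd : ∀ t ∈ Icc (0 : ℝ) 1, ∃ d, HasDerivAt G d t ∧ -(C * G t) ≤ d := by
    intro t ht
    have h1 := ((hasDerivAt_radialW k n (hvre t ht)).scomp t (hvd t)).norm_sq
    have h2 := (((hasDerivAt_radialW' k n (hvre t ht)).scomp t (hvd t)).div_const k).norm_sq
    refine ⟨_, h1.add h2, ?_⟩
    simp only [Function.comp_apply]
    set A := radialW k n (v t) with hA
    set B := radialW' k n (v t) / k with hB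
    have hv0 : v t ≠ 0 := fun h => by have := hvre t ht; simp [h] at this
    have e1 : (((k.re * r : ℝ) : ℂ) / k) • radialW' k n (v t) = (k.re * r) • B := by
      rw [hB, smul_eq_mul, Complex.real_smul]; ring
    have e2 : ((((k.re * r : ℝ) : ℂ) / k) • (-(k ^ 2 - ((n : ℂ) ^ 2 - 1 / 4) / v t ^ 2) * A)) / k =
        (k.re * r) • (q / (k * v t) ^ 2 * A - A) := by
      rw [smul_eq_mul, Complex.real_smul, hq]; field_simp; ring
    rw [e1, e2, inner_smul_right, inner_smul_right, inner_sub_right, real_inner_comm B A]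
    have e3 : 2 * (k.re * r * inner ℝ B A) +
        2 * (k.re * r * (inner ℝ B (q / (k * v t) ^ 2 * A) - inner ℝ B A)) =
        2 * (k.re * r * inner ℝ B (q / (k * v t) ^ 2 * A)) := by ring
    rw [e3]
    refine neg_le_of_abs_le ?_
    have e4 : |inner ℝ B (q / (k * v t) ^ 2 * A)| ≤ ‖B‖ * (‖q‖ / (τ * r) ^ 2 * ‖A‖) := by
      refine (abs_real_inner_le_norm _ _).trans ?_
      rw [norm_mul, norm_div q, norm_pow]
      gcongr
      exact hvn t
    rw [abs_mul, abs_mul, abs_mul, abs_two, abs_of_pos hr0]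
    calc 2 * (|k.re| * r * |inner ℝ B (q / (k * v t) ^ 2 * A)|)
        ≤ 2 * (|k.re| * r * (‖B‖ * (‖q‖ / (τ * r) ^ 2 * ‖A‖))) := by gcongr
      _ = C / r * (2 * ‖A‖ * ‖B‖) := by rw [hC]; field_simp
      _ ≤ C * (‖A‖ ^ 2 + ‖B‖ ^ 2) := by
          have h5 : C / r ≤ C := div_le_self hC0 hr
          have h6 : 2 * ‖A‖ * ‖B‖ ≤ ‖A‖ ^ 2 + ‖B‖ ^ 2 := by nlinarith [sq_nonneg (‖A‖ - ‖B‖)]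
          exact mul_le_mul h5 h6 (by positivity) hC0
  choose! d hd hd' using hGd
  have hmono : MonotoneOn (fun t => G t * Real.exp (C * t)) (Icc 0 1) := by
    have hder : ∀ t ∈ Icc (0 : ℝ) 1, HasDerivAt (fun t => G t * Real.exp (C * t))
        (d t * Real.exp (C * t) + G t * (Real.exp (C * t) * C)) t := fun t ht =>
      (hd t ht).mul (by simpa using ((hasDerivAt_id t).const_mul C).exp)
    refine monotoneOn_of_deriv_nonneg (convex_Icc 0 1)
      (fun t ht => (hder t ht).continuousAt.continuousWithinAt)
      (fun t ht => (hder t (interior_subset ht)).differentiableAt.differentiableWithinAt)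
      (fun t ht => ?_)
    rw [(hder t (interior_subset ht)).deriv]
    have h := hd' t (interior_subset ht)
    have hE := Real.exp_pos (C * t)
    have : d t * Real.exp (C * t) + G t * (Real.exp (C * t) * C) =
      Real.exp (C * t) * (d t + C * G t) := by ring
    rw [this]
    exact mul_nonneg hE.le (by linarith)
  have h01 := hmono (left_mem_Icc.mpr zero_le_one) (right_mem_Icc.mpr zero_le_one) zero_le_one
  simp only [mul_zero, Real.exp_zero, mul_one] at h01
  have e0 : v 0 = -Complex.I * ((τ * r : ℝ) : ℂ) / k := by simp [hv]
  have e1 : v 1 = r := by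
    simp only [hv]
    rw [div_eq_iff hk]
    apply Complex.ext <;> simp [hτ] <;> ring
  have h2 : ‖radialW k n (v 0)‖ ^ 2 ≤ G 0 := by
    simp only [hG]
    linarith [sq_nonneg ‖radialW' k n (v 0) / k‖]
  rw [← e0]
  refine h2.trans (h01.trans ?_)
  simp only [hG, e1]
  rw [norm_div, div_pow]
  have : (1 + 1 / ‖k‖ ^ 2) * Real.exp C * (‖radialW k n r‖ ^ 2 + ‖radialW' k n r‖ ^ 2) =
    (‖radialW k n r‖ ^ 2 + ‖radialW' k n r‖ ^ 2 / ‖k‖ ^ 2) * Real.exp C +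
    (‖radialW' k n r‖ ^ 2 + ‖radialW k n r‖ ^ 2 / ‖k‖ ^ 2) * Real.exp C := by ring
  rw [this]
  have : 0 ≤ (‖radialW' k n r‖ ^ 2 + ‖radialW k n r‖ ^ 2 / ‖k‖ ^ 2) * Real.exp C := by positivity
  linarith

/-- If `hₙ` vanished on the positive axis, so would `hₙ₊₁`, and `hankelSqDeriv_equation` with `k ≠
0` would pass this down to `h₀`. But `h₀` has a logarithmic singularity at zero: solving `h₀ = 0`
for `log s` would express it by a quantity with a finite limit. -/
lemma exists_hankelSqDeriv_ne_zero {k : ℂ} (hk : k ≠ 0) (n : ℕ) :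
    ∃ s : ℝ, 0 < s ∧ hankelSqDeriv k n s ≠ 0 := by
  by_contra! hcon
  have hsp : ∀ s : ℝ, 0 < s → (s : ℂ) ∈ Complex.slitPlane := fun s hs => Or.inl (by simpa using hs)
  have hsucc : ∀ m : ℕ, (∀ s : ℝ, 0 < s → hankelSqDeriv k m s = 0) →
      ∀ s : ℝ, 0 < s → hankelSqDeriv k (m + 1) s = 0 := by
    intro m hm s hs
    have h := (hasDerivAt_hankelSqDeriv k m (hsp s hs)).comp_ofReal
    exact h.unique ((hasDerivAt_const s (0 : ℂ)).congr_of_eventuallyEq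
      (Filter.eventuallyEq_of_mem (Ioi_mem_nhds hs) fun t ht => hm t ht))
  have hzero : ∀ s : ℝ, 0 < s → hankelSqDeriv k 0 s = 0 := by
    have hpred : ∀ m : ℕ, (∀ s : ℝ, 0 < s → hankelSqDeriv k m s = 0) →
        ∀ s : ℝ, 0 < s → hankelSqDeriv k 0 s = 0 := by
      intro m
      induction m with
      | zero => exact id
      | succ m ih =>
        intro hm
        refine ih fun s hs => ?_
        have h := hankelSqDeriv_equation k m (hsp s hs)
        rw [hm s hs, hsucc _ hm s hs] at h
        simpa [hk] using h
    exact hpred n hcon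
  have hpi : (Real.pi : ℂ) ≠ 0 := by exact_mod_cast Real.pi_ne_zero
  have hb0 : besselB 0 0 = 1 := by
    rw [besselB, powerSum, tsum_eq_single 0]
    · simp
    · intro m hm; simp [hm]
  set c := (1 + 2 * Complex.I / (Real.pi : ℂ) *
      (Complex.log (k / 2) + (Real.eulerMascheroniConstant : ℂ)))
  set g : ℝ → ℂ := fun s => besselB 0 (-(k ^ 2 / 4) * s)
  set e : ℝ → ℂ := fun s => harmonicB (-(k ^ 2 / 4) * s)
  have hgc : Continuous g := (differentiable_besselB 0).continuous.comp (by fun_prop)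
  have hec : Continuous e :=
    (show Differentiable ℂ harmonicB from
      fun x => (hasDerivAt_harmonicB x).differentiableAt).continuous.comp (by fun_prop)
  have hg0 : g 0 ≠ 0 := by simp [g, hb0]
  have hlim : Tendsto (fun s : ℝ => (Real.pi : ℂ) / Complex.I *
      (2 * Complex.I / (Real.pi : ℂ) * e s / g s - c)) (𝓝[>] 0)
      (𝓝 ((Real.pi : ℂ) / Complex.I * (2 * Complex.I / (Real.pi : ℂ) * e 0 / g 0 - c))) := by
    refine tendsto_nhdsWithin_of_tendsto_nhds ?_
    exact ((((hec.tendsto 0).const_mul _).div (hgc.tendsto 0) hg0).sub_const c).const_mul _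
  have hev : ∀ᶠ s in 𝓝[>] (0 : ℝ), ‖(Real.pi : ℂ) / Complex.I *
      (2 * Complex.I / (Real.pi : ℂ) * e s / g s - c)‖ = |Real.log s| := by
    have hne : ∀ᶠ s in 𝓝[>] (0 : ℝ), g s ≠ 0 :=
      tendsto_nhdsWithin_of_tendsto_nhds (hgc.tendsto 0) |>.eventually_ne hg0
    filter_upwards [hne, self_mem_nhdsWithin] with s hs hs0
    have h := hzero s hs0
    rw [hankelSqDeriv_zero, hankelSq] at h
    have : (Real.pi : ℂ) / Complex.I * (2 * Complex.I / (Real.pi : ℂ) * e s / g s - c) =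
        Complex.log s := by
      change g s * (c + Complex.I / (Real.pi : ℂ) * Complex.log s) -
        2 * Complex.I / (Real.pi : ℂ) * e s = 0 at h
      have h' : 2 * Complex.I / (Real.pi : ℂ) * e s / g s =
          c + Complex.I / (Real.pi : ℂ) * Complex.log s := by
        rw [div_eq_iff hs]; linear_combination -h
      rw [h']
      field_simp
      ring
    rw [this, ← Complex.ofReal_log (le_of_lt hs0), Complex.norm_real, Real.norm_eq_abs]
  have hinf : Tendsto (fun s => |Real.log s|) (𝓝[>] 0) atTop :=
    tendsto_abs_atBot_atTop.comp Real.tendsto_log_nhdsGT_zero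
  exact not_tendsto_nhds_of_tendsto_atTop hinf _ (hlim.norm.congr' hev)

/-- The radial functions `rⁿ hₙ(r²)` are not smaller at infinity than `exp (i k r) / √r`. -/
theorem not_tendsto_exp_mul_hankelSqDeriv {k : ℂ} (hk : k ≠ 0) (n : ℕ) :
    ¬ Tendsto (fun r : ℝ => Real.exp (2 * k.im * r) *
      (r * ‖(r : ℂ) ^ n * hankelSqDeriv k n ((r : ℂ) ^ 2)‖ ^ 2)) atTop (𝓝 0) := by
  intro hlim
  have hW : ∀ r : ℝ, r > 0 → HasDerivAt (fun r : ℝ => radialW k n r) (radialW' k n r) r :=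
    fun r hr => (hasDerivAt_radialW k n (by simpa using hr)).comp_ofReal
  have hW' : ∀ r : ℝ, r > 0 → HasDerivAt (fun r : ℝ => radialW' k n r)
      (-(k ^ 2 - ((n : ℂ) ^ 2 - 1 / 4) / (r : ℂ) ^ 2) * radialW k n r) r :=
    fun r hr => (hasDerivAt_radialW' k n (by simpa using hr)).comp_ofReal
  have hlim' : Tendsto (fun r : ℝ => Real.exp (k.im * r) * ‖radialW k n r‖) atTop (𝓝 0) := by
    have h := hlim.sqrt
    rw [Real.sqrt_zero] at h
    refine h.congr' ((eventually_gt_atTop 0).mono fun r hr => ?_)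
    rw [Real.sqrt_eq_iff_eq_sq (by positivity) (by positivity), mul_pow,
      norm_radialW_sq k n (by simpa using hr), ← Real.exp_nat_mul, Complex.norm_real,
      Real.norm_of_nonneg hr.le]
    congr 2
    push_cast
    ring
  rcases le_or_gt 0 k.im with him | him
  · obtain ⟨s, hs, hne⟩ := exists_hankelSqDeriv_ne_zero hk n
    have hr := Real.sqrt_pos.mpr hs
    have h := eq_zero_of_im_nonneg hk hW hW' hlim' him hr
    have h0 := norm_radialW_sq k n (v := (√s : ℝ)) (by simpa using hr)
    rw [h, ← Complex.ofReal_pow (√s) 2, Real.sq_sqrt hs.le] at h0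
    have hr' : √s ≠ 0 := hr.ne'
    simp [hne, hr'] at h0
  -- Here the radial equation has decaying solutions, so it does not suffice by itself; the explicit
  -- values on the ray `k v ∈ -i ℝ₊` show that `radialW` is not one of them.
  · have h := tendsto_zero_of_im_neg hk hW hW' hlim' him
    obtain ⟨K, hK⟩ := exists_norm_radialW_vertical_le him n
    obtain ⟨c, hc, hcle⟩ := exists_le_norm_hankelSqDeriv him n
    have hkn : 0 < ‖k‖ := norm_pos_iff.mpr hk
    have hτ : 0 < -k.im := by linarith
    have h2 : Tendsto (fun r : ℝ => K * (‖radialW k n r‖ ^ 2 + ‖radialW' k n r‖ ^ 2))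
        atTop (𝓝 0) := by simpa using h.const_mul K
    have h3 : c ^ 2 ≤ 0 := by
      -- The second threshold makes the endpoint on the ray satisfy `‖v‖ ≥ 1`, so that the powers of
      -- `v` only help the lower bound.
      refine ge_of_tendsto h2 ((eventually_ge_atTop (max 1 (‖k‖ / -k.im))).mono fun r hr => ?_)
      have hr1 : 1 ≤ r := (le_max_left _ _).trans hr
      have hr2 : ‖k‖ ≤ -k.im * r := by
        have := (le_max_right _ _).trans hr
        rwa [div_le_iff₀ hτ, mul_comm] at this
      refine le_trans ?_ (hK r hr1)
      have ht : 0 < -k.im * r := by nlinarith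
      rw [norm_radialW_sq k n (re_neg_I_div_pos him ht)]
      set v := -Complex.I * ((-k.im * r : ℝ) : ℂ) / k with hv
      have hv1 : 1 ≤ ‖v‖ := by
        rw [hv, norm_div, norm_mul, norm_neg, Complex.norm_I, one_mul, Complex.norm_real,
          Real.norm_of_nonneg ht.le, one_le_div hkn]
        exact hr2
      have hv2 : v ^ 2 = -1 / k ^ 2 * (((-k.im * r) ^ 2 : ℝ) : ℂ) := by
        rw [hv, div_pow, mul_pow, ← Complex.ofReal_pow, neg_sq, Complex.I_sq]; ring
      have h4 : c ≤ ‖v ^ n * hankelSqDeriv k n (v ^ 2)‖ := by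
        rw [norm_mul, norm_pow, hv2]
        have h5 := hcle ((-k.im * r) ^ 2) (by positivity)
        have h6 : 1 ≤ ‖v‖ ^ n := one_le_pow₀ hv1
        nlinarith
      have h5 : c ^ 2 ≤ ‖v ^ n * hankelSqDeriv k n (v ^ 2)‖ ^ 2 := by gcongr
      nlinarith [sq_nonneg c]
    nlinarith

/-! ### Parameter integrals over circles and Taylor series. -/

/-- Differentiation under the integral over a full period. -/
lemma hasDerivAt_integral_period {𝕜 : Type*} [RCLike 𝕜] [NormedSpace 𝕜 ℂ] [IsScalarTower ℝ 𝕜 ℂ]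
    {U : Set 𝕜} (hU : IsOpen U)
    {F F' : 𝕜 → ℝ → ℂ} (hF : ContinuousOn (Function.uncurry F) (U ×ˢ univ))
    (hF' : ContinuousOn (Function.uncurry F') (U ×ˢ univ))
    (hd : ∀ x ∈ U, ∀ θ, HasDerivAt (fun x => F x θ) (F' x θ) x) {x : 𝕜} (hx : x ∈ U) :
    HasDerivAt (fun x => ∫ θ in (0 : ℝ)..(2 * Real.pi), F x θ)
      (∫ θ in (0 : ℝ)..(2 * Real.pi), F' x θ) x := by
  obtain ⟨ε, hε, hball⟩ := Metric.nhds_basis_closedBall.mem_iff.mp (hU.mem_nhds hx)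
  have hslice : ∀ G : 𝕜 → ℝ → ℂ, ContinuousOn (Function.uncurry G) (U ×ˢ univ) →
      ∀ y ∈ U, Continuous (G y) := by
    intro G hG y hy
    rw [← continuousOn_univ]
    exact hG.comp (f := fun θ : ℝ => (y, θ)) (by fun_prop) (fun θ _ => ⟨hy, mem_univ _⟩)
  obtain ⟨C, hC⟩ := ((isCompact_closedBall x ε).prod
    (isCompact_Icc (a := (0 : ℝ)) (b := 2 * Real.pi))).exists_bound_of_continuousOn
    (hF'.mono (prod_mono hball (subset_univ _)))
  have hpi : (0 : ℝ) ≤ 2 * Real.pi := by positivity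
  refine (intervalIntegral.hasDerivAt_integral_of_dominated_loc_of_deriv_le
    (bound := fun _ => C) (Metric.closedBall_mem_nhds x hε) ?_ ?_ ?_ ?_ ?_ ?_).2
  · filter_upwards [hU.mem_nhds hx] with y hy
    exact (hslice F hF y hy).aestronglyMeasurable
  · exact (hslice F hF x hx).intervalIntegrable _ _
  · exact (hslice F' hF' x hx).aestronglyMeasurable
  · refine Eventually.of_forall fun θ hθ y hy => ?_
    rw [uIoc_of_le hpi] at hθ
    exact hC (y, θ) ⟨hy, Ioc_subset_Icc_self hθ⟩
  · exact intervalIntegrable_const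
  · exact Eventually.of_forall fun θ _ y hy => hd y (hball hy) θ

/-- The Taylor series at `0` of a function with prescribed higher derivatives. -/
lemma hasSum_taylor_of_hasDerivAt {f : ℕ → ℂ → ℂ} {r : ℝ}
    (hf : ∀ l, ∀ z ∈ Metric.ball (0 : ℂ) r, HasDerivAt (f l) (f (l + 1) z) z)
    {z : ℂ} (hz : z ∈ Metric.ball (0 : ℂ) r) :
    HasSum (fun l : ℕ => (l.factorial : ℂ)⁻¹ * z ^ l * f l 0) (f 0 z) := by
  have h0 : (0 : ℂ) ∈ Metric.ball (0 : ℂ) r :=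
    Metric.mem_ball_self (Metric.pos_of_mem_ball hz)
  have hder : ∀ l, EqOn (iteratedDeriv l (f 0)) (f l) (Metric.ball 0 r) := by
    intro l
    induction l with
    | zero => intro w _; simp
    | succ l ih =>
      intro w hw
      rw [iteratedDeriv_succ]
      exact ((hf l w hw).congr_of_eventuallyEq
        (ih.eventuallyEq_of_mem (Metric.isOpen_ball.mem_nhds hw))).deriv
  have h := Complex.hasSum_taylorSeries_on_ball
    (fun w hw => (hf 0 w hw).differentiableAt.differentiableWithinAt) hz
  refine h.congr_fun fun l => ?_
  rw [hder l h0, smul_eq_mul, smul_eq_mul, sub_zero, mul_assoc]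

lemma integral_exp_int (j : ℤ) :
    ∫ θ in (0 : ℝ)..(2 * Real.pi), Complex.exp ((j : ℂ) * ((θ : ℂ) * Complex.I)) =
      if j = 0 then 2 * (Real.pi : ℂ) else 0 := by
  split_ifs with h
  · simp [h]
  · have hc : (j : ℂ) * Complex.I ≠ 0 := mul_ne_zero (by exact_mod_cast h) Complex.I_ne_zero
    have e : ∀ θ : ℝ, Complex.exp ((j : ℂ) * ((θ : ℂ) * Complex.I)) =
        Complex.exp (((j : ℂ) * Complex.I) * (θ : ℂ)) := fun θ => by congr 1; ring
    simp_rw [e]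
    rw [integral_exp_mul_complex hc]
    have : (j : ℂ) * Complex.I * ((2 * Real.pi : ℝ) : ℂ) = j * (2 * Real.pi * Complex.I) := by
      push_cast; ring
    rw [this, Complex.exp_int_mul_two_pi_mul_I]
    simp

lemma mul_mem_slitPlane_of_re_pos {z w : ℂ} (hz : 0 < z.re) (hw : 0 < w.re) :
    z * w ∈ Complex.slitPlane := by
  rw [Complex.mem_slitPlane_iff, Complex.mul_re, Complex.mul_im]
  by_cases h : z.re * w.im + z.im * w.re = 0
  · left
    have h1 : z.re * (z.re * w.re - z.im * w.im) = w.re * (z.re ^ 2 + z.im ^ 2) := by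
      linear_combination (-z.im) * h
    have h2 : 0 < z.re * (z.re * w.re - z.im * w.im) := by rw [h1]; positivity
    exact (mul_pos_iff_of_pos_left hz).mp h2
  · right; exact h

/-! ### The kernel on a circle, holomorphic in two independent source variables. -/

section Circle

/-- The point with polar coordinates `(r, θ)`, as a complex number. -/
noncomputable def circlePt (r θ : ℝ) : ℂ := r * Complex.exp (θ * Complex.I)

/-- The complex conjugate of `circlePt r θ`. -/
noncomputable def circlePtConj (r θ : ℝ) : ℂ := r * Complex.exp (-(θ * Complex.I))

/-- The Fourier factor `exp (-i n θ)`. -/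
noncomputable def fourierFactor (n : ℤ) (θ : ℝ) : ℂ :=
  Complex.exp (((-n : ℤ) : ℂ) * ((θ : ℂ) * Complex.I))

@[fun_prop] lemma continuous_circlePt (r : ℝ) : Continuous (circlePt r) := by
  unfold circlePt; fun_prop

@[fun_prop] lemma continuous_circlePtConj (r : ℝ) : Continuous (circlePtConj r) := by
  unfold circlePtConj; fun_prop

@[fun_prop] lemma continuous_fourierFactor (n : ℤ) : Continuous (fourierFactor n) := by
  unfold fourierFactor; fun_prop

lemma circlePt_mul_conj (r θ : ℝ) : circlePt r θ * circlePtConj r θ = (r : ℂ) ^ 2 := by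
  rw [circlePt, circlePtConj, Complex.exp_neg]
  have := Complex.exp_ne_zero (θ * Complex.I)
  field_simp

lemma norm_circlePt {r : ℝ} (hr : 0 ≤ r) (θ : ℝ) : ‖circlePt r θ‖ = r := by
  rw [circlePt, norm_mul, Complex.norm_exp_ofReal_mul_I, Complex.norm_real,
    Real.norm_of_nonneg hr, mul_one]

lemma norm_circlePtConj {r : ℝ} (hr : 0 ≤ r) (θ : ℝ) : ‖circlePtConj r θ‖ = r := by
  have e : -((θ : ℂ) * Complex.I) = ((-θ : ℝ) : ℂ) * Complex.I := by push_cast; ring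
  rw [circlePtConj, e, norm_mul, Complex.norm_exp_ofReal_mul_I, Complex.norm_real,
    Real.norm_of_nonneg hr, mul_one]

lemma circlePt_neg (r θ : ℝ) : circlePt r (-θ) = circlePtConj r θ := by
  simp [circlePt, circlePtConj]

lemma circlePtConj_neg (r θ : ℝ) : circlePtConj r (-θ) = circlePt r θ := by
  simp [circlePt, circlePtConj]

lemma fourierFactor_neg (n : ℤ) (θ : ℝ) : fourierFactor n (-θ) = fourierFactor (-n) θ := by
  simp [fourierFactor]

/-- With `X X̄ = r²`, the product equals `((X - ζ) X̄) ((X̄ - η) X) / r²`, and each of the two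
factors has positive real part because `|ζ X̄|` and `|η X|` are less than `r²`. The variables `ζ`
and `η` need not be conjugate, so the kernel can be expanded in each separately. -/
lemma mem_slitPlane_circle {r : ℝ} (hr : 0 < r) (θ : ℝ) {ζ η : ℂ} (hζ : ‖ζ‖ < r) (hη : ‖η‖ < r) :
    (circlePt r θ - ζ) * (circlePtConj r θ - η) ∈ Complex.slitPlane := by
  have key : ∀ z w : ℂ, z * w = (r : ℂ) ^ 2 → ‖w‖ = r → ∀ ξ : ℂ, ‖ξ‖ < r →
      0 < ((z - ξ) * w).re := by
    intro z w hzw hw ξ hξ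
    have h1 : (ξ * w).re ≤ ‖ξ‖ * r := by
      rw [← hw, ← norm_mul]; exact Complex.re_le_norm _
    rw [sub_mul, hzw, Complex.sub_re, ← Complex.ofReal_pow, Complex.ofReal_re]
    nlinarith
  have h1 := key _ _ (circlePt_mul_conj r θ) (norm_circlePtConj hr.le θ) ζ hζ
  have h2 := key _ _ ((mul_comm _ _).trans (circlePt_mul_conj r θ)) (norm_circlePt hr.le θ) η hη
  have h3 : 0 < (((1 / r ^ 2 : ℝ) : ℂ) *
      ((circlePtConj r θ - η) * circlePt r θ)).re := by
    rw [Complex.re_ofReal_mul]; positivity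
  have h4 := mul_mem_slitPlane_of_re_pos h1 h3
  have hr0 : (r : ℂ) ≠ 0 := by exact_mod_cast hr.ne'
  have e : (circlePt r θ - ζ) * circlePtConj r θ * (((1 / r ^ 2 : ℝ) : ℂ) *
      ((circlePtConj r θ - η) * circlePt r θ)) =
      (circlePt r θ - ζ) * (circlePtConj r θ - η) *
        ((circlePt r θ * circlePtConj r θ) * (1 / (r : ℂ) ^ 2)) := by
    push_cast; ring
  rw [e, circlePt_mul_conj, mul_one_div_cancel (pow_ne_zero 2 hr0), mul_one] at h4
  exact h4

lemma integral_circlePt_pow_mul (r : ℝ) (l : ℕ) (n : ℤ) :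
    ∫ θ in (0 : ℝ)..(2 * Real.pi), circlePt r θ ^ l * fourierFactor n θ =
      if (l : ℤ) = n then 2 * (Real.pi : ℂ) * (r : ℂ) ^ l else 0 := by
  have e : ∀ θ : ℝ, circlePt r θ ^ l * fourierFactor n θ =
      (r : ℂ) ^ l * Complex.exp (((l - n : ℤ) : ℂ) * ((θ : ℂ) * Complex.I)) := by
    intro θ
    rw [circlePt, fourierFactor, mul_pow, ← Complex.exp_nat_mul, mul_assoc, ← Complex.exp_add]
    congr 2
    push_cast; ring
  simp_rw [e]
  rw [intervalIntegral.integral_const_mul, integral_exp_int]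
  simp only [sub_eq_zero, mul_ite, mul_zero]
  congr 1
  ring

lemma integral_circlePtConj_pow_mul (r : ℝ) (l : ℕ) (n : ℤ) :
    ∫ θ in (0 : ℝ)..(2 * Real.pi), circlePtConj r θ ^ l * fourierFactor n θ =
      if (l : ℤ) = -n then 2 * (Real.pi : ℂ) * (r : ℂ) ^ l else 0 := by
  have e : ∀ θ : ℝ, circlePtConj r θ ^ l * fourierFactor n θ =
      (r : ℂ) ^ l * Complex.exp (((-l - n : ℤ) : ℂ) * ((θ : ℂ) * Complex.I)) := by
    intro θ
    rw [circlePtConj, fourierFactor, mul_pow, ← Complex.exp_nat_mul, mul_assoc, ← Complex.exp_add]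
    congr 2
    push_cast; ring
  simp_rw [e]
  rw [intervalIntegral.integral_const_mul, integral_exp_int]
  have : (-(l : ℤ) - n = 0) ↔ ((l : ℤ) = -n) := by constructor <;> intro h <;> linarith
  simp only [this, mul_ite, mul_zero]
  congr 1
  ring

lemma continuousOn_hankelSqDeriv_circle (k : ℂ) {r : ℝ} (hr : 0 < r) (l : ℕ) {X : Type*}
    [TopologicalSpace X] {S : Set X} {ζ η : X → ℂ} {θ : X → ℝ} (hζ : Continuous ζ)
    (hη : Continuous η) (hθ : Continuous θ) (hζ' : ∀ p ∈ S, ‖ζ p‖ < r)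
    (hη' : ∀ p ∈ S, ‖η p‖ < r) :
    ContinuousOn (fun p => hankelSqDeriv k l
      ((circlePt r (θ p) - ζ p) * (circlePtConj r (θ p) - η p))) S :=
  (differentiableOn_hankelSqDeriv k l).continuousOn.comp (by fun_prop)
    (fun p hp => mem_slitPlane_circle hr _ (hζ' p hp) (hη' p hp))

end Circle

/-! ### Graf's addition theorem. -/

section Addition

variable (k : ℂ) {r : ℝ} (hr : 0 < r)

/-- The argument `(X - ζ) (X̄ - η)` of the kernel, for `X = r exp (i θ)`. -/
noncomputable def kernelArg (r : ℝ) (θ : ℝ) (ζ η : ℂ) : ℂ :=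
  (circlePt r θ - ζ) * (circlePtConj r θ - η)

include hr in
lemma hasDerivAt_kernel_left (l : ℕ) (θ : ℝ) {ζ η : ℂ} (hζ : ‖ζ‖ < r) (hη : ‖η‖ < r) :
    HasDerivAt (fun ζ => hankelSqDeriv k l (kernelArg r θ ζ η))
      (hankelSqDeriv k (l + 1) (kernelArg r θ ζ η) * (-(circlePtConj r θ - η))) ζ := by
  have h1 : HasDerivAt (fun ζ => kernelArg r θ ζ η) (-(circlePtConj r θ - η)) ζ := by
    simpa [kernelArg] using ((hasDerivAt_id ζ).const_sub (circlePt r θ)).mul_const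
      (circlePtConj r θ - η)
  exact (hasDerivAt_hankelSqDeriv k l (mem_slitPlane_circle hr θ hζ hη)).comp ζ h1

include hr in
lemma hasDerivAt_kernel_right (l : ℕ) (θ : ℝ) {ζ η : ℂ} (hζ : ‖ζ‖ < r) (hη : ‖η‖ < r) :
    HasDerivAt (fun η => hankelSqDeriv k l (kernelArg r θ ζ η))
      (hankelSqDeriv k (l + 1) (kernelArg r θ ζ η) * (-(circlePt r θ - ζ))) η := by
  have h1 : HasDerivAt (fun η => kernelArg r θ ζ η) (-(circlePt r θ - ζ)) η := by
    simpa [kernelArg] using ((hasDerivAt_id η).const_sub (circlePtConj r θ)).const_mul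
      (circlePt r θ - ζ)
  exact (hasDerivAt_hankelSqDeriv k l (mem_slitPlane_circle hr θ hζ hη)).comp η h1

include hr in
lemma continuousOn_kernel_left (l : ℕ) {η : ℂ} (hη : ‖η‖ < r) :
    ContinuousOn (fun p : ℂ × ℝ => hankelSqDeriv k l (kernelArg r p.2 p.1 η))
      (Metric.ball 0 r ×ˢ univ) :=
  continuousOn_hankelSqDeriv_circle k hr l continuous_fst continuous_const continuous_snd
    (fun p hp => by simpa using hp.1) (fun _ _ => hη)

include hr in
lemma continuousOn_kernel_right (l : ℕ) {ζ : ℂ} (hζ : ‖ζ‖ < r) :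
    ContinuousOn (fun p : ℂ × ℝ => hankelSqDeriv k l (kernelArg r p.2 ζ p.1))
      (Metric.ball 0 r ×ˢ univ) :=
  continuousOn_hankelSqDeriv_circle k hr l continuous_const continuous_fst continuous_snd
    (fun _ _ => hζ) (fun p hp => by simpa using hp.1)

include hr in
/-- The Fourier coefficients of `(X - ζ)ˡ hₗ((X - ζ) X̄)` on the circle `|X| = r`. -/
lemma integral_sub_pow_mul_kernel (l n : ℕ) {ζ : ℂ} (hζ : ‖ζ‖ < r) :
    ∫ θ in (0 : ℝ)..(2 * Real.pi), (circlePt r θ - ζ) ^ l *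
        hankelSqDeriv k l (kernelArg r θ ζ 0) * fourierFactor n θ =
      if n ≤ l then 2 * (Real.pi : ℂ) * ((r : ℂ) ^ n * hankelSqDeriv k n ((r : ℂ) ^ 2)) *
        (((l - n).factorial : ℂ)⁻¹ * (k ^ 2 / 4 * ζ) ^ (l - n)) else 0 := by
  have h0r : ‖(0 : ℂ)‖ < r := by simpa using hr
  -- `T j` is the `j`-th `ζ`-derivative of the integrand. By `hankelSqDeriv_equation`, each of the
  -- first `l` derivatives lowers both the power and the index of `h` by one at the cost of a factor
  -- `k² / 4`. Later derivatives fall on `h` alone and produce factors `-X̄`.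
  set T : ℕ → ℂ → ℝ → ℂ := fun j ζ θ =>
    (if j ≤ l then (k ^ 2 / 4) ^ j * (circlePt r θ - ζ) ^ (l - j) *
        hankelSqDeriv k (l - j) (kernelArg r θ ζ 0)
      else (k ^ 2 / 4) ^ l * (-circlePtConj r θ) ^ (j - l) *
        hankelSqDeriv k (j - l) (kernelArg r θ ζ 0)) * fourierFactor n θ with hT
  have hTge : ∀ j, l ≤ j → ∀ ζ θ, T j ζ θ = (k ^ 2 / 4) ^ l * (-circlePtConj r θ) ^ (j - l) *
        hankelSqDeriv k (j - l) (kernelArg r θ ζ 0) * fourierFactor n θ := by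
    intro j hj ζ θ
    simp only [hT]
    rcases hj.eq_or_lt with rfl | hj
    · simp
    · rw [if_neg (by omega)]
  have hTle : ∀ j, j ≤ l → ∀ ζ θ, T j ζ θ = (k ^ 2 / 4) ^ j * (circlePt r θ - ζ) ^ (l - j) *
        hankelSqDeriv k (l - j) (kernelArg r θ ζ 0) * fourierFactor n θ := by
    intro j hj ζ θ
    simp only [hT]
    rw [if_pos hj]
  have hTc : ∀ j, ContinuousOn (Function.uncurry (T j)) (Metric.ball 0 r ×ˢ univ) := by
    intro j
    rcases le_total l j with hj | hj
    · have e : Function.uncurry (T j) = fun p : ℂ × ℝ =>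
          (k ^ 2 / 4) ^ l * (-circlePtConj r p.2) ^ (j - l) *
        hankelSqDeriv k (j - l) (kernelArg r p.2 p.1 0) * fourierFactor n p.2 := by
        ext p; exact hTge j hj p.1 p.2
      rw [e]
      exact ((by fun_prop : Continuous fun p : ℂ × ℝ =>
        (k ^ 2 / 4) ^ l * (-circlePtConj r p.2) ^ (j - l)).continuousOn.mul
        (continuousOn_kernel_left k hr _ h0r)).mul (by fun_prop)
    · have e : Function.uncurry (T j) = fun p : ℂ × ℝ =>
          (k ^ 2 / 4) ^ j * (circlePt r p.2 - p.1) ^ (l - j) *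
        hankelSqDeriv k (l - j) (kernelArg r p.2 p.1 0) * fourierFactor n p.2 := by
        ext p; exact hTle j hj p.1 p.2
      rw [e]
      exact ((by fun_prop : Continuous fun p : ℂ × ℝ =>
        (k ^ 2 / 4) ^ j * (circlePt r p.2 - p.1) ^ (l - j)).continuousOn.mul
        (continuousOn_kernel_left k hr _ h0r)).mul (by fun_prop)
  have hTd : ∀ j, ∀ ζ ∈ Metric.ball (0 : ℂ) r, ∀ θ,
      HasDerivAt (fun ζ => T j ζ θ) (T (j + 1) ζ θ) ζ := by
    intro j ζ hζ θ
    have hζ' : ‖ζ‖ < r := by simpa using hζ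
    rcases le_or_gt l j with hj | hj
    · have h := ((hasDerivAt_kernel_left k hr (j - l) θ hζ' h0r).const_mul
        ((k ^ 2 / 4) ^ l * (-circlePtConj r θ) ^ (j - l))).mul_const (fourierFactor n θ)
      rw [funext fun ζ => hTge j hj ζ θ, hTge (j + 1) (by omega) ζ θ]
      refine h.congr_deriv ?_
      rw [show j + 1 - l = j - l + 1 by omega]
      ring
    · obtain ⟨m, rfl⟩ := Nat.exists_eq_add_of_lt hj
      have hs := mem_slitPlane_circle hr θ hζ' h0r
      have h1 : HasDerivAt (fun ζ => (circlePt r θ - ζ) ^ (m + 1))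
          (-((m + 1) * (circlePt r θ - ζ) ^ m)) ζ := by
        have := ((hasDerivAt_id ζ).const_sub (circlePt r θ)).pow (m + 1)
        refine this.congr_deriv ?_
        simp
      have h := ((h1.mul (hasDerivAt_kernel_left k hr (m + 1) θ hζ' h0r)).const_mul
        ((k ^ 2 / 4) ^ j)).mul_const (fourierFactor n θ)
      rw [funext fun ζ => hTle j hj.le ζ θ, hTle (j + 1) (by omega) ζ θ]
      rw [show j + m + 1 - j = m + 1 by omega, show j + m + 1 - (j + 1) = m by omega]
      refine (h.congr_of_eventuallyEq (Eventually.of_forall fun z => ?_)).congr_deriv ?_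
      · simp only [Pi.mul_apply]; ring
      · have he := hankelSqDeriv_equation k m hs
        change kernelArg r θ ζ 0 * _ + _ * hankelSqDeriv k (m + 1) (kernelArg r θ ζ 0) +
          _ * hankelSqDeriv k m (kernelArg r θ ζ 0) = 0 at he
        change _ * hankelSqDeriv k (m + 2) (kernelArg r θ ζ 0) + _ + _ = 0 at he
        have ha : kernelArg r θ ζ 0 = (circlePt r θ - ζ) * (circlePtConj r θ - 0) := rfl
        rw [show (m + 1 + 1) = m + 2 from rfl]
        linear_combination (-(k ^ 2 / 4) ^ j * (circlePt r θ - ζ) ^ m * fourierFactor n θ) * he +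
          (k ^ 2 / 4) ^ j * (circlePt r θ - ζ) ^ m * fourierFactor n θ *
            hankelSqDeriv k (m + 2) (kernelArg r θ ζ 0) * ha
  have hsum := hasSum_taylor_of_hasDerivAt
    (f := fun j ζ => ∫ θ in (0 : ℝ)..(2 * Real.pi), T j ζ θ) (r := r)
    (fun j z hz => hasDerivAt_integral_period Metric.isOpen_ball (hTc j) (hTc (j + 1)) (hTd j) hz)
    (z := ζ) (by simpa using hζ)
  -- At `ζ = 0` the argument of `h` is the constant `r²`, so only powers of `X` or `X̄` are
  -- integrated. Orthogonality selects `l - j = n`; for `j > l` nothing survives because `n ≥ 0`.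
  have hT0 : ∀ j, (∫ θ in (0 : ℝ)..(2 * Real.pi), T j 0 θ) =
      if n + j = l then (k ^ 2 / 4) ^ j * hankelSqDeriv k n ((r : ℂ) ^ 2) *
        (2 * (Real.pi : ℂ) * (r : ℂ) ^ n) else 0 := by
    intro j
    have harg : ∀ θ, kernelArg r θ 0 0 = (r : ℂ) ^ 2 := fun θ => by
      simp [kernelArg, circlePt_mul_conj]
    rcases le_or_gt j l with hj | hj
    · have e : ∀ θ, T j 0 θ = ((k ^ 2 / 4) ^ j * hankelSqDeriv k (l - j) ((r : ℂ) ^ 2)) *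
          (circlePt r θ ^ (l - j) * fourierFactor n θ) := by
        intro θ
        rw [hTle j hj, harg, sub_zero]; ring
      simp_rw [e]
      rw [intervalIntegral.integral_const_mul, integral_circlePt_pow_mul]
      by_cases h : n + j = l
      · rw [if_pos h, if_pos (by omega), show l - j = n by omega]
      · rw [if_neg h, if_neg (by omega), mul_zero]
    · have e : ∀ θ, T j 0 θ = ((k ^ 2 / 4) ^ l * (-1) ^ (j - l) *
          hankelSqDeriv k (j - l) ((r : ℂ) ^ 2)) *
          (circlePtConj r θ ^ (j - l) * fourierFactor n θ) := by
        intro θ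
        rw [hTge j hj.le, harg, neg_pow]; ring
      simp_rw [e]
      rw [intervalIntegral.integral_const_mul, integral_circlePtConj_pow_mul,
        if_neg (by omega), if_neg (by omega), mul_zero]
  have hgoal : ∫ θ in (0 : ℝ)..(2 * Real.pi), (circlePt r θ - ζ) ^ l *
        hankelSqDeriv k l (kernelArg r θ ζ 0) * fourierFactor n θ =
        ∫ θ in (0 : ℝ)..(2 * Real.pi), T 0 ζ θ := by
    refine intervalIntegral.integral_congr fun θ _ => ?_
    rw [hTle 0 (Nat.zero_le _)]; simp
  rw [hgoal]
  simp only [hT0] at hsum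
  split_ifs with h
  · refine hsum.unique ?_
    have := hasSum_single (f := fun j : ℕ => (j.factorial : ℂ)⁻¹ * ζ ^ j * if n + j = l then
      (k ^ 2 / 4) ^ j * hankelSqDeriv k n ((r : ℂ) ^ 2) * (2 * (Real.pi : ℂ) * (r : ℂ) ^ n) else 0)
      (l - n) (fun j hj => by rw [if_neg (by omega), mul_zero])
    rw [if_pos (by omega)] at this
    convert this using 1
    rw [mul_pow]; ring
  · refine hsum.unique ?_
    convert hasSum_zero using 2 with j
    rw [if_neg (by omega), mul_zero]

/-- The regular solutions `η ^ n B_n(-k² ζ η / 4)` of the Helmholtz equation. -/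
noncomputable def regularWave (k : ℂ) (n : ℕ) (ζ η : ℂ) : ℂ :=
  2 * (Real.pi : ℂ) * (-1) ^ n * η ^ n * besselB n (-(k ^ 2 / 4) * ζ * η)

include hr in
/-- Graf's addition theorem for the fundamental solution, in integrated form. -/
lemma integral_kernel_mul_fourierFactor (n : ℕ) {ζ η : ℂ} (hζ : ‖ζ‖ < r) (hη : ‖η‖ < r) :
    ∫ θ in (0 : ℝ)..(2 * Real.pi), hankelSqDeriv k 0 (kernelArg r θ ζ η) * fourierFactor n θ =
      (r : ℂ) ^ n * hankelSqDeriv k n ((r : ℂ) ^ 2) * regularWave k n ζ η := by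
  have hsum := hasSum_taylor_of_hasDerivAt
    (f := fun l η => ∫ θ in (0 : ℝ)..(2 * Real.pi), (-(circlePt r θ - ζ)) ^ l *
        hankelSqDeriv k l (kernelArg r θ ζ η) * fourierFactor n θ) (r := r)
    (fun l z hz => by
      refine hasDerivAt_integral_period (F' := fun η θ => (-(circlePt r θ - ζ)) ^ (l + 1) *
        hankelSqDeriv k (l + 1) (kernelArg r θ ζ η) * fourierFactor n θ)
        Metric.isOpen_ball ?_ ?_ ?_ hz
      · exact ((by fun_prop : Continuous fun p : ℂ × ℝ =>
          (-(circlePt r p.2 - ζ)) ^ l).continuousOn.mul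
          (continuousOn_kernel_right k hr _ hζ)).mul (by fun_prop)
      · exact ((by fun_prop : Continuous fun p : ℂ × ℝ =>
          (-(circlePt r p.2 - ζ)) ^ (l + 1)).continuousOn.mul
          (continuousOn_kernel_right k hr _ hζ)).mul (by fun_prop)
      · intro w hw θ
        have h := ((hasDerivAt_kernel_right k hr l θ hζ (by simpa using hw)).const_mul
          ((-(circlePt r θ - ζ)) ^ l)).mul_const (fourierFactor n θ)
        refine h.congr_deriv ?_
        ring)
    (z := η) (by simpa using hη)
  have e0 : ∀ l : ℕ, ∫ θ in (0 : ℝ)..(2 * Real.pi), (-(circlePt r θ - ζ)) ^ l *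
        hankelSqDeriv k l (kernelArg r θ ζ 0) * fourierFactor n θ =
      (-1) ^ l * if n ≤ l then 2 * (Real.pi : ℂ) *
        ((r : ℂ) ^ n * hankelSqDeriv k n ((r : ℂ) ^ 2)) *
        (((l - n).factorial : ℂ)⁻¹ * (k ^ 2 / 4 * ζ) ^ (l - n)) else 0 := by
    intro l
    rw [← integral_sub_pow_mul_kernel k hr l n hζ, ← intervalIntegral.integral_const_mul]
    refine intervalIntegral.integral_congr fun θ _ => ?_
    rw [neg_pow]; ring
  simp only [e0, pow_zero, one_mul] at hsum
  refine hsum.unique ?_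
  -- The Taylor coefficients in `η` of index below `n` vanish; shifting by `n` leaves the series of
  -- `besselB n`.
  rw [← hasSum_nat_add_iff' n]
  have hz : ∑ i ∈ Finset.range n, ((i.factorial : ℂ)⁻¹ * η ^ i * ((-1) ^ i * if n ≤ i then
      2 * (Real.pi : ℂ) * ((r : ℂ) ^ n * hankelSqDeriv k n ((r : ℂ) ^ 2)) *
        (((i - n).factorial : ℂ)⁻¹ * (k ^ 2 / 4 * ζ) ^ (i - n)) else 0)) = 0 := by
    refine Finset.sum_eq_zero fun i hi => ?_
    rw [if_neg (by have := Finset.mem_range.mp hi; omega), mul_zero, mul_zero]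
  rw [hz, sub_zero]
  have hB := ((factorialDecay_besselB n).summable (-(k ^ 2 / 4) * ζ * η)).hasSum.mul_left
    ((r : ℂ) ^ n * hankelSqDeriv k n ((r : ℂ) ^ 2) * (2 * (Real.pi : ℂ) * (-1) ^ n * η ^ n))
  have e1 : (r : ℂ) ^ n * hankelSqDeriv k n ((r : ℂ) ^ 2) * regularWave k n ζ η =
      (r : ℂ) ^ n * hankelSqDeriv k n ((r : ℂ) ^ 2) * (2 * (Real.pi : ℂ) * (-1) ^ n * η ^ n) *
        besselB n (-(k ^ 2 / 4) * ζ * η) := by rw [regularWave]; ring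
  rw [e1]
  refine hB.congr_fun fun m => ?_
  have e2 : (-(k ^ 2 / 4) * ζ * η) ^ m = (-1) ^ m * (k ^ 2 / 4 * ζ) ^ m * η ^ m := by
    rw [← mul_pow, ← mul_pow]; congr 1; ring
  rw [if_pos (by omega), Nat.add_sub_cancel, e2, pow_add, pow_add, one_div, mul_inv]
  ring

end Addition

section AdditionInt

variable (k : ℂ) {r : ℝ} (hr : 0 < r)

lemma integral_period_comp_neg {g : ℝ → ℂ} (hg : Function.Periodic g (2 * Real.pi)) :
    ∫ θ in (0 : ℝ)..(2 * Real.pi), g (-θ) = ∫ θ in (0 : ℝ)..(2 * Real.pi), g θ := by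
  rw [intervalIntegral.integral_comp_neg]
  have := hg.intervalIntegral_add_eq (-(2 * Real.pi)) 0
  simpa using this

lemma circlePt_periodic (r : ℝ) : Function.Periodic (circlePt r) (2 * Real.pi) := by
  intro θ
  rw [circlePt, circlePt]
  push_cast
  rw [add_mul, Complex.exp_periodic]

lemma circlePtConj_periodic (r : ℝ) : Function.Periodic (circlePtConj r) (2 * Real.pi) := by
  intro θ
  rw [← circlePt_neg, ← circlePt_neg, neg_add, ← sub_eq_add_neg]
  exact (circlePt_periodic r).sub_eq _

lemma fourierFactor_periodic (n : ℤ) : Function.Periodic (fourierFactor n) (2 * Real.pi) := by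
  intro θ
  rw [fourierFactor, fourierFactor]
  have e : ((-n : ℤ) : ℂ) * (((θ + 2 * Real.pi : ℝ) : ℂ) * Complex.I) =
      ((-n : ℤ) : ℂ) * ((θ : ℂ) * Complex.I) + ((-n : ℤ) : ℂ) * (2 * Real.pi * Complex.I) := by
    push_cast; ring
  rw [e, Complex.exp_add, Complex.exp_int_mul_two_pi_mul_I, mul_one]

/-- The regular solutions of the Helmholtz equation with integer angular index. -/
noncomputable def regularWaveInt (k : ℂ) (n : ℤ) (ζ η : ℂ) : ℂ :=
  if 0 ≤ n then regularWave k n.natAbs ζ η else regularWave k n.natAbs η ζ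

/-- The radial factor of the outgoing solutions of angular index `n`. -/
noncomputable def outgoingRadial (k : ℂ) (n : ℤ) (r : ℝ) : ℂ :=
  (r : ℂ) ^ n.natAbs * hankelSqDeriv k n.natAbs ((r : ℂ) ^ 2)

include hr in
-- Negative `n` reduces to positive `n` by the reflection `θ ↦ -θ`, which exchanges `X` with `X̄`,
-- hence `ζ` with `η`.
lemma integral_kernel_mul_fourierFactor_int (n : ℤ) {ζ η : ℂ} (hζ : ‖ζ‖ < r) (hη : ‖η‖ < r) :
    ∫ θ in (0 : ℝ)..(2 * Real.pi), hankelSqDeriv k 0 (kernelArg r θ ζ η) * fourierFactor n θ =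
      outgoingRadial k n r * regularWaveInt k n ζ η := by
  rw [regularWaveInt, outgoingRadial]
  split_ifs with h
  · rw [← integral_kernel_mul_fourierFactor k hr n.natAbs hζ hη, Int.natAbs_of_nonneg h]
  · have hn : ((n.natAbs : ℕ) : ℤ) = -n := by omega
    rw [← integral_kernel_mul_fourierFactor k hr n.natAbs hη hζ, hn,
      ← integral_period_comp_neg (g := fun θ => hankelSqDeriv k 0 (kernelArg r θ η ζ) *
        fourierFactor (-n) θ)]
    · refine intervalIntegral.integral_congr fun θ _ => ?_
      simp only [kernelArg, circlePt_neg, circlePtConj_neg, fourierFactor_neg, neg_neg]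
      rw [mul_comm (circlePt r θ - ζ)]
    · intro θ
      simp only [kernelArg, circlePt_periodic r θ, circlePtConj_periodic r θ,
        fourierFactor_periodic (-n) θ]

include hr in
-- The `ζ`-derivative of the addition theorem, for dipole sources. The radial factor does not depend
-- on `ζ` and is therefore unchanged.
lemma integral_kernel_left_mul_fourierFactor (n : ℤ) {ζ η : ℂ} (hζ : ‖ζ‖ < r) (hη : ‖η‖ < r) :
    ∫ θ in (0 : ℝ)..(2 * Real.pi), (circlePtConj r θ - η) *
        hankelSqDeriv k 1 (kernelArg r θ ζ η) * fourierFactor n θ =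
      outgoingRadial k n r * -deriv (fun ζ => regularWaveInt k n ζ η) ζ := by
  have hζ' : ζ ∈ Metric.ball (0 : ℂ) r := by simpa using hζ
  have h := hasDerivAt_integral_period (U := Metric.ball (0 : ℂ) r) Metric.isOpen_ball
    (F := fun ζ θ => hankelSqDeriv k 0 (kernelArg r θ ζ η) * fourierFactor n θ)
    (F' := fun ζ θ => hankelSqDeriv k 1 (kernelArg r θ ζ η) * (-(circlePtConj r θ - η)) *
      fourierFactor n θ)
    ((continuousOn_kernel_left k hr 0 hη).mul (by fun_prop))
    (((continuousOn_kernel_left k hr 1 hη).mul (by fun_prop)).mul (by fun_prop))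
    (fun z hz θ => (hasDerivAt_kernel_left k hr 0 θ (by simpa using hz) hη).mul_const _) hζ'
  have h2 := (h.congr_of_eventuallyEq (Filter.eventuallyEq_of_mem
    (Metric.isOpen_ball.mem_nhds hζ') (fun z hz =>
    (integral_kernel_mul_fourierFactor_int k hr n (by simpa using hz) hη).symm))).deriv
  rw [deriv_const_mul_field] at h2
  rw [mul_neg, h2, ← intervalIntegral.integral_neg]
  refine intervalIntegral.integral_congr fun θ _ => ?_
  ring

include hr in
lemma integral_kernel_right_mul_fourierFactor (n : ℤ) {ζ η : ℂ} (hζ : ‖ζ‖ < r) (hη : ‖η‖ < r) :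
    ∫ θ in (0 : ℝ)..(2 * Real.pi), (circlePt r θ - ζ) *
        hankelSqDeriv k 1 (kernelArg r θ ζ η) * fourierFactor n θ =
      outgoingRadial k n r * -deriv (fun η => regularWaveInt k n ζ η) η := by
  have hη' : η ∈ Metric.ball (0 : ℂ) r := by simpa using hη
  have h := hasDerivAt_integral_period (U := Metric.ball (0 : ℂ) r) Metric.isOpen_ball
    (F := fun η θ => hankelSqDeriv k 0 (kernelArg r θ ζ η) * fourierFactor n θ)
    (F' := fun η θ => hankelSqDeriv k 1 (kernelArg r θ ζ η) * (-(circlePt r θ - ζ)) *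
      fourierFactor n θ)
    ((continuousOn_kernel_right k hr 0 hζ).mul (by fun_prop))
    (((continuousOn_kernel_right k hr 1 hζ).mul (by fun_prop)).mul (by fun_prop))
    (fun z hz θ => (hasDerivAt_kernel_right k hr 0 θ hζ (by simpa using hz)).mul_const _) hη'
  have h2 := (h.congr_of_eventuallyEq (Filter.eventuallyEq_of_mem
    (Metric.isOpen_ball.mem_nhds hη') (fun z hz =>
    (integral_kernel_mul_fourierFactor_int k hr n hζ (by simpa using hz)).symm))).deriv
  rw [deriv_const_mul_field] at h2
  rw [mul_neg, h2, ← intervalIntegral.integral_neg]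
  refine intervalIntegral.integral_congr fun θ _ => ?_
  ring

end AdditionInt

/-! ### Potentials of sources in a disk. -/

section Potential

/-- A point of the plane as a complex number. -/
noncomputable def toComplex (y : Plane) : ℂ := ⟨y 0, y 1⟩

/-- The point with polar coordinates `(r, θ)`. -/
noncomputable def polarPt (r θ : ℝ) : Plane := !₂[r * Real.cos θ, r * Real.sin θ]

lemma toComplex_eq (y : Plane) : toComplex y = (y 0 : ℂ) + (y 1 : ℂ) * Complex.I := by
  apply Complex.ext <;> simp [toComplex]

@[fun_prop] lemma continuous_toComplex : Continuous toComplex := by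
  rw [funext toComplex_eq]; fun_prop

@[fun_prop] lemma continuous_polarPt (r : ℝ) : Continuous (polarPt r) := by
  unfold polarPt
  refine (PiLp.continuous_toLp 2 _).comp (continuous_pi fun i => ?_)
  fin_cases i <;> simp <;> fun_prop

lemma norm_toComplex (y : Plane) : ‖toComplex y‖ = ‖y‖ := by
  rw [EuclideanSpace.norm_eq, Complex.norm_eq_sqrt_sq_add_sq]
  simp [toComplex, Fin.sum_univ_two]

lemma toComplex_sub (x y : Plane) : toComplex (x - y) = toComplex x - toComplex y := by
  apply Complex.ext <;> simp [toComplex]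

lemma toComplex_polarPt (r θ : ℝ) : toComplex (polarPt r θ) = circlePt r θ := by
  rw [circlePt, Complex.exp_mul_I]
  apply Complex.ext <;> simp [toComplex, polarPt, Complex.cos_ofReal_re, Complex.sin_ofReal_re]

lemma conj_toComplex_polarPt (r θ : ℝ) :
    (starRingEnd ℂ) (toComplex (polarPt r θ)) = circlePtConj r θ := by
  rw [toComplex_polarPt, circlePt, circlePtConj, map_mul, Complex.conj_ofReal, ← Complex.exp_conj]
  simp

lemma norm_polarPt {r : ℝ} (hr : 0 ≤ r) (θ : ℝ) : ‖polarPt r θ‖ = r := by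
  rw [← norm_toComplex, toComplex_polarPt, norm_circlePt hr]

/-- The density of a layer potential with source densities `a`, `b`, `c` at `y`. -/
noncomputable def potentialDensity (k : ℂ) (a b c : Plane → ℂ) (x y : Plane) : ℂ :=
  a y * hankelSqDeriv k 0 ((‖x - y‖ ^ 2 : ℝ) : ℂ) +
    b y * ((starRingEnd ℂ) (toComplex (x - y)) * hankelSqDeriv k 1 ((‖x - y‖ ^ 2 : ℝ) : ℂ)) +
    c y * (toComplex (x - y) * hankelSqDeriv k 1 ((‖x - y‖ ^ 2 : ℝ) : ℂ))

lemma norm_sub_sq_eq_kernelArg (r θ : ℝ) (y : Plane) :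
    ((‖polarPt r θ - y‖ ^ 2 : ℝ) : ℂ) =
      kernelArg r θ (toComplex y) ((starRingEnd ℂ) (toComplex y)) := by
  rw [kernelArg, ← conj_toComplex_polarPt, ← toComplex_polarPt, ← map_sub, ← toComplex_sub,
    Complex.mul_conj, Complex.normSq_eq_norm_sq, norm_toComplex]

/-- Supplies the joint integrability for Fubini: the kernel is bounded on the compact set that
carries the product measure. -/
lemma integrable_mul_of_continuousOn {μ : Measure Plane} [SFinite μ] {R : ℝ}
    (hμ : ∀ᵐ y ∂μ, y ∈ Metric.closedBall (0 : Plane) R) {a : Plane → ℂ} (ha : Integrable a μ)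
    {G : ℝ → Plane → ℂ}
    (hG : ContinuousOn (Function.uncurry G) (univ ×ˢ Metric.closedBall (0 : Plane) R)) :
    Integrable (Function.uncurry fun θ y => a y * G θ y)
      ((volume.restrict (uIoc 0 (2 * Real.pi))).prod μ) := by
  have hpi : (0 : ℝ) ≤ 2 * Real.pi := by positivity
  rw [uIoc_of_le hpi]
  set ν : Measure ℝ := volume.restrict (Ioc 0 (2 * Real.pi))
  obtain ⟨C, hC⟩ := ((isCompact_Icc (a := (0 : ℝ)) (b := 2 * Real.pi)).prod
    (isCompact_closedBall (0 : Plane) R)).exists_bound_of_continuousOn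
    (hG.mono (prod_mono (subset_univ _) subset_rfl))
  have e : (ν.prod μ).restrict ((Ioc 0 (2 * Real.pi)) ×ˢ Metric.closedBall (0 : Plane) R) =
      ν.prod μ := by
    rw [← Measure.prod_restrict, Measure.restrict_eq_self_of_ae_mem hμ,
      Measure.restrict_restrict measurableSet_Ioc, inter_self]
  have hmeas : MeasurableSet ((Ioc 0 (2 * Real.pi)) ×ˢ Metric.closedBall (0 : Plane) R) :=
    measurableSet_Ioc.prod Metric.isClosed_closedBall.measurableSet
  have h1 : Integrable (fun p : ℝ × Plane => a p.2) (ν.prod μ) := ha.comp_snd ν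
  refine h1.mul_bdd (c := C) ?_ ?_
  · rw [← e]
    exact (hG.mono (prod_mono (subset_univ _) subset_rfl)).aestronglyMeasurable hmeas
  · rw [← e]
    refine (ae_restrict_mem hmeas).mono fun p hp => ?_
    exact hC p ⟨Ioc_subset_Icc_self hp.1, hp.2⟩

/-- The Fourier coefficients on circles of a layer potential are multiples of the outgoing radial
functions. -/
lemma exists_fourier_potential (k : ℂ) {μ : Measure Plane} [SFinite μ] {R : ℝ}
    (hR : 0 ≤ R) (hμ : ∀ᵐ y ∂μ, y ∈ Metric.closedBall (0 : Plane) R) {a b c : Plane → ℂ}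
    (ha : Integrable a μ) (hb : Integrable b μ) (hc : Integrable c μ) (n : ℤ) :
    ∃ A : ℂ, ∀ r > R,
      IntervalIntegrable (fun θ => (∫ y, potentialDensity k a b c (polarPt r θ) y ∂μ) *
        fourierFactor n θ) volume 0 (2 * Real.pi) ∧
      ∫ θ in (0 : ℝ)..(2 * Real.pi), (∫ y, potentialDensity k a b c (polarPt r θ) y ∂μ) *
        fourierFactor n θ = outgoingRadial k n r * A := by
  set w : ℂ → ℂ → ℂ := regularWaveInt k n
  -- The coefficient pairs the densities with the regular wave and its two derivatives, restricted
  -- to `η = ζ̄`; no `r` enters.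
  refine ⟨∫ y, (a y * w (toComplex y) ((starRingEnd ℂ) (toComplex y)) +
    b y * -deriv (fun ζ => w ζ ((starRingEnd ℂ) (toComplex y))) (toComplex y) +
    c y * -deriv (fun η => w (toComplex y) η) ((starRingEnd ℂ) (toComplex y))) ∂μ, fun r hr => ?_⟩
  have hr0 : 0 < r := by linarith
  set ζ : Plane → ℂ := toComplex
  set η : Plane → ℂ := fun y => (starRingEnd ℂ) (toComplex y) with hη
  have hηc : Continuous η := Complex.continuous_conj.comp continuous_toComplex
  have hζn : ∀ y ∈ Metric.closedBall (0 : Plane) R, ‖ζ y‖ < r := fun y hy => by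
    rw [norm_toComplex]; exact (by simpa using hy : ‖y‖ ≤ R).trans_lt hr
  have hηn : ∀ y ∈ Metric.closedBall (0 : Plane) R, ‖η y‖ < r := fun y hy => by
    rw [hη, RCLike.norm_conj]; exact hζn y hy
  have hker : ∀ l, ContinuousOn (fun p : ℝ × Plane => hankelSqDeriv k l
      (kernelArg r p.1 (ζ p.2) (η p.2))) (univ ×ˢ Metric.closedBall (0 : Plane) R) := fun l =>
    continuousOn_hankelSqDeriv_circle k hr0 l (continuous_toComplex.comp continuous_snd)
      (hηc.comp continuous_snd) continuous_fst (fun p hp => hζn _ hp.2) (fun p hp => hηn _ hp.2)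
  set G₀ : ℝ → Plane → ℂ := fun θ y =>
    hankelSqDeriv k 0 (kernelArg r θ (ζ y) (η y)) * fourierFactor n θ
  set G₁ : ℝ → Plane → ℂ := fun θ y => (circlePtConj r θ - η y) *
    hankelSqDeriv k 1 (kernelArg r θ (ζ y) (η y)) * fourierFactor n θ
  set G₂ : ℝ → Plane → ℂ := fun θ y => (circlePt r θ - ζ y) *
    hankelSqDeriv k 1 (kernelArg r θ (ζ y) (η y)) * fourierFactor n θ
  have hG₀ : ContinuousOn (Function.uncurry G₀) (univ ×ˢ Metric.closedBall (0 : Plane) R) :=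
    (hker 0).mul (by fun_prop)
  have hG₁ : ContinuousOn (Function.uncurry G₁) (univ ×ˢ Metric.closedBall (0 : Plane) R) :=
    ((by fun_prop : Continuous fun p : ℝ × Plane =>
      circlePtConj r p.1 - η p.2).continuousOn.mul (hker 1)).mul (by fun_prop)
  have hG₂ : ContinuousOn (Function.uncurry G₂) (univ ×ˢ Metric.closedBall (0 : Plane) R) :=
    ((by fun_prop : Continuous fun p : ℝ × Plane =>
      circlePt r p.1 - toComplex p.2).continuousOn.mul (hker 1)).mul (by fun_prop)
  have hint := ((integrable_mul_of_continuousOn hμ ha hG₀).add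
    (integrable_mul_of_continuousOn hμ hb hG₁)).add (integrable_mul_of_continuousOn hμ hc hG₂)
  set F : ℝ → Plane → ℂ := fun θ y => a y * G₀ θ y + b y * G₁ θ y + c y * G₂ θ y with hF
  replace hint : Integrable (Function.uncurry F)
      ((volume.restrict (uIoc 0 (2 * Real.pi))).prod μ) := hint
  have heq : ∀ θ, (∫ y, potentialDensity k a b c (polarPt r θ) y ∂μ) * fourierFactor n θ =
      ∫ y, F θ y ∂μ := by
    intro θ
    rw [← integral_mul_const]
    refine integral_congr_ae (Eventually.of_forall fun y => ?_)
    simp only [potentialDensity, hF, G₀, G₁, G₂]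
    rw [norm_sub_sq_eq_kernelArg, toComplex_sub, map_sub, conj_toComplex_polarPt,
      toComplex_polarPt]
    ring
  simp only [heq]
  constructor
  · rw [intervalIntegrable_iff]
    exact hint.integral_prod_left
  · rw [intervalIntegral_integral_swap hint, ← integral_const_mul]
    refine integral_congr_ae (hμ.mono fun y hy => ?_)
    have hslice : ∀ {G : ℝ → Plane → ℂ},
        ContinuousOn (Function.uncurry G) (univ ×ˢ Metric.closedBall (0 : Plane) R) →
        Continuous fun θ => G θ y := fun {G} hG => by
      rw [← continuousOn_univ]
      exact hG.comp (f := fun θ : ℝ => (θ, y)) (by fun_prop) (fun θ _ => ⟨mem_univ _, hy⟩)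
    have h0 := (((hslice hG₀).const_mul (a y)).intervalIntegrable
      (μ := volume) 0 (2 * Real.pi))
    have h1 := (((hslice hG₁).const_mul (b y)).intervalIntegrable
      (μ := volume) 0 (2 * Real.pi))
    have h2 := (((hslice hG₂).const_mul (c y)).intervalIntegrable
      (μ := volume) 0 (2 * Real.pi))
    simp only [hF]
    rw [intervalIntegral.integral_add (h0.add h1) h2, intervalIntegral.integral_add h0 h1,
      intervalIntegral.integral_const_mul, intervalIntegral.integral_const_mul,
      intervalIntegral.integral_const_mul]
    simp only [G₀, G₁, G₂]
    rw [integral_kernel_mul_fourierFactor_int k hr0 n (hζn y hy) (hηn y hy),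
      integral_kernel_left_mul_fourierFactor k hr0 n (hζn y hy) (hηn y hy),
      integral_kernel_right_mul_fourierFactor k hr0 n (hζn y hy) (hηn y hy)]
    ring

end Potential

/-! ### Finite length of a Lipschitz boundary. -/

/-- The graph parametrization `t ↦ A⁻¹ (t, γ t)` is Lipschitz. -/
lemma lipschitzWith_graph (A : Plane ≃ₗᵢ[ℝ] Plane) {L : NNReal} {γ : ℝ → ℝ}
    (hγ : LipschitzWith L γ) :
    LipschitzWith (1 + L) fun t : ℝ => A.symm !₂[t, γ t] := by
  refine LipschitzWith.of_dist_le_mul fun s t => ?_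
  rw [A.symm.dist_map, EuclideanSpace.dist_eq, Fin.sum_univ_two]
  have h := hγ.dist_le_mul s t
  simp only [Matrix.cons_val_zero, Matrix.cons_val_one]
  rw [Real.sqrt_le_left (by positivity)]
  push_cast
  have h1 : 0 ≤ dist s t := dist_nonneg
  have h2 : 0 ≤ dist (γ s) (γ t) := dist_nonneg
  have h3 : (0 : ℝ) ≤ L := L.2
  nlinarith [mul_nonneg h3 h1]

/-- The boundary of a Lipschitz domain has finite length. -/
lemma isFiniteMeasure_boundaryMeasure {D : Set Plane} (hD : IsLipschitzDomain D) :
    IsFiniteMeasure (boundaryMeasure D) := by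
  obtain ⟨hopen, hbdd, hloc⟩ := hD
  have hcomp : IsCompact (frontier D) :=
    Metric.isCompact_of_isClosed_isBounded isClosed_frontier
      (hbdd.closure.subset frontier_subset_closure)
  refine ⟨?_⟩
  rw [boundaryMeasure, Measure.restrict_apply_univ]
  refine hcomp.measure_lt_top_of_nhdsWithin fun p hp => ?_
  obtain ⟨A, L, γ, hγ, hev⟩ := hloc p hp
  obtain ⟨ε, hε, hball⟩ := Metric.eventually_nhds_iff_ball.mp hev
  refine ⟨frontier D ∩ Metric.ball p ε,
    inter_mem_nhdsWithin _ (Metric.ball_mem_nhds p hε), ?_⟩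
  set f : ℝ → Plane := fun t => A.symm !₂[t, γ t]
  set M : ℝ := ‖p‖ + ε
  -- A nearby frontier point is on the graph: strictly below it would lie in the open set `D`,
  -- strictly above it would have a neighbourhood missing `D`. As `A` is a linear isometry, the
  -- first coordinate is bounded by `‖x‖ ≤ M`.
  have hsub : frontier D ∩ Metric.ball p ε ⊆ f '' Icc (-M) M := by
    rintro x ⟨hxf, hxb⟩
    have hge : γ ((A x) 0) ≤ (A x) 1 := by
      by_contra! h
      have hx : x ∈ D := (hball x hxb).mpr h
      rw [hopen.frontier_eq] at hxf
      exact hxf.2 hx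
    have hle : (A x) 1 ≤ γ ((A x) 0) := by
      by_contra! h
      have hop : IsOpen {y : Plane | γ ((A y) 0) < (A y) 1} :=
        isOpen_lt (hγ.continuous.comp (by fun_prop)) (by fun_prop)
      obtain ⟨z, ⟨hz, hzb⟩, hzD⟩ := mem_closure_iff.mp (frontier_subset_closure hxf) _
        (hop.inter Metric.isOpen_ball) ⟨h, hxb⟩
      exact absurd ((hball z hzb).mp hzD) (not_lt.mpr (le_of_lt hz))
    refine ⟨(A x) 0, ?_, ?_⟩
    · rw [mem_Icc, ← abs_le]
      have h1 : |(A x) 0| ≤ ‖A x‖ := by simpa using PiLp.norm_apply_le (A x) 0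
      rw [A.norm_map] at h1
      have h2 : ‖x - p‖ < ε := by simpa [dist_eq_norm] using hxb
      have h3 : ‖x‖ ≤ ‖p‖ + ‖x - p‖ := by simpa using norm_add_le p (x - p)
      exact h1.trans (by simp only [M]; linarith)
    · rw [LinearIsometryEquiv.symm_apply_eq]
      ext i
      fin_cases i
      · simp
      · simpa using le_antisymm hge hle
  refine (measure_mono hsub).trans_lt ?_
  refine ((lipschitzWith_graph A hγ).hausdorffMeasure_image_le zero_le_one _).trans_lt ?_
  rw [hausdorffMeasure_real]
  exact ENNReal.mul_lt_top (by simp) (by simp)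

/-! ### From the representation formula to potentials with integrable densities. -/

section Representation

variable {k : ℂ} (hk : k ≠ 0) {x : Plane}

lemma contDiffAt_hankelSq (k : ℂ) {s : ℂ} (hs : s ∈ Complex.slitPlane) :
    ContDiffAt ℝ ∞ (hankelSq k) s :=
  (((differentiableOn_hankelSqDeriv k 0).analyticAt
    (Complex.isOpen_slitPlane.mem_nhds hs)).contDiffAt).restrict_scalars ℝ

lemma ofReal_norm_sub_sq_mem_slitPlane {x y : Plane} (hxy : x ≠ y) :
    ((‖x - y‖ ^ 2 : ℝ) : ℂ) ∈ Complex.slitPlane := by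
  have := norm_pos_iff.mpr (sub_ne_zero.mpr hxy)
  rw [Complex.ofReal_mem_slitPlane]
  positivity

include hk in
lemma fundSol_eventuallyEq {y : Plane} (hxy : x ≠ y) :
    fundSol k x =ᶠ[𝓝 y] fun y => Complex.I / 4 * hankelSq k ((‖x - y‖ ^ 2 : ℝ) : ℂ) := by
  filter_upwards [isOpen_compl_singleton.mem_nhds (show y ∈ ({x} : Set Plane)ᶜ from
    fun h => hxy h.symm)] with z hz
  exact fundSol_eq hk (fun h => hz h.symm)

include hk in
lemma contDiffAt_fundSol {y : Plane} (hxy : x ≠ y) : ContDiffAt ℝ ∞ (fundSol k x) y := by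
  refine ContDiffAt.congr_of_eventuallyEq ?_ (fundSol_eventuallyEq hk hxy)
  refine contDiffAt_const.mul ?_
  refine ContDiffAt.comp (g := hankelSq k) (f := fun y : Plane => ((‖x - y‖ ^ 2 : ℝ) : ℂ)) y
    (contDiffAt_hankelSq k (ofReal_norm_sub_sq_mem_slitPlane hxy)) ?_
  exact Complex.ofRealCLM.contDiff.contDiffAt.comp y
    ((contDiff_const.sub contDiff_id).norm_sq ℝ).contDiffAt

include hk in
-- The real inner product `2 ⟨x - y, v⟩` is written as `z̄ w + z w̄`, which splits the derivative
-- into the two dipole kernels of `potentialDensity`.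
lemma fderiv_fundSol {y : Plane} (hxy : x ≠ y) (v : Plane) :
    fderiv ℝ (fundSol k x) y v = Complex.I / 4 *
      (-((starRingEnd ℂ) (toComplex (x - y)) * toComplex v +
        toComplex (x - y) * (starRingEnd ℂ) (toComplex v)) *
      hankelSqDeriv k 1 ((‖x - y‖ ^ 2 : ℝ) : ℂ)) := by
  have h1 : HasDerivAt (fun t : ℝ => hankelSq k (t : ℂ))
      (hankelSqDeriv k 1 ((‖x - y‖ ^ 2 : ℝ) : ℂ)) (‖x - y‖ ^ 2) :=
    (hasDerivAt_hankelSqDeriv k 0 (ofReal_norm_sub_sq_mem_slitPlane hxy)).comp_ofReal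
  have h2 : HasFDerivAt (fun y : Plane => ‖x - y‖ ^ 2) _ y :=
    ((hasFDerivAt_id y).const_sub x).norm_sq
  have h3 := (HasFDerivAt.comp (f := fun y : Plane => ‖x - y‖ ^ 2) y h1.hasFDerivAt h2).const_mul
    (Complex.I / 4)
  rw [(h3.congr_of_eventuallyEq (fundSol_eventuallyEq hk hxy)).fderiv]
  have e : inner ℝ (x - y) v = (x - y) 0 * v 0 + (x - y) 1 * v 1 := by
    rw [PiLp.inner_apply, Fin.sum_univ_two]; simp; ring
  have e2 : (starRingEnd ℂ) (toComplex (x - y)) * toComplex v +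
        toComplex (x - y) * (starRingEnd ℂ) (toComplex v) = 2 * (inner ℝ (x - y) v : ℝ) := by
    rw [e]
    apply Complex.ext <;> simp [toComplex] <;> ring
  rw [e2]
  simp [inner_sub_left]
  ring

end Representation

instance isFiniteMeasure_exteriorMeasure (D : Set Plane) (R : ℝ) :
    IsFiniteMeasure (exteriorMeasure D R) := by
  refine ⟨?_⟩
  rw [exteriorMeasure, Measure.restrict_apply_univ]
  exact (measure_mono sdiff_subset).trans_lt Metric.isBounded_ball.measure_lt_top

lemma toComplex_single : toComplex (EuclideanSpace.single (0 : Fin 2) (1 : ℝ)) = 1 ∧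
    toComplex (EuclideanSpace.single (1 : Fin 2) (1 : ℝ)) = Complex.I := by
  constructor <;> apply Complex.ext <;> simp [toComplex]

/-- An outgoing solution is, near infinity, a sum of a layer potential on the boundary and a
volume potential. -/
lemma exists_potential_representation {D : Set Plane} (hD : IsLipschitzDomain D) {k : ℂ}
    (hk : k ≠ 0) {u : Plane → ℂ} (hout : IsOutgoing D k u) :
    ∃ R > 0, closure D ⊆ Metric.ball 0 R ∧ ∃ a b c b' c' : Plane → ℂ,
      Integrable a (exteriorMeasure D R) ∧ Integrable b (exteriorMeasure D R) ∧
      Integrable c (exteriorMeasure D R) ∧ Integrable b' (boundaryMeasure D) ∧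
      Integrable c' (boundaryMeasure D) ∧ ∀ x, R < ‖x‖ →
        u x = Complex.I / 4 * ((∫ y, potentialDensity k a b c x y ∂(exteriorMeasure D R)) +
          ∫ y, potentialDensity k 0 b' c' x y ∂(boundaryMeasure D)) := by
  have hfin := isFiniteMeasure_boundaryMeasure hD
  obtain ⟨hH1, ν, g, ℓ, hν, hg, hℓ, hrep⟩ := hout
  obtain ⟨R₀, hR₀, hDR₀⟩ := hD.2.1.closure.subset_ball_lt 0 0
  -- For `‖x‖ > R₀ + 2` the cutoff vanishes near the singularity `x`, so `χ Φₖ(x, ·)` is a test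
  -- function. It has the boundary values of `Φₖ(x, ·)`, since `χ = 1` on `closure D`. Green's
  -- identity thus turns the pairing with `ℓ` into a volume integral.
  set χ : ContDiffBump (0 : Plane) := ⟨R₀, R₀ + 1, hR₀, by linarith⟩
  have hχ1 : ∀ y ∈ closure D, χ y = 1 := fun y hy =>
    χ.one_of_mem_closedBall (Metric.ball_subset_closedBall (hDR₀ hy))
  have hχd : Differentiable ℝ χ := (χ.contDiff (n := 1)).differentiable one_ne_zero
  have hχ0 : ∀ y : Plane, R₀ + 1 < ‖y‖ → χ =ᶠ[𝓝 y] 0 := by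
    intro y hy
    filter_upwards [(isOpen_lt continuous_const continuous_norm).mem_nhds
      (show y ∈ {z : Plane | R₀ + 1 < ‖z‖} from hy)] with z hz
    exact χ.zero_of_le_dist (by rw [dist_zero_right]; exact hz.le)
  set R : ℝ := R₀ + 2 with hR
  set μ := exteriorMeasure D R
  set σ := boundaryMeasure D
  set e : Fin 2 → Plane := fun i => EuclideanSpace.single i (1 : ℝ)
  have hu1 : Integrable u μ := (hH1 R).1.integrable one_le_two
  have hdu : ∀ v : Plane, Integrable (fun y => fderiv ℝ u y v) μ := fun v =>
    ((ContinuousLinearMap.apply ℝ ℂ v).integrable_comp ((hH1 R).2.integrable one_le_two))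
  have hbdd : ∀ {f : Plane → ℂ} {ψ : Plane → ℝ}, Integrable f μ → Continuous ψ →
      HasCompactSupport ψ → Integrable (fun y => f y * (ψ y : ℂ)) μ := by
    intro f ψ hf hψ hψs
    obtain ⟨C, hC⟩ := hψs.exists_bound_of_continuous hψ
    exact hf.mul_bdd (c := C) (Complex.continuous_ofReal.comp hψ).aestronglyMeasurable
      (Eventually.of_forall fun y => by rw [Complex.norm_real]; exact hC y)
  have hχc : Continuous χ := χ.continuous
  have hχs : HasCompactSupport χ := χ.hasCompactSupport
  have hχ'c : ∀ v, Continuous fun y => fderiv ℝ χ y v := fun v =>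
    ((χ.contDiff (n := 1)).continuous_fderiv one_ne_zero).clm_apply continuous_const
  have hχ's : ∀ v, HasCompactSupport fun y => fderiv ℝ χ y v := fun v => hχs.fderiv_apply ℝ v
  -- The volume densities come from the product rule for `χ Φₖ`: the first collects the factor of
  -- `Φₖ`, namely `∇u · ∇χ - k² u χ`, and the other two regroup `χ ∇u · ∇Φₖ`, the coordinate vectors
  -- being `1` and `i` as complex numbers.
  refine ⟨R, by positivity, hDR₀.trans (Metric.ball_subset_ball (by linarith)),
    fun y => fderiv ℝ u y (e 0) * (fderiv ℝ χ y (e 0) : ℝ) +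
      fderiv ℝ u y (e 1) * (fderiv ℝ χ y (e 1) : ℝ) - k ^ 2 * (u y * (χ y : ℝ)),
    fun y => (-1) * (fderiv ℝ u y (e 0) * (χ y : ℝ)) + (-Complex.I) *
      (fderiv ℝ u y (e 1) * (χ y : ℝ)),
    fun y => (-1) * (fderiv ℝ u y (e 0) * (χ y : ℝ)) + Complex.I *
      (fderiv ℝ u y (e 1) * (χ y : ℝ)),
    fun y => g y * -toComplex (ν y), fun y => g y * -(starRingEnd ℂ) (toComplex (ν y)),
    ?_, ?_, ?_, ?_, ?_, ?_⟩
  · exact ((hbdd (hdu _) (hχ'c _) (hχ's _)).add (hbdd (hdu _) (hχ'c _) (hχ's _))).sub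
      ((hbdd hu1 hχc hχs).const_mul _)
  · exact ((hbdd (hdu _) hχc hχs).const_mul _).add ((hbdd (hdu _) hχc hχs).const_mul _)
  · exact ((hbdd (hdu _) hχc hχs).const_mul _).add ((hbdd (hdu _) hχc hχs).const_mul _)
  · refine (hg.1.integrable one_le_two).mul_bdd (c := 1)
      (continuous_toComplex.neg.comp_aestronglyMeasurable hν.1) (hν.2.mono fun y hy => ?_)
    rw [norm_neg, norm_toComplex, hy.1]
  · refine (hg.1.integrable one_le_two).mul_bdd (c := 1)
      ((Complex.continuous_conj.comp continuous_toComplex).neg.comp_aestronglyMeasurable hν.1)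
      (hν.2.mono fun y hy => ?_)
    rw [norm_neg, RCLike.norm_conj, norm_toComplex, hy.1]
  intro x hx
  have hxy : ∀ {y : Plane}, ‖y‖ ≤ R → x ≠ y := fun {y} hy h => by rw [h] at hx; linarith
  have hxD : x ∈ (closure D)ᶜ := fun h => by
    have := hDR₀ h
    rw [Metric.mem_ball, dist_zero_right] at this
    linarith
  set φ : Plane → ℂ := fun y => (χ y : ℂ) * fundSol k x y with hφ
  have hφ0 : ∀ y : Plane, R₀ + 1 < ‖y‖ → φ =ᶠ[𝓝 y] fun _ => 0 := fun y hy =>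
    (hχ0 y hy).mono fun z hz => by simp only [hφ]; rw [hz]; simp
  have hφs : ContDiff ℝ ∞ φ := by
    rw [contDiff_iff_contDiffAt]
    intro y
    rcases le_or_gt ‖y‖ R with hy | hy
    · exact (Complex.ofRealCLM.contDiff.contDiffAt.comp y χ.contDiffAt).mul
        (contDiffAt_fundSol hk (hxy hy))
    · exact contDiffAt_const.congr_of_eventuallyEq (hφ0 y (by linarith))
  have hφc : HasCompactSupport φ := by
    have h1 : HasCompactSupport (fun y => (χ y : ℂ)) :=
      hχs.comp_left (g := fun t : ℝ => (t : ℂ)) Complex.ofReal_zero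
    exact h1.mul_right
  have hℓφ : ℓ (fun y : frontier D => fundSol k x y) = ℓ (fun y : frontier D => φ y) := by
    congr 1
    ext y
    simp only [hφ]
    rw [hχ1 _ (frontier_subset_closure y.2)]
    simp
  rw [hrep x hxD, hℓφ, hℓ φ hφs hφc, sub_neg_eq_add, mul_add, add_comm]
  congr 1
  · have hmeas : MeasurableSet (closure D)ᶜ := isClosed_closure.measurableSet.compl
    rw [← integral_const_mul]
    have hsub : Metric.ball (0 : Plane) R \ closure D ⊆ (closure D)ᶜ := fun y hy => hy.2
    rw [setIntegral_eq_of_subset_of_forall_sdiff_eq_zero hmeas hsub]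
    · refine setIntegral_congr_fun (Metric.isOpen_ball.measurableSet.diff
        isClosed_closure.measurableSet) fun y hy => ?_
      have hyR : ‖y‖ ≤ R := by
        have := hy.1
        rw [Metric.mem_ball, dist_zero_right] at this
        exact this.le
      have hfd : ∀ v, fderiv ℝ φ y v = (fderiv ℝ χ y v : ℝ) * fundSol k x y +
          (χ y : ℂ) * fderiv ℝ (fundSol k x) y v := by
        intro v
        have h1 : HasFDerivAt (fun y => (χ y : ℂ)) _ y :=
          Complex.ofRealCLM.hasFDerivAt.comp y (hχd y).hasFDerivAt
        have h2 := ((contDiffAt_fundSol hk (hxy hyR)).differentiableAt (by simp)).hasFDerivAt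
        have h3 : HasFDerivAt φ _ y := h1.mul h2
        rw [h3.fderiv]
        simp
        ring
      simp only [gradDot, Fin.sum_univ_two, potentialDensity]
      rw [hfd, hfd, fderiv_fundSol hk (hxy hyR), fderiv_fundSol hk (hxy hyR)]
      simp only [hφ]
      rw [fundSol_eq hk (hxy hyR), toComplex_single.1,
        toComplex_single.2, hankelSqDeriv_zero]
      simp only [map_one, Complex.conj_I, e]
      ring
    · intro y hy
      have hyR : R ≤ ‖y‖ := by
        by_contra! h
        exact hy.2 ⟨by simpa using h, hy.1⟩
      have h0 := hφ0 y (by linarith)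
      simp [gradDot, h0.fderiv_eq, h0.eq_of_nhds]
  · rw [← integral_const_mul]
    refine integral_congr_ae ?_
    refine (ae_restrict_mem isClosed_frontier.measurableSet).mono fun y hy => ?_
    have hyR : ‖y‖ ≤ R := by
      have := hDR₀ (frontier_subset_closure hy)
      rw [Metric.mem_ball, dist_zero_right] at this
      linarith
    simp only [potentialDensity, Pi.zero_apply]
    rw [fderiv_fundSol hk (hxy hyR)]
    ring

/-! ### Vanishing near infinity. -/

/-- A continuous periodic function all of whose Fourier coefficients vanish is zero. -/
lemma eq_zero_of_integral_mul_fourierFactor_eq_zero {f : ℝ → ℂ} (hf : Continuous f)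
    (hp : Function.Periodic f (2 * Real.pi))
    (h : ∀ n : ℤ, ∫ θ in (0 : ℝ)..(2 * Real.pi), f θ * fourierFactor n θ = 0) (θ : ℝ) :
    f θ = 0 := by
  have : Fact (0 < 2 * Real.pi) := ⟨by positivity⟩
  let F : C(AddCircle (2 * Real.pi), ℂ) := ⟨hp.lift, continuous_coinduced_dom.mpr hf⟩
  have hF : ∀ n, fourierCoeff F n = 0 := by
    intro n
    rw [fourierCoeff_eq_intervalIntegral F n 0, zero_add]
    have : (∫ x in (0 : ℝ)..(2 * Real.pi), fourier (-n) (x : AddCircle (2 * Real.pi)) • F x) =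
        ∫ x in (0 : ℝ)..(2 * Real.pi), f x * fourierFactor n x := by
      refine intervalIntegral.integral_congr fun x _ => ?_
      have h1 : F (x : AddCircle (2 * Real.pi)) = f x := hp.lift_coe x
      simp only [h1]
      rw [fourier_coe_apply, smul_eq_mul, mul_comm, fourierFactor]
      congr 2
      have : (Real.pi : ℂ) ≠ 0 := by exact_mod_cast Real.pi_ne_zero
      push_cast
      field_simp
    rw [this, h n, smul_zero]
  -- Zero coefficients are summable, so pointwise Fourier inversion applies to a merely continuous
  -- function.
  have h2 := has_pointwise_sum_fourier_series_of_summable (f := F)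
    (by rw [funext hF]; exact summable_zero) (θ : AddCircle (2 * Real.pi))
  simp only [hF, zero_smul] at h2
  exact (hp.lift_coe θ).symm.trans (h2.unique hasSum_zero)

lemma polarPt_periodic (r : ℝ) : Function.Periodic (polarPt r) (2 * Real.pi) := fun θ => by
  simp [polarPt]

lemma toComplex_injective : Function.Injective toComplex := fun x y h => by
  have := norm_toComplex (x - y)
  rw [toComplex_sub, h, sub_self, norm_zero, eq_comm, norm_eq_zero, sub_eq_zero] at this
  exact this

lemma exists_eq_polarPt (x : Plane) : ∃ θ, x = polarPt ‖x‖ θ := by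
  refine ⟨(toComplex x).arg, toComplex_injective ?_⟩
  rw [toComplex_polarPt, circlePt, ← norm_toComplex, Complex.norm_mul_exp_arg_mul_I]

/-- The Cauchy-Schwarz inequality for Fourier coefficients. -/
lemma norm_integral_mul_fourierFactor_sq_le {f : ℝ → ℂ} (hf : Continuous f) (n : ℤ) :
    ‖∫ θ in (0 : ℝ)..(2 * Real.pi), f θ * fourierFactor n θ‖ ^ 2 ≤
      2 * Real.pi * ∫ θ in (0 : ℝ)..(2 * Real.pi), ‖f θ‖ ^ 2 := by
  have hpi : (0 : ℝ) ≤ 2 * Real.pi := by positivity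
  have hn : ∀ θ, ‖fourierFactor n θ‖ = 1 := fun θ => by
    rw [fourierFactor]
    have : ((-n : ℤ) : ℂ) * ((θ : ℂ) * Complex.I) = (((-n : ℤ) * θ : ℝ) : ℂ) * Complex.I := by
      push_cast; ring
    rw [this, Complex.norm_exp_ofReal_mul_I]
  set N := ∫ θ in (0 : ℝ)..(2 * Real.pi), ‖f θ‖ with hN
  have h1 : ‖∫ θ in (0 : ℝ)..(2 * Real.pi), f θ * fourierFactor n θ‖ ≤ N := by
    refine (intervalIntegral.norm_integral_le_integral_norm hpi).trans_eq ?_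
    refine intervalIntegral.integral_congr fun θ _ => ?_
    simp only [norm_mul, hn, mul_one]
  -- The variance of `‖f‖` about its mean `N / (2π)` is nonnegative, which is Cauchy-Schwarz against
  -- the constant function.
  have h2 : 0 ≤ ∫ θ in (0 : ℝ)..(2 * Real.pi), (2 * Real.pi * ‖f θ‖ - N) ^ 2 :=
    intervalIntegral.integral_nonneg hpi fun θ _ => sq_nonneg _
  have h3 : ∫ θ in (0 : ℝ)..(2 * Real.pi), (2 * Real.pi * ‖f θ‖ - N) ^ 2 =
      (2 * Real.pi) ^ 2 * (∫ θ in (0 : ℝ)..(2 * Real.pi), ‖f θ‖ ^ 2) -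
        2 * Real.pi * N ^ 2 := by
    have e : ∀ θ, (2 * Real.pi * ‖f θ‖ - N) ^ 2 = (2 * Real.pi) ^ 2 * ‖f θ‖ ^ 2 -
        (4 * Real.pi * N) * ‖f θ‖ + N ^ 2 := fun θ => by ring
    simp only [e]
    have i1 : IntervalIntegrable (fun θ => (2 * Real.pi) ^ 2 * ‖f θ‖ ^ 2) volume 0
      (2 * Real.pi) := (by fun_prop : Continuous _).intervalIntegrable _ _
    have i2 : IntervalIntegrable (fun θ => (4 * Real.pi * N) * ‖f θ‖) volume 0
      (2 * Real.pi) := (by fun_prop : Continuous _).intervalIntegrable _ _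
    rw [intervalIntegral.integral_add (i1.sub i2) intervalIntegrable_const,
      intervalIntegral.integral_sub i1 i2, intervalIntegral.integral_const_mul,
      intervalIntegral.integral_const_mul, intervalIntegral.integral_const, ← hN]
    simp only [sub_zero, smul_eq_mul]
    ring
  have h4 : N ^ 2 ≤ 2 * Real.pi * ∫ θ in (0 : ℝ)..(2 * Real.pi), ‖f θ‖ ^ 2 := by
    have : 0 < 2 * Real.pi := by positivity
    nlinarith
  exact (pow_le_pow_left₀ (norm_nonneg _) h1 2).trans h4

lemma ae_mem_closedBall_exteriorMeasure (D : Set Plane) (R : ℝ) :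
    ∀ᵐ y ∂(exteriorMeasure D R), y ∈ Metric.closedBall (0 : Plane) R :=
  (ae_restrict_mem (Metric.isOpen_ball.measurableSet.diff
    isClosed_closure.measurableSet)).mono fun _ hy => Metric.ball_subset_closedBall hy.1

lemma ae_mem_boundaryMeasure (D : Set Plane) : ∀ᵐ y ∂(boundaryMeasure D), y ∈ frontier D :=
  ae_restrict_mem isClosed_frontier.measurableSet

/-- The Fourier coefficients of an outgoing solution on large circles are multiples of the
outgoing radial functions. -/
lemma exists_fourier_outgoing {D : Set Plane} (hD : IsLipschitzDomain D) {k : ℂ} (hk : k ≠ 0)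
    {u : Plane → ℂ} (hout : IsOutgoing D k u) :
    ∃ R > 0, closure D ⊆ Metric.ball 0 R ∧ ∀ n : ℤ, ∃ A : ℂ, ∀ r > R,
      ∫ θ in (0 : ℝ)..(2 * Real.pi), u (polarPt r θ) * fourierFactor n θ =
        outgoingRadial k n r * A := by
  have := isFiniteMeasure_boundaryMeasure hD
  obtain ⟨R, hR, hDR, a, b, c, b', c', ha, hb, hc, hb', hc', hu⟩ :=
    exists_potential_representation hD hk hout
  refine ⟨R, hR, hDR, fun n => ?_⟩
  obtain ⟨A, hA⟩ := exists_fourier_potential k hR.le (ae_mem_closedBall_exteriorMeasure D R)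
    ha hb hc n
  obtain ⟨B, hB⟩ := exists_fourier_potential k hR.le ((ae_mem_boundaryMeasure D).mono
    fun y hy => Metric.ball_subset_closedBall (hDR (frontier_subset_closure hy)))
    (a := 0) (integrable_zero _ _ _) hb' hc' n
  refine ⟨Complex.I / 4 * (A + B), fun r hr => ?_⟩
  have e : ∀ θ, u (polarPt r θ) * fourierFactor n θ = Complex.I / 4 *
      ((∫ y, potentialDensity k a b c (polarPt r θ) y ∂(exteriorMeasure D R)) *
        fourierFactor n θ + (∫ y, potentialDensity k 0 b' c' (polarPt r θ) y
          ∂(boundaryMeasure D)) * fourierFactor n θ) := fun θ => by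
    rw [hu _ (by rw [norm_polarPt (hR.trans hr).le]; exact hr)]
    ring
  simp only [e]
  rw [intervalIntegral.integral_const_mul, intervalIntegral.integral_add (hA r hr).1 (hB r hr).1,
    (hA r hr).2, (hB r hr).2]
  ring

/-- Outgoing solutions which decay faster than the outgoing radial functions vanish near
infinity. -/
lemma exists_eq_zero_of_lt_norm {D : Set Plane} (hD : IsLipschitzDomain D) {k : ℂ} (hk : k ≠ 0)
    {u : Plane → ℂ} (hu : ContinuousOn u (closure D)ᶜ) (hout : IsOutgoing D k u)
    (hdecay : Tendsto (fun r : ℝ => Real.exp (2 * (k * (r : ℂ)).im) * circleSqIntegral u r)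
      atTop (𝓝 0)) :
    ∃ R > 0, closure D ⊆ Metric.ball 0 R ∧ ∀ x, R < ‖x‖ → u x = 0 := by
  obtain ⟨R, hR, hDR, hA⟩ := exists_fourier_outgoing hD hk hout
  have hcont : ∀ r > R, Continuous fun θ => u (polarPt r θ) := by
    intro r hr
    refine continuousOn_univ.mp (hu.comp (continuous_polarPt r).continuousOn fun θ _ hθ => ?_)
    have := hDR hθ
    rw [Metric.mem_ball, dist_zero_right, norm_polarPt (hR.trans hr).le] at this
    linarith
  have hzero : ∀ n : ℤ, ∀ r > R,
      ∫ θ in (0 : ℝ)..(2 * Real.pi), u (polarPt r θ) * fourierFactor n θ = 0 := by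
    intro n
    obtain ⟨A, hA⟩ := hA n
    suffices h : A = 0 by
      intro r hr
      rw [hA r hr, h, mul_zero]
    by_contra hne
    refine not_tendsto_exp_mul_hankelSqDeriv hk n.natAbs ?_
    -- If `A ≠ 0`, Cauchy-Schwarz bounds the radial function by the circle integral with exactly
    -- this constant.
    have hlim := hdecay.const_mul (2 * Real.pi / ‖A‖ ^ 2)
    rw [mul_zero] at hlim
    refine squeeze_zero' (g := fun r : ℝ => 2 * Real.pi / ‖A‖ ^ 2 *
      (Real.exp (2 * (k * (r : ℂ)).im) * circleSqIntegral u r)) ?_ ?_ hlim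
    · filter_upwards [eventually_gt_atTop R] with r hr
      have : 0 < r := hR.trans hr
      positivity
    · filter_upwards [eventually_gt_atTop R] with r hr
      have hr0 : 0 < r := hR.trans hr
      have hA0 : 0 < ‖A‖ ^ 2 := by positivity
      have h1 := norm_integral_mul_fourierFactor_sq_le (hcont r hr) n
      rw [hA r hr, norm_mul, mul_pow, outgoingRadial] at h1
      have h2 : circleSqIntegral u r =
          (∫ θ in (0 : ℝ)..(2 * Real.pi), ‖u (polarPt r θ)‖ ^ 2) * r := by
        rw [← intervalIntegral.integral_mul_const]
        rfl
      have h3 : (k * (r : ℂ)).im = k.im * r := by simp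
      rw [h2, h3, div_mul_eq_mul_div, le_div_iff₀ hA0, mul_assoc 2 k.im r]
      have h4 : 0 ≤ Real.exp (2 * (k.im * r)) * r := by positivity
      linear_combination mul_le_mul_of_nonneg_left h1 h4
  refine ⟨R, hR, hDR, fun x hx => ?_⟩
  obtain ⟨θ, hθ⟩ := exists_eq_polarPt x
  rw [hθ]
  exact eq_zero_of_integral_mul_fourierFactor_eq_zero (hcont _ hx)
    ((polarPt_periodic _).comp u) (fun n => hzero n _ hx) θ

/-! ### Unique continuation through Bessel's equation on small disks. -/

lemma polarPt_eq_smul (r θ : ℝ) : polarPt r θ = r • polarPt 1 θ := by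
  ext i; fin_cases i <;> simp [polarPt]

lemma polarPt_one_eq (θ : ℝ) : polarPt 1 θ = Real.cos θ • EuclideanSpace.single (0 : Fin 2) (1 : ℝ) +
    Real.sin θ • EuclideanSpace.single (1 : Fin 2) (1 : ℝ) := by
  ext i; fin_cases i <;> simp [polarPt]

lemma hasDerivAt_polarPt (r θ : ℝ) :
    HasDerivAt (polarPt r) (polarPt r (θ + Real.pi / 2)) θ := by
  have h : polarPt r = fun θ => r • (Real.cos θ • EuclideanSpace.single (0 : Fin 2) (1 : ℝ) +
      Real.sin θ • EuclideanSpace.single (1 : Fin 2) (1 : ℝ)) := by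
    funext θ; rw [polarPt_eq_smul, polarPt_one_eq]
  rw [h]
  simp only [Real.cos_add_pi_div_two, Real.sin_add_pi_div_two]
  exact (((Real.hasDerivAt_cos θ).smul_const _).add
    ((Real.hasDerivAt_sin θ).smul_const _)).const_smul r

lemma hasDerivAt_fourierFactor (n : ℤ) (θ : ℝ) :
    HasDerivAt (fourierFactor n) (-(n * Complex.I) * fourierFactor n θ) θ := by
  have h := (((Complex.ofRealCLM.hasDerivAt (x := θ)).mul_const Complex.I).const_mul
    ((-n : ℤ) : ℂ)).cexp
  refine h.congr_deriv ?_
  simp [fourierFactor]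
  ring

/-- The Laplacian is the sum of the second derivatives in the radial and angular directions. -/
lemma laplacian_eq_polar (u : Plane → ℂ) (x : Plane) (θ : ℝ) :
    Laplacian.laplacian u x = fderiv ℝ (fderiv ℝ u) x (polarPt 1 θ) (polarPt 1 θ) +
      fderiv ℝ (fderiv ℝ u) x (polarPt 1 (θ + Real.pi / 2)) (polarPt 1 (θ + Real.pi / 2)) := by
  have h := congrFun (InnerProductSpace.laplacian_eq_iteratedFDeriv_orthonormalBasis u
    (EuclideanSpace.basisFun (Fin 2) ℝ)) x
  rw [h]
  simp only [polarPt_one_eq, Real.cos_add_pi_div_two, Real.sin_add_pi_div_two,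
    Fin.sum_univ_two, iteratedFDeriv_two_apply, EuclideanSpace.basisFun_apply, map_add, map_smul,
    add_apply, smul_apply]
  simp only [Matrix.cons_val_zero, Matrix.cons_val_one, Complex.real_smul]
  have h2 : ((Real.cos θ : ℝ) : ℂ) ^ 2 + ((Real.sin θ : ℝ) : ℂ) ^ 2 = 1 := by
    exact_mod_cast Real.cos_sq_add_sin_sq θ
  push_cast at h2 ⊢
  linear_combination (-(fderiv ℝ (fderiv ℝ u) x (EuclideanSpace.single 0 1)
    (EuclideanSpace.single 0 1) + fderiv ℝ (fderiv ℝ u) x (EuclideanSpace.single 1 1)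
    (EuclideanSpace.single 1 1))) * h2

lemma hasFDerivAt_of_contDiffOn_two {u : Plane → ℂ} {U : Set Plane} (hU : IsOpen U)
    (hu : ContDiffOn ℝ 2 u U) {x : Plane} (hx : x ∈ U) :
    HasFDerivAt u (fderiv ℝ u x) x ∧ HasFDerivAt (fderiv ℝ u) (fderiv ℝ (fderiv ℝ u) x) x :=
  ⟨((hu.differentiableOn two_ne_zero).differentiableAt (hU.mem_nhds hx)).hasFDerivAt,
    (((hu.fderiv_of_isOpen (m := 1) hU (by norm_num)).differentiableOn
      one_ne_zero).differentiableAt (hU.mem_nhds hx)).hasFDerivAt⟩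

lemma continuousOn_fderiv_of_contDiffOn_two {u : Plane → ℂ} {U : Set Plane} (hU : IsOpen U)
    (hu : ContDiffOn ℝ 2 u U) :
    ContinuousOn (fderiv ℝ u) U ∧ ContinuousOn (fderiv ℝ (fderiv ℝ u)) U :=
  ⟨hu.continuousOn_fderiv_of_isOpen hU one_le_two,
    (hu.fderiv_of_isOpen (m := 1) hU (by norm_num)).continuousOn_fderiv_of_isOpen hU le_rfl⟩

lemma add_polarPt_mem_ball {q : Plane} {r ε : ℝ} (hr : r ∈ Ioo 0 ε) (θ : ℝ) :
    q + polarPt r θ ∈ Metric.ball q ε := by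
  rw [Metric.mem_ball, dist_eq_norm, add_sub_cancel_left, norm_polarPt hr.1.le]
  exact hr.2

lemma hasDerivAt_add_polarPt_radius (q : Plane) (r θ : ℝ) :
    HasDerivAt (fun r => q + polarPt r θ) (polarPt 1 θ) r := by
  have : (fun r => q + polarPt r θ) = fun r : ℝ => q + r • polarPt 1 θ := by
    funext r; rw [polarPt_eq_smul]
  rw [this]
  simpa using ((hasDerivAt_id r).smul_const (polarPt 1 θ)).const_add q

lemma continuous_add_polarPt (q : Plane) :
    Continuous fun p : ℝ × ℝ => q + polarPt p.1 p.2 := by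
  have : (fun p : ℝ × ℝ => q + polarPt p.1 p.2) = fun p => q + p.1 • polarPt 1 p.2 := by
    funext p; rw [polarPt_eq_smul]
  rw [this]
  fun_prop

/-- The first two radial derivatives of an angular Fourier coefficient. -/
lemma hasDerivAt_fourier_radius {u : Plane → ℂ} {q : Plane} {ε : ℝ}
    (hu : ContDiffOn ℝ 2 u (Metric.ball q ε)) (n : ℤ) {r : ℝ} (hr : r ∈ Ioo 0 ε) :
    HasDerivAt (fun r => ∫ θ in (0 : ℝ)..(2 * Real.pi), u (q + polarPt r θ) * fourierFactor n θ)
      (∫ θ in (0 : ℝ)..(2 * Real.pi), fderiv ℝ u (q + polarPt r θ) (polarPt 1 θ) *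
        fourierFactor n θ) r ∧
    HasDerivAt (fun r => ∫ θ in (0 : ℝ)..(2 * Real.pi),
        fderiv ℝ u (q + polarPt r θ) (polarPt 1 θ) * fourierFactor n θ)
      (∫ θ in (0 : ℝ)..(2 * Real.pi), fderiv ℝ (fderiv ℝ u) (q + polarPt r θ) (polarPt 1 θ)
        (polarPt 1 θ) * fourierFactor n θ) r := by
  obtain ⟨hG, hH⟩ := continuousOn_fderiv_of_contDiffOn_two Metric.isOpen_ball hu
  have hd := fun x hx => hasFDerivAt_of_contDiffOn_two (x := x) Metric.isOpen_ball hu hx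
  have hpc := continuous_add_polarPt q
  have hmaps : MapsTo (fun p : ℝ × ℝ => q + polarPt p.1 p.2) (Ioo 0 ε ×ˢ univ)
      (Metric.ball q ε) := fun p hp => add_polarPt_mem_ball hp.1 _
  have hec : Continuous fun p : ℝ × ℝ => polarPt 1 p.2 := (continuous_polarPt 1).comp continuous_snd
  have hφc : Continuous fun p : ℝ × ℝ => fourierFactor n p.2 := by fun_prop
  have hc1 : ContinuousOn (fun p : ℝ × ℝ => fderiv ℝ u (q + polarPt p.1 p.2) (polarPt 1 p.2) *
      fourierFactor n p.2) (Ioo 0 ε ×ˢ univ) :=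
    ((hG.comp hpc.continuousOn hmaps).clm_apply hec.continuousOn).mul hφc.continuousOn
  constructor
  · refine hasDerivAt_integral_period (𝕜 := ℝ) (F := fun r θ => u (q + polarPt r θ) *
      fourierFactor n θ) (F' := fun r θ => fderiv ℝ u (q + polarPt r θ) (polarPt 1 θ) *
      fourierFactor n θ) isOpen_Ioo
      ((hu.continuousOn.comp hpc.continuousOn hmaps).mul hφc.continuousOn) hc1
      (fun s hs θ => ?_) hr
    exact ((hd _ (add_polarPt_mem_ball hs θ)).1.comp_hasDerivAt s
      (hasDerivAt_add_polarPt_radius q s θ)).mul_const _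
  · refine hasDerivAt_integral_period (𝕜 := ℝ) (F := fun r θ =>
      fderiv ℝ u (q + polarPt r θ) (polarPt 1 θ) * fourierFactor n θ) (F' := fun r θ =>
      fderiv ℝ (fderiv ℝ u) (q + polarPt r θ) (polarPt 1 θ) (polarPt 1 θ) * fourierFactor n θ)
      isOpen_Ioo hc1 ((((hH.comp hpc.continuousOn hmaps).clm_apply hec.continuousOn).clm_apply
        hec.continuousOn).mul hφc.continuousOn) (fun s hs θ => ?_) hr
    have h1 : HasDerivAt (fun r => fderiv ℝ u (q + polarPt r θ))
        (fderiv ℝ (fderiv ℝ u) (q + polarPt s θ) (polarPt 1 θ)) s :=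
      (hd _ (add_polarPt_mem_ball hs θ)).2.comp_hasDerivAt s
        (hasDerivAt_add_polarPt_radius q s θ)
    have h2 : HasDerivAt (fun r => fderiv ℝ u (q + polarPt r θ) (polarPt 1 θ))
        (fderiv ℝ (fderiv ℝ u) (q + polarPt s θ) (polarPt 1 θ) (polarPt 1 θ)) s :=
      ((ContinuousLinearMap.apply ℝ ℂ (polarPt 1 θ)).hasFDerivAt.comp_hasDerivAt s h1)
    exact h2.mul_const _

/-- The angular Fourier coefficients of a solution of the Helmholtz equation in a disk satisfy
Bessel's equation. -/
lemma fourier_bessel_equation {k : ℂ} {u : Plane → ℂ} {q : Plane} {ε : ℝ}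
    (hu : ContDiffOn ℝ 2 u (Metric.ball q ε)) (hH : IsHelmholtzSolutionOn k u (Metric.ball q ε))
    (n : ℤ) {r : ℝ} (hr : r ∈ Ioo 0 ε) :
    (r : ℂ) ^ 2 * (∫ θ in (0 : ℝ)..(2 * Real.pi),
        fderiv ℝ (fderiv ℝ u) (q + polarPt r θ) (polarPt 1 θ) (polarPt 1 θ) * fourierFactor n θ) +
      r * (∫ θ in (0 : ℝ)..(2 * Real.pi), fderiv ℝ u (q + polarPt r θ) (polarPt 1 θ) *
        fourierFactor n θ) + (k ^ 2 * (r : ℂ) ^ 2 - n ^ 2) *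
        ∫ θ in (0 : ℝ)..(2 * Real.pi), u (q + polarPt r θ) * fourierFactor n θ = 0 := by
  obtain ⟨hG0, hH0⟩ := continuousOn_fderiv_of_contDiffOn_two Metric.isOpen_ball hu
  have hd := fun x hx => hasFDerivAt_of_contDiffOn_two (x := x) Metric.isOpen_ball hu hx
  set x : ℝ → Plane := fun θ => q + polarPt r θ
  have hx : ∀ θ, x θ ∈ Metric.ball q ε := add_polarPt_mem_ball hr
  set e : ℝ → Plane := polarPt 1
  set φ : ℝ → ℂ := fourierFactor n
  have hxc : Continuous x := by fun_prop
  have hecc : Continuous e := by fun_prop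
  have hφcc : Continuous φ := by fun_prop
  have hdx : ∀ θ, HasDerivAt x (r • e (θ + Real.pi / 2)) θ := fun θ => by
    rw [← polarPt_eq_smul]
    exact (hasDerivAt_polarPt r θ).const_add q
  have hde : ∀ θ, HasDerivAt (fun θ => e (θ + Real.pi / 2)) (-e θ) θ := fun θ => by
    have h := (hasDerivAt_polarPt 1 (θ + Real.pi / 2)).comp_add_const θ (Real.pi / 2)
    refine h.congr_deriv ?_
    simp only [e]
    rw [polarPt_one_eq, polarPt_one_eq, Real.cos_add_pi_div_two, Real.sin_add_pi_div_two,
      Real.sin_add_pi_div_two, Real.cos_add_pi_div_two]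
    module
  have hu0 : Continuous fun θ => u (x θ) :=
    continuousOn_univ.mp (hu.continuousOn.comp hxc.continuousOn fun θ _ => hx θ)
  have hu1 : Continuous fun θ => fderiv ℝ u (x θ) :=
    continuousOn_univ.mp (hG0.comp hxc.continuousOn fun θ _ => hx θ)
  have hu2 : Continuous fun θ => fderiv ℝ (fderiv ℝ u) (x θ) :=
    continuousOn_univ.mp (hH0.comp hxc.continuousOn fun θ _ => hx θ)
  have hlap : ∀ θ, fderiv ℝ (fderiv ℝ u) (x θ) (e (θ + Real.pi / 2)) (e (θ + Real.pi / 2)) =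
      -(k ^ 2 * u (x θ)) - fderiv ℝ (fderiv ℝ u) (x θ) (e θ) (e θ) := fun θ => by
    have h1 := hH _ (hx θ)
    rw [laplacian_eq_polar u (x θ) θ] at h1
    linear_combination h1
  -- `P = (∂_θ u) φ + i n u φ` packages two integrations by parts: `P' = (∂_θ² u + n² u) φ`. The
  -- Helmholtz equation in polar form replaces `∂_θ² u` by radial derivatives, and `∫ P' = 0` by
  -- periodicity.
  set P : ℝ → ℂ := fun θ => r * fderiv ℝ u (x θ) (e (θ + Real.pi / 2)) * φ θ +
    n * Complex.I * (u (x θ) * φ θ) with hP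
  have hdP : ∀ θ, HasDerivAt P (-((r : ℂ) ^ 2 * (fderiv ℝ (fderiv ℝ u) (x θ) (e θ) (e θ) * φ θ) +
      r * (fderiv ℝ u (x θ) (e θ) * φ θ) + (k ^ 2 * (r : ℂ) ^ 2 - n ^ 2) * (u (x θ) * φ θ))) θ := by
    intro θ
    have h1 := ((hd _ (hx θ)).2.comp_hasDerivAt θ (hdx θ)).clm_apply (hde θ)
    have h2 := (hd _ (hx θ)).1.comp_hasDerivAt θ (hdx θ)
    have h3 := hasDerivAt_fourierFactor n θ
    have h4 := ((h1.const_mul (r : ℂ)).mul h3).add ((h2.mul h3).const_mul (n * Complex.I))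
    refine h4.congr_deriv ?_
    simp only [map_smul, smul_apply, map_neg, Complex.real_smul]
    rw [hlap]
    simp only [Function.comp_apply, φ]
    linear_combination (-(n : ℂ) ^ 2 * u (x θ) * fourierFactor n θ) * Complex.I_sq
  have hi0 : Continuous fun θ => u (x θ) * φ θ := hu0.mul hφcc
  have hi1 : Continuous fun θ => fderiv ℝ u (x θ) (e θ) * φ θ := (hu1.clm_apply hecc).mul hφcc
  have hi2 : Continuous fun θ => fderiv ℝ (fderiv ℝ u) (x θ) (e θ) (e θ) * φ θ :=
    ((hu2.clm_apply hecc).clm_apply hecc).mul hφcc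
  have hj0 := (hi0.const_mul (k ^ 2 * (r : ℂ) ^ 2 - n ^ 2)).intervalIntegrable
    (μ := volume) 0 (2 * Real.pi)
  have hj1 := (hi1.const_mul (r : ℂ)).intervalIntegrable (μ := volume) 0 (2 * Real.pi)
  have hj2 := (hi2.const_mul ((r : ℂ) ^ 2)).intervalIntegrable (μ := volume) 0 (2 * Real.pi)
  have hint := intervalIntegral.integral_eq_sub_of_hasDerivAt
    (fun θ (_ : θ ∈ uIcc 0 (2 * Real.pi)) => hdP θ) ((hj2.add hj1).add hj0).neg
  have hper : P (2 * Real.pi) = P 0 := by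
    have h1 : x (2 * Real.pi) = x 0 := by
      simpa [x] using polarPt_periodic r 0
    have h2 : e (2 * Real.pi + Real.pi / 2) = e (0 + Real.pi / 2) := by
      rw [add_comm, zero_add]; exact polarPt_periodic 1 _
    have h3 : φ (2 * Real.pi) = φ 0 := by simpa using fourierFactor_periodic n 0
    simp only [hP]
    rw [h1, h2, h3]
  rw [hper, sub_self, intervalIntegral.integral_neg, neg_eq_zero,
    intervalIntegral.integral_add (hj2.add hj1) hj0, intervalIntegral.integral_add hj2 hj1,
    intervalIntegral.integral_const_mul, intervalIntegral.integral_const_mul,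
    intervalIntegral.integral_const_mul] at hint
  exact hint

/-- Uniqueness for Bessel's equation. -/
lemma eq_zero_of_bessel_equation {k c : ℂ} {v v' v'' : ℝ → ℂ} {ε δ : ℝ} (hδ : 0 < δ)
    (h : ∀ r ∈ Ioo 0 ε, HasDerivAt v (v' r) r ∧ HasDerivAt v' (v'' r) r ∧
      (r : ℂ) ^ 2 * v'' r + r * v' r + (k ^ 2 * (r : ℂ) ^ 2 - c) * v r = 0)
    (hv : ∀ r ∈ Ioo 0 δ, v r = 0) {r : ℝ} (hr : r ∈ Ioo 0 ε) : v r = 0 := by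
  rcases lt_or_ge r δ with hrδ | hrδ
  · exact hv r ⟨hr.1, hrδ⟩
  -- Both `v` and `v'` vanish at `a`, which is away from the singular point `0`. On `[a, r]` the
  -- equation is a first-order system for `(v, v')` with bounded coefficients, so Grönwall's
  -- inequality applies.
  set a := δ / 2 with ha
  have ha0 : 0 < a := by positivity
  have har : a < r := by linarith
  have hsub : ∀ t ∈ Icc a r, t ∈ Ioo 0 ε := fun t ht => ⟨ha0.trans_le ht.1, ht.2.trans_lt hr.2⟩
  have haI : a ∈ Icc a r := left_mem_Icc.mpr har.le
  have hva : v a = 0 := hv a ⟨ha0, by linarith⟩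
  have hv'a : v' a = 0 := by
    have h1 : v =ᶠ[𝓝 a] fun _ => 0 := by
      filter_upwards [Ioo_mem_nhds ha0 (show a < δ by linarith)] with t ht using hv t ht
    exact ((h a (hsub a haI)).1.congr_of_eventuallyEq h1.symm).unique (hasDerivAt_const a 0)
  set K : ℝ := 1 + 1 / a + (‖k‖ ^ 2 + ‖c‖ / a ^ 2)
  have hK := norm_le_gronwallBound_of_norm_deriv_right_le (f := fun t => (v t, v' t))
    (f' := fun t => (v' t, v'' t)) (δ := 0) (K := K) (ε := 0) (a := a) (b := r)
    (fun t ht => (((h t (hsub t ht)).1.continuousAt.prodMk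
      (h t (hsub t ht)).2.1.continuousAt)).continuousWithinAt)
    (fun t ht => ((h t (hsub t (Ico_subset_Icc_self ht))).1.prodMk
      (h t (hsub t (Ico_subset_Icc_self ht))).2.1).hasDerivWithinAt)
    (by simp [hva, hv'a]) ?_ r (right_mem_Icc.mpr har.le)
  · rw [gronwallBound_ε0_δ0] at hK
    exact (Prod.ext_iff.mp (norm_le_zero_iff.mp hK)).1
  · intro t ht
    have htI := hsub t (Ico_subset_Icc_self ht)
    have ht0 : (t : ℂ) ≠ 0 := by exact_mod_cast htI.1.ne'
    have hd := (h t htI).2.2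
    have h2 : v'' t = -(1 / (t : ℂ) * v' t + (k ^ 2 - c / (t : ℂ) ^ 2) * v t) := by
      field_simp
      linear_combination hd
    have hN1 : ‖v t‖ ≤ ‖(v t, v' t)‖ := norm_fst_le (v t, v' t)
    have hN2 : ‖v' t‖ ≤ ‖(v t, v' t)‖ := norm_snd_le (v t, v' t)
    set N := ‖(v t, v' t)‖
    have hN : 0 ≤ N := norm_nonneg _
    have hta : 1 / t ≤ 1 / a := one_div_le_one_div_of_le ha0 ht.1
    have htc : ‖c‖ / t ^ 2 ≤ ‖c‖ / a ^ 2 := by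
      have := ht.1
      gcongr
    have h3 : ‖v'' t‖ ≤ (1 / a + (‖k‖ ^ 2 + ‖c‖ / a ^ 2)) * N := by
      rw [h2, norm_neg, add_mul]
      refine (norm_add_le _ _).trans (add_le_add ?_ ?_)
      · rw [norm_mul, norm_div, norm_one, Complex.norm_real, Real.norm_of_nonneg htI.1.le]
        gcongr
      · rw [norm_mul]
        refine mul_le_mul ((norm_sub_le _ _).trans (add_le_add ?_ ?_)) hN1 (norm_nonneg _)
          (by positivity)
        · rw [norm_pow]
        · rw [norm_div, norm_pow, Complex.norm_real, Real.norm_of_nonneg htI.1.le]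
          exact htc
    rw [add_zero, Prod.norm_def, max_le_iff]
    have hKp : 0 ≤ 1 / a + (‖k‖ ^ 2 + ‖c‖ / a ^ 2) := by positivity
    constructor
    · refine hN2.trans ?_
      simp only [K]
      nlinarith [mul_nonneg hKp hN]
    · refine h3.trans ?_
      simp only [K]
      nlinarith

/-- A solution of the Helmholtz equation in a disk which vanishes near the centre is zero. -/
lemma eq_zero_of_eventuallyEq_zero_ball {k : ℂ} {u : Plane → ℂ} {q : Plane} {ε : ℝ}
    (hu : ContDiffOn ℝ 2 u (Metric.ball q ε)) (hH : IsHelmholtzSolutionOn k u (Metric.ball q ε))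
    (h0 : u =ᶠ[𝓝 q] 0) {y : Plane} (hy : y ∈ Metric.ball q ε) : u y = 0 := by
  rcases eq_or_ne y q with rfl | hyq
  · exact h0.eq_of_nhds
  obtain ⟨δ, hδ, hball⟩ := Metric.eventually_nhds_iff_ball.mp h0
  have hr : ‖y - q‖ ∈ Ioo 0 ε := ⟨norm_pos_iff.mpr (sub_ne_zero.mpr hyq), by
    rwa [Metric.mem_ball, dist_eq_norm] at hy⟩
  obtain ⟨θ, hθ⟩ := exists_eq_polarPt (y - q)
  set r := ‖y - q‖
  have hyθ : y = q + polarPt r θ := by rw [← hθ]; abel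
  rw [hyθ]
  refine eq_zero_of_integral_mul_fourierFactor_eq_zero (f := fun θ => u (q + polarPt r θ)) ?_ ?_
    (fun n => ?_) θ
  · exact continuousOn_univ.mp (hu.continuousOn.comp (by fun_prop) fun θ _ =>
      add_polarPt_mem_ball hr θ)
  · intro θ
    simp only [polarPt_periodic r θ]
  · refine eq_zero_of_bessel_equation hδ (fun s hs => ⟨(hasDerivAt_fourier_radius hu n hs).1,
      (hasDerivAt_fourier_radius hu n hs).2, fourier_bessel_equation hu hH n hs⟩)
      (fun s hs => ?_) hr
    have : ∀ θ, u (q + polarPt s θ) = 0 := fun θ => hball _ (by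
      rw [Metric.mem_ball, dist_eq_norm, add_sub_cancel_left, norm_polarPt hs.1.le]
      exact hs.2)
    simp [this]

/-- Unique continuation for the Helmholtz equation. -/
lemma eqOn_zero_of_eventuallyEq_zero {k : ℂ} {u : Plane → ℂ} {U : Set Plane} (hU : IsOpen U)
    (hUc : IsPreconnected U) (hu : ContDiffOn ℝ 2 u U) (hH : IsHelmholtzSolutionOn k u U)
    {q : Plane} (hq : q ∈ U) (h0 : u =ᶠ[𝓝 q] 0) : EqOn u 0 U := by
  have hS : IsOpen {x | u =ᶠ[𝓝 x] 0} := isOpen_setOfPred_eventually_nhds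
  have hsub : U ⊆ {x | u =ᶠ[𝓝 x] 0} := by
    refine hUc.subset_of_closure_inter_subset hS ⟨q, hq, h0⟩ ?_
    rintro x ⟨hx, hxU⟩
    obtain ⟨ε, hε, hball⟩ := Metric.isOpen_iff.mp hU x hxU
    -- The half radius makes the disk about `p` both lie inside `U` and contain the limit point `x`.
    obtain ⟨p, hp, hpx⟩ := Metric.mem_closure_iff.mp hx (ε / 2) (half_pos hε)
    have hpU : Metric.ball p (ε / 2) ⊆ U := fun z hz => hball (by
      rw [Metric.mem_ball] at hz ⊢
      linarith [dist_triangle z p x, dist_comm x p])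
    filter_upwards [Metric.isOpen_ball.mem_nhds (show x ∈ Metric.ball p (ε / 2) from hpx)]
      with z hz
    exact eq_zero_of_eventuallyEq_zero_ball (hu.mono hpU) (fun w hw => hH w (hpU hw)) hp hz
  exact fun x hx => (hsub hx).eq_of_nhds

end Scattering

theorem mainTheorem4 (D : Set Scattering.Plane) (hD : Scattering.IsLipschitzDomain D)
    (hext : IsConnected (closure D)ᶜ)
    (k : ℂ) (hk : k ∈ Complex.slitPlane)
    (u : Scattering.Plane → ℂ) (hu : ContDiffOn ℝ 2 u (closure D)ᶜ)
    (hHelm : Scattering.IsHelmholtzSolutionOn k u (closure D)ᶜ)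
    (hout : Scattering.IsOutgoing D k u)
    (hdecay : Filter.Tendsto
      (fun r : ℝ => Real.exp (2 * (k * (r : ℂ)).im) * Scattering.circleSqIntegral u r)
      Filter.atTop (nhds 0)) :
    ∀ x ∈ (closure D)ᶜ, u x = 0 := by
  obtain ⟨R, hR, hDR, hzero⟩ := Scattering.exists_eq_zero_of_lt_norm hD
    (Complex.slitPlane_ne_zero hk) hu.continuousOn hout hdecay
  have hq : ‖Scattering.polarPt (R + 1) 0‖ = R + 1 := Scattering.norm_polarPt (by linarith) 0
  refine Scattering.eqOn_zero_of_eventuallyEq_zero (q := Scattering.polarPt (R + 1) 0)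
    isClosed_closure.isOpen_compl hext.isPreconnected hu hHelm (fun h => ?_) ?_
  · have := hDR h
    rw [Metric.mem_ball, dist_zero_right] at this
    linarith
  · filter_upwards [(isOpen_lt continuous_const continuous_norm).mem_nhds
      (show Scattering.polarPt (R + 1) 0 ∈ {z : Scattering.Plane | R < ‖z‖} by
        rw [mem_ofPred_eq, hq]; linarith)] with z hz using hzero z hz
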